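/- Links are unoriented links in $S^3$, considered up to ambient isotopy. A $\pm5$-move inserts five right-handed (respectively left-handed) half twists into two parallel strands of a diagram; two links are *5-move equivalent* if they are related by a finite sequence of $\pm5$-moves and isotopies. For $x\in\mathbb{Q}\cup\{\infty\}$ let $[x]$ be Conway's rational tangle (so $[\frac1n]$ is a vertical column of $n$ right-handed half twists, and $[\infty]=[\frac10]$ consists of two vertical strands), and let $M_{[x_1,\dots,x_k]}$ be the Montesinos link obtained by placing $[x_1],\dots,[x_k]$ side by side and taking the numerator closure. We write $n[x]$ for $n$ consecutive columns $[x]$. Let $T_1$ be the trivial knot, $T_2$ the trivial link of two components, $H$ the Hopf link and $4_1$ the figure eight knot. **Theorem 5.1.** Consider the following families of links. (i) The pretzel links $M_{[m[\frac12],[s]]}$ with integers $m\ge 3$ and $-2\le s\le 2$. (ii) The Montesinos links $M_{[y_1,\dots,y_{k+m}]}$ with $k\ge1$, $m\ge 0$, $k+m\ge3$, such that $(y_1,\dots,y_{k+m})$ is a permutation of $k$ copies of $\frac25$ and $m$ copies of $\frac12$ (that is, up to permutation of columns, $M_{[k[\frac25],m[\frac12]]}$). (iii) All connected sums, formed in any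 manner, of any number of copies of $T_2$, $H$ and $4_1$ (the sum of no copies is $T_1$). Then: (1) Every Montesinos link $M_{[\frac{p_1}{q_1},\dots,\frac{p_k}{q_k}]}$ is 5-move equivalent to a link of family (i), (ii) or (iii). (2) Two links of family (i) with different parameters $(m,s)$ are not 5-move equivalent. Two links of family (ii) with different parameters $(k,m)$ are not 5-move equivalent, whatever the orders of their columns. No link of family (i) is 5-move equivalent to a link of family (ii), and no link of family (i) or (ii) is 5-move equivalent to a link of family (iii). -/

import Mathlib

namespace FiveMove

/-! ## Unoriented tangle and link diagrams

A tangle diagram in the plane strip is put in general position with respect to the height and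
recorded, from bottom to top, as the list of its elementary pieces: local minima, local maxima and
crossings.  Positions are counted from the left, starting with `0`. -/

/-- The elementary pieces.  `cup` is a local minimum (it creates two neighbouring strands), `cap` is
a local maximum (it joins two neighbouring strands), `cross b` is a crossing of two neighbouring
strands.  In `cross true` the strand that runs from the bottom left to the top right is the
overcrossing one (a right-handed vertical half twist); in `cross false` it is the undercrossing
one. -/
inductive Piece
  | cup
  | cap
  | cross (b : Bool)
  deriving DecidableEq

/-- The number of strands that enter a piece from below. -/
def Piece.dom : Piece → ℕ
  | .cup => 0
  | .cap => 2
  | .cross _ => 2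

/-- The number of strands that leave a piece at the top. -/
def Piece.cod : Piece → ℕ
  | .cup => 2
  | .cap => 0
  | .cross _ => 2

/-- A slice `(i, e)` of a diagram: the piece `e`, with `i` vertical strands to its left (and any
number of vertical strands to its right). -/
abbrev Slice := ℕ × Piece

/-- The number of strands above a list of slices that is placed on top of `n` strands, and `none`
if the slices do not fit. -/
def target : List Slice → ℕ → Option ℕ
  | [], n => some n
  | (i, e) :: w, n => if i + e.dom ≤ n then target w (n - e.dom + e.cod) else none

theorem target_append (u v : List Slice) (n : ℕ) :
    target (u ++ v) n = (target u n).bind (target v) := by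
  induction u generalizing n with
  | nil => simp [target]
  | cons a u ih =>
    obtain ⟨i, e⟩ := a
    simp only [List.cons_append, target]
    split_ifs <;> simp [ih]

/-- Put `i` vertical strands to the left of a diagram. -/
def shift (i : ℕ) (w : List Slice) : List Slice := w.map fun x => (i + x.1, x.2)

theorem target_shift (i j : ℕ) (w : List Slice) (m n : ℕ) (h : target w m = some n) :
    target (shift i w) (i + m + j) = some (i + n + j) := by
  induction w generalizing m with
  | nil => simp_all [target, shift]
  | cons a w ih =>
    obtain ⟨k, e⟩ := a
    simp only [target] at h
    split_ifs at h with hk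
    have := ih _ h
    simp only [shift, List.map_cons, target]
    rw [if_pos (by omega)]
    rw [show i + m + j - e.dom + e.cod = i + (m - e.dom + e.cod) + j by omega]
    exact this

/-- Diagrams of unoriented tangles with `m` end points at the bottom and `n` at the top. -/
@[ext]
structure Tangle (m n : ℕ) where
  word : List Slice
  valid : target word m = some n

/-- Diagrams of unoriented links. -/
abbrev LinkDiagram := Tangle 0 0

namespace Tangle

/-- Vertical composition: `T` is placed on top of `S`. -/
def comp {a b c : ℕ} (S : Tangle a b) (T : Tangle b c) : Tangle a c :=
  ⟨S.word ++ T.word, by rw [target_append, S.valid]; exact T.valid⟩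

/-- Add `i` vertical strands to the left and `j` vertical strands to the right. -/
def whisker {a b : ℕ} (i : ℕ) (T : Tangle a b) (j : ℕ) : Tangle (i + a + j) (i + b + j) :=
  ⟨shift i T.word, target_shift i j _ _ _ T.valid⟩

end Tangle

/-! ## Isotopy and 5-moves -/

/-- The local moves on diagrams in general position which generate isotopy of unoriented tangles:
the planar ones (interchange of the heights of two distant pieces, cancellation of a local minimum
against a local maximum, a strand that passes a local extremum) and the three Reidemeister moves. -/
inductive IsotopyMove : List Slice → List Slice → Prop
  | exchange (i d : ℕ) (e f : Piece) :
      IsotopyMove [(i, e), (i + e.cod + d, f)] [(i + e.dom + d, f), (i, e)]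
  | zigzag_left (i : ℕ) : IsotopyMove [(i, .cup), (i + 1, .cap)] []
  | zigzag_right (i : ℕ) : IsotopyMove [(i + 1, .cup), (i, .cap)] []
  | slide_cup (i : ℕ) (b : Bool) :
      IsotopyMove [(i + 1, .cup), (i, .cross b)] [(i, .cup), (i + 1, .cross (!b))]
  | slide_cap (i : ℕ) (b : Bool) :
      IsotopyMove [(i, .cross b), (i + 1, .cap)] [(i + 1, .cross (!b)), (i, .cap)]
  | reidemeister_one_cup (i : ℕ) (b : Bool) :
      IsotopyMove [(i, .cup), (i, .cross b)] [(i, .cup)]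
  | reidemeister_one_cap (i : ℕ) (b : Bool) :
      IsotopyMove [(i, .cross b), (i, .cap)] [(i, .cap)]
  | reidemeister_two (i : ℕ) (b : Bool) :
      IsotopyMove [(i, .cross b), (i, .cross (!b))] []
  | reidemeister_three (i : ℕ) (b : Bool) :
      IsotopyMove [(i, .cross b), (i + 1, .cross b), (i, .cross b)]
        [(i + 1, .cross b), (i, .cross b), (i + 1, .cross b)]

/-- A 5-move or a (-5)-move: five half twists of the same handedness are inserted into two parallel
strands. -/
inductive FiveTwist : List Slice → List Slice → Prop
  | insert (i : ℕ) (b : Bool) : FiveTwist [] (List.replicate 5 (i, .cross b))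

/-- `T` and `T'` agree outside of a part in which they differ by one of the moves `R`. -/
def LocalMove (R : List Slice → List Slice → Prop) {m n : ℕ} (T T' : Tangle m n) : Prop :=
  ∃ u v l r, R l r ∧ T.word = u ++ l ++ v ∧ T'.word = u ++ r ++ v

/-- Two diagrams represent isotopic tangles (links, if there are no end points). -/
def Isotopic {m n : ℕ} : Tangle m n → Tangle m n → Prop :=
  Relation.EqvGen (LocalMove IsotopyMove)

/-- 5-move equivalence: related by a finite sequence of isotopies and `±5`-moves. -/
def FiveMoveEquiv {m n : ℕ} : Tangle m n → Tangle m n → Prop :=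
  Relation.EqvGen (LocalMove fun l r => IsotopyMove l r ∨ FiveTwist l r)

/-! ## Rational tangles and Montesinos links

A 2-tangle is a tangle with end points SW, SE at the bottom and NW, NE at the top. -/

/-- The tangle `[0]`: two horizontal arcs. -/
def zeroTangle : Tangle 2 2 := ⟨[(0, .cap), (0, .cup)], rfl⟩

/-- The tangle `[∞] = [1/0]`: two vertical strands. -/
def inftyTangle : Tangle 2 2 := ⟨[], rfl⟩

/-- A single crossing: the tangle `[1]` for `true` and `[-1]` for `false`. -/
def crossing (b : Bool) : Tangle 2 2 := ⟨[(0, .cross b)], rfl⟩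

/-- The product `A * B` of two 2-tangles: `A` and `B` side by side, NE of `A` is joined to NW of `B`
and SE of `A` to SW of `B`. -/
def prod (A B : Tangle 2 2) : Tangle 2 2 :=
  ((⟨[(1, .cup)], rfl⟩ : Tangle 2 4).comp
    ((A.whisker 0 2 : Tangle 4 4).comp (B.whisker 2 0 : Tangle 4 4))).comp
      (⟨[(1, .cap)], rfl⟩ : Tangle 4 2)

/-- The product `T₁ * ⋯ * Tₖ`; the neutral element is `[0]`. -/
def prodList (l : List (Tangle 2 2)) : Tangle 2 2 := l.foldr prod zeroTangle

/-- The numerator closure: NW is joined to NE, and SW to SE. -/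
def numerator (T : Tangle 2 2) : LinkDiagram :=
  ((⟨[(0, .cup)], rfl⟩ : Tangle 0 2).comp T).comp (⟨[(0, .cap)], rfl⟩ : Tangle 2 0)

/-- The integer tangle `[a]`: a horizontal row of `|a|` crossings `[±1]`. -/
def horizontalTwist (a : ℤ) : Tangle 2 2 :=
  prodList (List.replicate a.natAbs (crossing (decide (0 ≤ a))))

/-- The tangle `[1/a]`: a vertical column of `|a|` crossings `[±1]`; `|a|` half twists, right-handed
if `a` is positive. -/
def verticalTwist (a : ℤ) : Tangle 2 2 :=
  (List.replicate a.natAbs (crossing (decide (0 ≤ a)))).foldr Tangle.comp inftyTangle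

/-- The two rational tangles `([x], [1/x])` given by the continued fraction
`x = a₀ + 1 / (a₁ + 1 / (a₂ + ⋯))`, where the value of the empty continued fraction is `∞`.
They are built from `[∞]` and `[0]` by the rules
`[a + 1/y] = [1/y] * [a]` and `[1/(a + 1/y)] =` (the tangle `[y]` below the column `[1/a]`). -/
def contFracTangle : List ℤ → Tangle 2 2 × Tangle 2 2
  | [] => (inftyTangle, zeroTangle)
  | a :: l => (prod (contFracTangle l).2 (horizontalTwist a),
      (contFracTangle l).1.comp (verticalTwist a))

/-- The continued fraction expansion of `p / q` by the Euclidean algorithm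
(`p / q = ⌊p / q⌋ + 1 / (q / (p mod q))`). -/
def contFrac (p : ℤ) (q : ℕ) : List ℤ :=
  if _h : q = 0 then [] else (p / q) :: contFrac q (p % q).toNat
termination_by q
decreasing_by
  have h1 : 0 ≤ p % q := Int.emod_nonneg _ (by exact_mod_cast _h)
  have h2 : p % q < q := Int.emod_lt_of_pos _ (by omega)
  omega

/-- The rational tangle `[x]` of Conway, for `x ∈ ℚ ∪ {∞}`. -/
def rationalTangle : OnePoint ℚ → Tangle 2 2
  | none => inftyTangle
  | some x => (contFracTangle (contFrac x.num x.den)).1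

/-- The Montesinos link `M[x₁, …, xₖ]`: the numerator closure of `[x₁] * ⋯ * [xₖ]`. -/
def montesinos (x : List (OnePoint ℚ)) : LinkDiagram :=
  numerator (prodList (x.map rationalTangle))

/-- The pretzel link `M[m[1/2], [s]]`: `m` columns `[1/2]` and a column `[s]`. -/
def halfPretzel (m : ℕ) (s : ℤ) : LinkDiagram :=
  montesinos (List.replicate m (((1 / 2 : ℚ)) : OnePoint ℚ) ++ [((s : ℚ) : OnePoint ℚ)])

/-- `x` is a list of `k` columns `2/5` and `m` columns `1/2`, in any order. -/
def IsColumnList (k m : ℕ) (x : List (OnePoint ℚ)) : Prop :=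
  x.Perm (List.replicate k (((2 / 5 : ℚ)) : OnePoint ℚ) ++
    List.replicate m (((1 / 2 : ℚ)) : OnePoint ℚ))

/-! ## Connected sums -/

/-- The standard closure of a tangle with one end point at the bottom and one at the top. -/
def closure (A : Tangle 1 1) : LinkDiagram :=
  ((⟨[(0, .cup)], rfl⟩ : Tangle 0 2).comp (A.whisker 0 1 : Tangle 2 2)).comp
    (⟨[(0, .cap)], rfl⟩ : Tangle 2 0)

/-- `L` is a connected sum of `L₁` and `L₂`, for some choice of the arcs along which it is formed:
cut open at these arcs, `L₁` and `L₂` become tangles with two end points, and `L` is the closure of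
their composition. -/
def IsConnectedSum (L₁ L₂ L : LinkDiagram) : Prop :=
  ∃ A B : Tangle 1 1, Isotopic L₁ (closure A) ∧ Isotopic L₂ (closure B) ∧
    Isotopic L (closure (A.comp B))

/-- The trivial knot `T₁`. -/
def trivialKnot : LinkDiagram := ⟨[(0, .cup), (0, .cap)], rfl⟩

/-- The trivial link `T₂` of two components. -/
def trivialLink₂ : LinkDiagram := ⟨[(0, .cup), (0, .cap), (0, .cup), (0, .cap)], rfl⟩

/-- The Hopf link `H`, as the closure of the braid `σ₁²`. -/
def hopfLink : LinkDiagram :=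
  ⟨[(0, .cup), (1, .cup), (0, .cross true), (0, .cross true), (1, .cap), (0, .cap)], rfl⟩

/-- The figure eight knot `4₁`, as the closure of the braid `(σ₁ σ₂⁻¹)²`. -/
def figureEight : LinkDiagram :=
  ⟨[(0, .cup), (1, .cup), (2, .cup), (0, .cross true), (1, .cross false), (0, .cross true),
    (1, .cross false), (2, .cap), (1, .cap), (0, .cap)], rfl⟩

/-- Connected sums of any number (possibly zero, which gives `T₁`) of copies of `T₂`, `H` and `4₁`,
formed in any manner. -/
inductive IsBasicSum : LinkDiagram → Prop
  | trivialKnot : IsBasicSum trivialKnot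
  | trivialLink₂ : IsBasicSum trivialLink₂
  | hopfLink : IsBasicSum hopfLink
  | figureEight : IsBasicSum figureEight
  | connectedSum {L₁ L₂ L : LinkDiagram} :
      IsBasicSum L₁ → IsBasicSum L₂ → IsConnectedSum L₁ L₂ L → IsBasicSum L

end FiveMove

open FiveMove

/-! Reduction to the three families. Bending one end of a 2-tangle upwards turns it into a tangle
with one end below and three above. A vertical half twist and a horizontal one then become the two
generators of the braid group on three strands. Up to 5-moves both generators have order dividing
five, and the orbit of `[∞]` is contained in twelve classes. The model is the action on nonzero
pairs `±(p, q)` modulo 5, with `b : x ↦ x - 1` and `a : x ↦ x / (x + 1)`. Representatives are `[∞]`,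
`[2/5]`, the five `[s]` and the five `[1/2] * [s]`; see `TwistAction.orbit_a` and `IsRat.cases`. In
the monoid of 2-tangle classes `[1/2]` commutes with single crossings (`half_commute`), and `[2/5]`
absorbs them (`special_mul`, `mul_special`). Hence a product without a factor `[∞]` has the normal
form of `prod_normalForm`. A factor `[∞]` splits the numerator into a connected sum of denominators,
and the denominators of the twelve classes are `T₁`, `T₂`, `H` and `4₁`. At most two columns again
lead to such a denominator.

Inequivalence. The Kauffman bracket is taken at `A` with `γ = A⁴ + A⁻⁴` a root of `γ² = γ + 1`. Five
half twists are then a power of `A`, so the bracket is invariant up to powers of `A`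
(`IsBracket.isInvariant`). It is computed through two characters of the algebra of 2-tangles. On
`[2/5]` the second character vanishes. On `[1/2]` the absolute values are `φ⁻¹, φ` for `γ = φ` and
`φ, φ⁻¹` for `γ = ψ`. The norms at `φ` and at `ψ` determine `(k, m)` in the second family and `m` in
the first, and they separate the families, except that `M[1/2, 1/2, 1/2, s]` is not separated from
`T₂` by the estimates used. That case is settled by a five-state spin model with weights `ζ^(u²)`
over `ZMod 11`, whose value is unchanged by all moves.

For fixed `m` the parameter `s` is read off from the phase. Evaluation over `ℂ × ℂ` at `(A, iA)`
gives the same unknown power of the variable in both coordinates. Comparison of the two restricts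
the factor at `A` to a tenth root of unity, the size of the dominant term forces it to be `1`, and
`-A⁴` of order five gives `s` modulo 5 (`halfPretzel_injective`). -/

namespace FiveMove

/-! ## Equivalence of words -/

/-- The local moves of isotopy and, if `p` holds, also the 5-moves. -/
def Mv (p : Prop) (l r : List Slice) : Prop := IsotopyMove l r ∨ (p ∧ FiveTwist l r)

/-- A local move between two words that lead from `n` to `k` strands. -/
def WordStep (p : Prop) (n k : ℕ) (w w' : List Slice) : Prop :=
  target w n = some k ∧ target w' n = some k ∧
    ∃ u v l r, Mv p l r ∧ w = u ++ l ++ v ∧ w' = u ++ r ++ v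

/-- The equivalence of words generated by the local moves. -/
def WordEquiv (p : Prop) (n k : ℕ) : List Slice → List Slice → Prop :=
  Relation.EqvGen (WordStep p n k)

/-- The equivalence of tangles generated by the local moves. -/
def TangleEquiv (p : Prop) {m n : ℕ} (T T' : Tangle m n) : Prop :=
  WordEquiv p m n T.word T'.word

variable {p : Prop} {n k : ℕ}

namespace WordEquiv

@[refl] theorem refl (w : List Slice) : WordEquiv p n k w w := Relation.EqvGen.refl _

@[symm] theorem symm {w w' : List Slice} (h : WordEquiv p n k w w') : WordEquiv p n k w' w :=
  Relation.EqvGen.symm _ _ h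

@[trans] theorem trans {w w' w'' : List Slice} (h : WordEquiv p n k w w')
    (h' : WordEquiv p n k w' w'') : WordEquiv p n k w w'' := Relation.EqvGen.trans _ _ _ h h'

instance : Trans (WordEquiv p n k) (WordEquiv p n k) (WordEquiv p n k) := ⟨trans⟩

theorem of_eq {w w' : List Slice} (h : w = w') : WordEquiv p n k w w' := h ▸ refl _

theorem mv {l r : List Slice} (h : IsotopyMove l r) (hl : target l n = some k)
    (hr : target r n = some k) : WordEquiv p n k l r :=
  Relation.EqvGen.rel _ _ ⟨hl, hr, [], [], l, r, .inl h, by simp, by simp⟩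

theorem five {l r : List Slice} (hp : p) (h : FiveTwist l r) (hl : target l n = some k)
    (hr : target r n = some k) : WordEquiv p n k l r :=
  Relation.EqvGen.rel _ _ ⟨hl, hr, [], [], l, r, .inr ⟨hp, h⟩, by simp, by simp⟩

theorem map {q : Prop} {n' k' : ℕ} (f : List Slice → List Slice)
    (hf : ∀ w w', WordStep p n k w w' → WordStep q n' k' (f w) (f w')) {w w' : List Slice}
    (h : WordEquiv p n k w w') : WordEquiv q n' k' (f w) (f w') := by
  induction h with
  | rel _ _ h => exact .rel _ _ (hf _ _ h)
  | refl _ => exact .refl _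
  | symm _ _ _ ih => exact ih.symm
  | trans _ _ _ _ _ ih ih' => exact ih.trans ih'

theorem pre {n' : ℕ} (x : List Slice) (hx : target x n' = some n) {w w' : List Slice}
    (h : WordEquiv p n k w w') : WordEquiv p n' k (x ++ w) (x ++ w') := by
  refine h.map (x ++ ·) ?_
  rintro _ _ ⟨h1, h2, u, v, l, r, hm, rfl, rfl⟩
  exact ⟨by simp only [target_append x, hx]; exact h1,
    by simp only [target_append x, hx]; exact h2, x ++ u, v, l, r, hm, by simp, by simp⟩

theorem suf {k' : ℕ} (y : List Slice) (hy : target y k = some k') {w w' : List Slice}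
    (h : WordEquiv p n k w w') : WordEquiv p n k' (w ++ y) (w' ++ y) := by
  refine h.map (· ++ y) ?_
  rintro _ _ ⟨h1, h2, u, v, l, r, hm, rfl, rfl⟩
  exact ⟨by rw [target_append _ y, h1]; exact hy,
    by rw [target_append _ y, h2]; exact hy, u, v ++ y, l, r, hm, by simp, by simp⟩

theorem ctx {n' k' : ℕ} (u : List Slice) {l r : List Slice} (v : List Slice)
    (h : WordEquiv p n k l r) (hu : target u n' = some n) (hv : target v k = some k') :
    WordEquiv p n' k' (u ++ (l ++ v)) (u ++ (r ++ v)) :=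
  (h.suf v hv).pre u hu

end WordEquiv

@[simp] theorem shift_nil (i : ℕ) : shift i [] = [] := rfl

@[simp] theorem shift_cons (i j : ℕ) (e : Piece) (w : List Slice) :
    shift i ((j, e) :: w) = (i + j, e) :: shift i w := rfl

@[simp] theorem shift_append (i : ℕ) (u v : List Slice) :
    shift i (u ++ v) = shift i u ++ shift i v := by simp [shift]

@[simp] theorem shift_shift (i j : ℕ) (w : List Slice) :
    shift i (shift j w) = shift (i + j) w := by simp [shift, Function.comp_def, add_assoc]

@[simp] theorem shift_zero (w : List Slice) : shift 0 w = w := by simp [shift]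

theorem shift_replicate (i j n : ℕ) (e : Piece) :
    shift i (List.replicate n (j, e)) = List.replicate n (i + j, e) := by simp [shift]

theorem IsotopyMove.shift (j : ℕ) {l r : List Slice} (h : IsotopyMove l r) :
    IsotopyMove (shift j l) (shift j r) := by
  cases h with
  | exchange i d e f =>
    simp only [shift_cons, shift_nil]
    rw [← add_assoc, ← add_assoc, ← add_assoc, ← add_assoc]
    exact .exchange _ _ _ _
  | zigzag_left i => exact .zigzag_left (j + i)
  | zigzag_right i => exact .zigzag_right (j + i)
  | slide_cup i b => exact .slide_cup (j + i) b
  | slide_cap i b => exact .slide_cap (j + i) b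
  | reidemeister_one_cup i b => exact .reidemeister_one_cup (j + i) b
  | reidemeister_one_cap i b => exact .reidemeister_one_cap (j + i) b
  | reidemeister_two i b => exact .reidemeister_two (j + i) b
  | reidemeister_three i b => exact .reidemeister_three (j + i) b

theorem Mv.shift (j : ℕ) {l r : List Slice} (h : Mv p l r) : Mv p (shift j l) (shift j r) := by
  rcases h with h | ⟨hp, h⟩
  · exact .inl (h.shift j)
  · cases h with
    | insert i b => rw [shift_replicate]; exact .inr ⟨hp, .insert _ _⟩

theorem WordEquiv.shift (i j : ℕ) {w w' : List Slice} (h : WordEquiv p n k w w') :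
    WordEquiv p (i + n + j) (i + k + j) (shift i w) (shift i w') := by
  refine h.map (FiveMove.shift i) ?_
  rintro _ _ ⟨h1, h2, u, v, l, r, hm, rfl, rfl⟩
  exact ⟨target_shift _ _ _ _ _ h1, target_shift _ _ _ _ _ h2, FiveMove.shift i u,
    FiveMove.shift i v, _, _, hm.shift i, by simp, by simp⟩

@[simp] theorem Tangle.target_word {a b : ℕ} (T : Tangle a b) {N : ℕ} (h : a ≤ N) :
    target T.word N = some (N - a + b) := by
  have := target_shift 0 (N - a) _ _ _ T.valid
  rw [shift_zero] at this
  rw [show N = 0 + a + (N - a) by omega, this]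
  congr 1; omega

@[simp] theorem Tangle.target_shift_word {a b i : ℕ} (T : Tangle a b) {N : ℕ} (h : i + a ≤ N) :
    target (shift i T.word) N = some (N - a + b) := by
  have := target_shift i (N - (i + a)) _ _ _ T.valid
  rw [show N = i + a + (N - (i + a)) by omega, this]
  congr 1; omega

@[simp] theorem Tangle.word_comp {a b c : ℕ} (S : Tangle a b) (T : Tangle b c) :
    (S.comp T).word = S.word ++ T.word := rfl

@[simp] theorem Tangle.word_whisker {a b : ℕ} (i j : ℕ) (T : Tangle a b) :
    (T.whisker i j).word = shift i T.word := rfl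

/-! ### Exchange of heights -/

/-- The piece `f` lies to the right of the whole word, with `d` strands between them, so it passes
the slices one at a time. Its position changes with the number of strands of the word. -/
theorem WordEquiv.exchange_right (i d j : ℕ) (f : Piece) {m m' : ℕ} {w : List Slice}
    (h : target w m = some m') :
    WordEquiv p (i + m + d + f.dom + j) (i + m' + d + f.cod + j)
      (FiveMove.shift i w ++ [(i + m' + d, f)]) ((i + m + d, f) :: FiveMove.shift i w) := by
  induction w generalizing m with
  | nil => simp only [target, Option.some.injEq] at h; subst h; rfl
  | cons s w ih =>
    obtain ⟨a, e⟩ := s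
    simp only [target] at h
    split_ifs at h with ha
    have h1 := ih h
    have h2 : WordEquiv p (i + m + d + f.dom + j) _ _ _ :=
      h1.pre [(i + a, e)] (by
        simp only [target]; rw [if_pos (by omega)]; congr 1; omega)
    refine h2.trans ?_
    have h3 : IsotopyMove [(i + a, e), (i + a + e.cod + (m - a - e.dom + d), f)]
      [(i + a + e.dom + (m - a - e.dom + d), f), (i + a, e)] := .exchange _ _ _ _
    rw [show i + a + e.cod + (m - a - e.dom + d) = i + (m - e.dom + e.cod) + d by omega,
      show i + a + e.dom + (m - a - e.dom + d) = i + m + d by omega] at h3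
    have h4 : WordEquiv p (i + m + d + f.dom + j) (i + (m - e.dom + e.cod) + d + f.cod + j) _ _ :=
      .mv h3 (by simp only [target]; rw [if_pos (by omega), if_pos (by omega)]; congr 1; omega)
        (by simp only [target]; rw [if_pos (by omega), if_pos (by omega)]; congr 1; omega)
    refine h4.suf (FiveMove.shift i w) ?_
    have := target_shift i (d + f.cod + j) _ _ _ h
    rw [show i + (m - e.dom + e.cod) + d + f.cod + j = i + (m - e.dom + e.cod) + (d + f.cod + j)
      by omega, this]
    congr 1; omega

theorem WordEquiv.exchange_left (i d j : ℕ) (e : Piece) {m m' : ℕ} {w : List Slice}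
    (h : target w m = some m') :
    WordEquiv p (i + e.dom + d + m + j) (i + e.cod + d + m' + j)
      ((i, e) :: FiveMove.shift (i + e.cod + d) w)
      (FiveMove.shift (i + e.dom + d) w ++ [(i, e)]) := by
  induction w generalizing m with
  | nil => simp only [target, Option.some.injEq] at h; subst h; rfl
  | cons s w ih =>
    obtain ⟨a, f⟩ := s
    simp only [target] at h
    split_ifs at h with ha
    have h3 : IsotopyMove [(i, e), (i + e.cod + (d + a), f)]
      [(i + e.dom + (d + a), f), (i, e)] := .exchange _ _ _ _
    rw [← add_assoc, ← add_assoc] at h3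
    have h4 : WordEquiv p (i + e.dom + d + m + j) (i + e.cod + d + (m - f.dom + f.cod) + j) _ _ :=
      .mv h3 (by simp only [target]; rw [if_pos (by omega), if_pos (by omega)]; congr 1; omega)
        (by simp only [target]; rw [if_pos (by omega), if_pos (by omega)]; congr 1; omega)
    refine (h4.suf (FiveMove.shift (i + e.cod + d) w) (target_shift _ _ _ _ _ h)).trans ?_
    exact (ih h).pre [(i + e.dom + d + a, f)] (by
      simp only [target]; rw [if_pos (by omega)]; congr 1; omega)

/-! ### Tangles -/

namespace TangleEquiv

variable {a b c : ℕ}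

@[refl] theorem refl (T : Tangle a b) : TangleEquiv p T T := WordEquiv.refl _

@[symm] theorem symm {T T' : Tangle a b} (h : TangleEquiv p T T') : TangleEquiv p T' T :=
  WordEquiv.symm h

@[trans] theorem trans {T T' T'' : Tangle a b} (h : TangleEquiv p T T')
    (h' : TangleEquiv p T' T'') : TangleEquiv p T T'' := WordEquiv.trans h h'

theorem comp {S S' : Tangle a b} {T T' : Tangle b c} (h : TangleEquiv p S S')
    (h' : TangleEquiv p T T') : TangleEquiv p (S.comp T) (S'.comp T') :=
  (WordEquiv.suf T.word T.valid h).trans (WordEquiv.pre S'.word S'.valid h')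

theorem whisker {T T' : Tangle a b} (h : TangleEquiv p T T') (i j : ℕ) :
    TangleEquiv p (T.whisker i j) (T'.whisker i j) := WordEquiv.shift i j h

theorem prod {A A' B B' : Tangle 2 2} (h : TangleEquiv p A A') (h' : TangleEquiv p B B') :
    TangleEquiv p (prod A B) (prod A' B') :=
  comp (comp (refl _) (comp (whisker h 0 2) (whisker h' 2 0))) (refl _)

theorem numerator {T T' : Tangle 2 2} (h : TangleEquiv p T T') :
    TangleEquiv p (numerator T) (numerator T') :=
  comp (comp (refl _) h) (refl _)

/-- The passage between tangles and bare words. The parameter `p` treats isotopy (`False`) and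
5-move equivalence (`True`) together. -/
theorem eqvGen {R : List Slice → List Slice → Prop} (hR : ∀ l r, R l r ↔ Mv p l r)
    (T T' : Tangle a b) : Relation.EqvGen (LocalMove R) T T' ↔ TangleEquiv p T T' := by
  constructor
  · intro h
    induction h with
    | rel S S' h =>
      obtain ⟨u, v, l, r, hm, h1, h2⟩ := h
      exact .rel _ _ ⟨S.valid, S'.valid, u, v, l, r, (hR _ _).1 hm, h1, h2⟩
    | refl _ => exact .refl _
    | symm _ _ _ ih => exact ih.symm
    | trans _ _ _ _ _ ih ih' => exact ih.trans ih'
  · intro h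
    -- `WordEquiv` is reflexive also on words that are no tangles from `a` to `b`; the alternative
    -- `w = w'` takes care of these.
    have key : ∀ w w', WordEquiv p a b w w' → w = w' ∨
        ∃ (h : target w a = some b) (h' : target w' a = some b),
          Relation.EqvGen (LocalMove R) (⟨w, h⟩ : Tangle a b) ⟨w', h'⟩ := by
      intro w w' h
      induction h with
      | rel w w' h =>
        obtain ⟨h1, h2, u, v, l, r, hm, e1, e2⟩ := h
        exact .inr ⟨h1, h2, .rel _ _ ⟨u, v, l, r, (hR _ _).2 hm, e1, e2⟩⟩
      | refl _ => exact .inl rfl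
      | symm _ _ _ ih =>
        rcases ih with h | ⟨h1, h2, h⟩
        · exact .inl h.symm
        · exact .inr ⟨h2, h1, h.symm⟩
      | trans _ _ _ _ _ ih ih' =>
        rcases ih with rfl | ⟨h1, h2, h⟩
        · exact ih'
        · rcases ih' with rfl | ⟨h1', h2', h'⟩
          · exact .inr ⟨h1, h2, h⟩
          · exact .inr ⟨h1, h2', h.trans _ _ _ h'⟩
    rcases key _ _ h with h | ⟨_, _, h⟩
    · rw [Tangle.ext h]; exact .refl _
    · exact h

end TangleEquiv

theorem isotopic_iff {a b : ℕ} {T T' : Tangle a b} : Isotopic T T' ↔ TangleEquiv False T T' :=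
  TangleEquiv.eqvGen (by simp [Mv]) _ _

theorem fiveMoveEquiv_iff {a b : ℕ} {T T' : Tangle a b} :
    FiveMoveEquiv T T' ↔ TangleEquiv True T T' :=
  TangleEquiv.eqvGen (by simp [Mv]) _ _

end FiveMove

namespace FiveMove

variable {p : Prop} {n k : ℕ}

/-! ### The monoid of 2-tangles -/

theorem WordEquiv.exR {m i N x : ℕ} (T : Tangle m m) (f : Piece) (hx : i + m ≤ x)
    (h : x + f.dom ≤ N) : WordEquiv p N (N - f.dom + f.cod)
      (FiveMove.shift i T.word ++ [(x, f)]) ((x, f) :: FiveMove.shift i T.word) := by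
  obtain ⟨d, rfl⟩ := Nat.exists_eq_add_of_le hx
  obtain ⟨j, rfl⟩ := Nat.exists_eq_add_of_le h
  have := WordEquiv.exchange_right (p := p) i d j f T.valid
  convert this using 1
  omega

theorem WordEquiv.exL {m m' i x y N : ℕ} (T : Tangle m m') (e : Piece) (hx : i + e.cod ≤ x)
    (hy : y + e.cod = x + e.dom) (h : y + m ≤ N) : WordEquiv p N (N - m + m' - e.dom + e.cod)
      ((i, e) :: FiveMove.shift x T.word) (FiveMove.shift y T.word ++ [(i, e)]) := by
  obtain ⟨d, rfl⟩ := Nat.exists_eq_add_of_le hx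
  obtain rfl : y = i + e.dom + d := by omega
  obtain ⟨j, rfl⟩ := Nat.exists_eq_add_of_le h
  have := WordEquiv.exchange_left (p := p) i d j e T.valid
  convert this using 1
  omega

attribute [simp] target target_append Piece.dom Piece.cod

@[simp] theorem word_prod (A B : Tangle 2 2) :
    (prod A B).word = (1, .cup) :: (A.word ++ (shift 2 B.word ++ [(1, .cap)])) := by
  simp [prod]

@[simp] theorem word_numerator (A : Tangle 2 2) :
    (numerator A).word = (0, .cup) :: (A.word ++ [(0, .cap)]) := by
  simp [numerator]

@[simp] theorem word_closure (A : Tangle 1 1) :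
    (closure A).word = (0, .cup) :: (A.word ++ [(0, .cap)]) := by
  simp [closure]

@[simp] theorem word_crossing (b : Bool) : (crossing b).word = [(0, .cross b)] := rfl
@[simp] theorem word_zeroTangle : zeroTangle.word = [(0, .cap), (0, .cup)] := rfl
@[simp] theorem word_inftyTangle : inftyTangle.word = [] := rfl

/-- The two diagrams differ only in the heights of the minima and maxima that join the three
columns. -/
theorem prod_assoc (A B C : Tangle 2 2) :
    TangleEquiv p (prod (prod A B) C) (prod A (prod B C)) := by
  unfold TangleEquiv
  simp only [word_prod, List.append_assoc, shift_cons, shift_append, shift_shift, shift_nil,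
    List.cons_append, List.nil_append]
  calc
    WordEquiv p 2 2 _ ((1, .cup) :: (3, .cup) :: (A.word ++ (shift 2 B.word ++ (1, .cap) ::
          (shift 2 C.word ++ [(1, .cap)])))) :=
      .ctx (n := 2) (k := 6) [] _ (.symm (.mv (.exchange 1 0 .cup .cup) rfl rfl)) rfl
        (by simp)
    WordEquiv p 2 2 _ ((1, .cup) :: (A.word ++ (3, .cup) :: (shift 2 B.word ++ (1, .cap) ::
          (shift 2 C.word ++ [(1, .cap)])))) := by
      simpa using WordEquiv.ctx (p := p) (n := 4) (n' := 2) (k' := 2) [(1, .cup)]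
        (shift 2 B.word ++ (1, .cap) :: (shift 2 C.word ++ [(1, .cap)]))
        (.symm (.exR (i := 0) (x := 3) A .cup (by simp) (by simp))) rfl
        (by simp)
    WordEquiv p 2 2 _ ((1, .cup) :: (A.word ++ (3, .cup) :: (shift 2 B.word ++
          (shift 4 C.word ++ [(1, .cap), (1, .cap)])))) := by
      simpa using WordEquiv.ctx (p := p) (n := 6) (n' := 2) (k' := 2)
        ((1, .cup) :: (A.word ++ (3, .cup) :: shift 2 B.word)) [(1, .cap)]
        (.exL (i := 1) (x := 2) (y := 4) C .cap (by simp)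
          (by simp) (by simp))
        (by simp)
        (by simp)
    WordEquiv p 2 2 _ _ := by
      simpa using WordEquiv.pre (p := p) (n := 6) (k := 2) (n' := 2)
        ((1, .cup) :: (A.word ++ (3, .cup) :: (shift 2 B.word ++ shift 4 C.word)))
        (by simp)
        (.mv (.exchange 1 0 .cap .cap) rfl rfl)

theorem straighten_right (T : Tangle 2 2) :
    WordEquiv p 2 2 ((1, .cup) :: (T.word ++ [(2, .cap)])) T.word := by
  calc
    WordEquiv p 2 2 _ ((1, .cup) :: (2, .cap) :: T.word) := by
      simpa using WordEquiv.pre (p := p) (n' := 2) [(1, .cup)] rfl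
        (.exR (i := 0) (x := 2) (N := 4) T .cap (by simp) (by simp))
    WordEquiv p 2 2 _ _ := by
      simpa using WordEquiv.suf (p := p) (n := 2) (k := 2) (k' := 2) T.word T.valid
        (.mv (.zigzag_left 1) rfl rfl)

theorem straighten_left (T : Tangle 2 2) :
    WordEquiv p 2 2 ((1, .cup) :: (shift 2 T.word ++ [(0, .cap)])) T.word := by
  calc
    WordEquiv p 2 2 _ ((1, .cup) :: (0, .cap) :: T.word) := by
      simpa using WordEquiv.pre (p := p) (n' := 2) [(1, .cup)] rfl
        (.symm (.exL (i := 0) (x := 0) (y := 2) (N := 4) T .cap (by simp) (by simp) (by simp)))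
    WordEquiv p 2 2 _ _ := by
      simpa using WordEquiv.suf (p := p) (n := 2) (k := 2) (k' := 2) T.word T.valid
        (.mv (.zigzag_right 0) rfl rfl)

theorem prod_zero (T : Tangle 2 2) : TangleEquiv p (prod T zeroTangle) T := by
  calc
    WordEquiv p 2 2 _ ((1, .cup) :: (T.word ++ [(2, .cap)])) := by
      simpa using WordEquiv.pre (p := p) (n' := 2) (n := 4) ((1, .cup) :: T.word)
        (by simp) (.pre [(2, .cap)] rfl (.mv (n := 2) (k := 2) (.zigzag_right 1) rfl rfl))
    WordEquiv p 2 2 _ _ := straighten_right T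

theorem zero_prod (T : Tangle 2 2) : TangleEquiv p (prod zeroTangle T) T := by
  calc
    WordEquiv p 2 2 _ ((0, .cup) :: (shift 2 T.word ++ [(1, .cap)])) := by
      simpa using WordEquiv.suf (p := p) (n := 2) (k := 2) (k' := 2)
        ((0, .cup) :: (shift 2 T.word ++ [(1, .cap)])) (by simp)
        (.mv (.zigzag_right 0) rfl rfl)
    WordEquiv p 2 2 _ (T.word ++ [(0, .cup), (1, .cap)]) := by
      simpa using WordEquiv.suf (p := p) (k' := 2) [(1, .cap)] rfl
        (.exL (i := 0) (x := 2) (y := 0) (N := 2) T .cup (by simp) (by simp) (by simp))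
    WordEquiv p 2 2 _ _ := by
      simpa using WordEquiv.pre (p := p) (n := 2) (k := 2) T.word T.valid
        (.mv (.zigzag_left 0) rfl rfl)

/-! ### Bending a 2-tangle to a tangle with three ends at the top. -/

/-- The tangle whose end point SE is bent upwards; the end points at the top are NW, NE, SE. -/
def bendRight (T : Tangle 2 2) : Tangle 1 3 := ⟨(1, .cup) :: T.word, by simp⟩

/-- The tangle whose end point SW is bent upwards; the end points at the top are SW, NW, NE. -/
def bendLeft (T : Tangle 2 2) : Tangle 1 3 := ⟨(0, .cup) :: shift 1 T.word, by simp⟩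

/-- A half twist of the strands `i` and `i + 1` out of three strands. -/
def twist (i : Fin 2) (b : Bool) : Tangle 3 3 :=
  ⟨[(i, .cross b)], by fin_cases i <;> rfl⟩

@[simp] theorem word_bendRight (T : Tangle 2 2) : (bendRight T).word = (1, .cup) :: T.word := rfl
@[simp] theorem word_bendLeft (T : Tangle 2 2) :
    (bendLeft T).word = (0, .cup) :: shift 1 T.word := rfl
@[simp] theorem word_twist (i : Fin 2) (b : Bool) : (twist i b).word = [(i.val, .cross b)] := rfl

theorem TangleEquiv.bendRight {T T' : Tangle 2 2} (h : TangleEquiv p T T') :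
    TangleEquiv p (bendRight T) (bendRight T') :=
  WordEquiv.pre (n' := 1) [(1, .cup)] rfl (by simpa [TangleEquiv] using h.whisker 0 1)

theorem TangleEquiv.bendLeft {T T' : Tangle 2 2} (h : TangleEquiv p T T') :
    TangleEquiv p (bendLeft T) (bendLeft T') :=
  WordEquiv.pre (n' := 1) [(0, .cup)] rfl (h.whisker 1 0)

/-- The bent end can be pulled straight again, so no information is lost; identities between
2-tangles may be checked on three strands, where the braid relations are available. -/
theorem TangleEquiv.of_bendRight {T T' : Tangle 2 2}
    (h : TangleEquiv p (FiveMove.bendRight T) (FiveMove.bendRight T')) : TangleEquiv p T T' := by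
  have := WordEquiv.suf (k' := 2) [(2, .cap)] rfl (h.whisker 0 1)
  simp only [Tangle.word_whisker, shift_zero, word_bendRight, List.cons_append] at this
  exact ((straighten_right T).symm.trans this).trans (straighten_right T')

theorem TangleEquiv.of_bendLeft {T T' : Tangle 2 2}
    (h : TangleEquiv p (FiveMove.bendLeft T) (FiveMove.bendLeft T')) : TangleEquiv p T T' := by
  have := WordEquiv.suf (k' := 2) [(0, .cap)] rfl (h.whisker 1 0)
  simp only [Tangle.word_whisker, shift_cons, shift_shift, word_bendLeft, List.cons_append] at this
  exact ((straighten_left T).symm.trans this).trans (straighten_left T')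

/-- The crossing joins the ends NE and SE of `T`. After SE is bent upwards these are neighbours at
the top, and the crossing becomes a half twist there; the quarter turn reverses its sign. -/
theorem bendRight_prod_crossing (T : Tangle 2 2) (b : Bool) :
    TangleEquiv p (bendRight (prod T (crossing b))) ((bendRight T).comp (twist 1 !b)) := by
  unfold TangleEquiv
  simp only [word_bendRight, word_prod, word_crossing, shift_cons, shift_nil, Tangle.word_comp,
    word_twist]
  calc
    WordEquiv p 1 3 _ ((1, .cup) :: (3, .cup) :: (T.word ++ [(2, .cross b), (1, .cap)])) := by
      simpa using WordEquiv.suf (p := p) (n := 1) (k := 5) (k' := 3)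
        (T.word ++ [(2, .cross b), (1, .cap)]) (by simp)
        (.symm (.mv (.exchange 1 0 .cup .cup) rfl rfl))
    WordEquiv p 1 3 _ ((1, .cup) :: (3, .cup) :: (T.word ++ [(1, .cross !b), (2, .cap)])) := by
      simpa using WordEquiv.pre (p := p) (n := 5) (k := 3) (n' := 1)
        ((1, .cup) :: (3, .cup) :: T.word) (by simp)
        (.symm (.mv (.slide_cap 1 (!b)) rfl rfl))
    WordEquiv p 1 3 _ ((1, .cup) :: (T.word ++ [(3, .cup), (1, .cross !b), (2, .cap)])) := by
      simpa using WordEquiv.ctx (p := p) (n' := 1) (k' := 3) [(1, .cup)]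
        [(1, .cross !b), (2, .cap)]
        (.symm (.exR (i := 0) (x := 3) (N := 3) T .cup (by simp) (by simp))) rfl rfl
    WordEquiv p 1 3 _ ((1, .cup) :: (T.word ++ [(1, .cross !b), (3, .cup), (2, .cap)])) := by
      simpa using WordEquiv.ctx (p := p) (n := 3) (k := 5) (n' := 1) (k' := 3)
        ((1, .cup) :: T.word) [(2, .cap)]
        (.symm (.mv (.exchange 1 0 (.cross !b) .cup) rfl rfl)) (by simp) rfl
    WordEquiv p 1 3 _ _ := by
      simpa using WordEquiv.pre (p := p) (n := 3) (k := 3) (n' := 1)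
        ((1, .cup) :: T.word) (by simp)
        (.pre (n := 3) [(1, .cross !b)] rfl (.mv (.zigzag_right 2) rfl rfl))

theorem bendLeft_crossing_prod (T : Tangle 2 2) (b : Bool) :
    TangleEquiv p (bendLeft (prod (crossing b) T)) ((bendLeft T).comp (twist 0 !b)) := by
  unfold TangleEquiv
  simp only [word_bendLeft, word_prod, word_crossing, shift_cons, shift_nil, Tangle.word_comp,
    word_twist, shift_append, shift_shift, List.cons_append, List.nil_append]
  calc
    WordEquiv p 1 3 _ ((0, .cup) :: (2, .cup) :: (shift 3 T.word ++ [(1, .cross b), (2, .cap)])) := by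
      simpa using WordEquiv.ctx (p := p) (n' := 1) (k' := 3) [(0, .cup), (2, .cup)] [(2, .cap)]
        (.exL (i := 1) (x := 3) (y := 3) (N := 5) T (.cross b) (by simp) (by simp) (by simp))
        rfl rfl
    WordEquiv p 1 3 _ ((0, .cup) :: (2, .cup) :: (shift 3 T.word ++ [(2, .cross !b), (1, .cap)])) := by
      simpa using WordEquiv.pre (p := p) (n' := 1) (n := 5) (k := 3)
        ((0, .cup) :: (2, .cup) :: shift 3 T.word) (by simp)
        (.mv (.slide_cap 1 b) rfl rfl)
    WordEquiv p 1 3 _ ((0, .cup) :: (shift 1 T.word ++ [(0, .cross !b), (0, .cup), (1, .cap)])) := by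
      simpa using WordEquiv.suf (p := p) (n := 1) (k := 5) (k' := 3) [(1, .cap)] rfl
        (.exL (i := 0) (x := 2) (y := 0) (N := 1) ((bendLeft T).comp (twist 0 !b)) .cup
          (by simp) (by simp) (by simp))
    WordEquiv p 1 3 _ _ := by
      simpa using WordEquiv.pre (p := p) (n := 3) (k := 3) (n' := 1)
        ((0, .cup) :: shift 1 T.word) (by simp)
        (.pre (n := 3) [(0, .cross !b)] rfl (.mv (.zigzag_left 0) rfl rfl))

end FiveMove

namespace FiveMove

/-! ### Two braid generators acting on the rational tangles -/

/-- Two permutations that satisfy the relations of the half twists `a` and `b` acting on rational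
tangles, of which `n` is the tangle `[∞]`. -/
structure TwistAction {X : Type*} (a b : Equiv.Perm X) (n : X) : Prop where
  braid : ∀ x, a (b (a x)) = b (a (b x))
  fix : b n = n
  loop : a (b (b (a n))) = n

namespace TwistAction

variable {X : Type*} {a b : Equiv.Perm X} {n : X}

theorem zero_fix (h : TwistAction a b n) : a (b (a n)) = b (a n) := by
  rw [h.braid, h.fix]

/-- The relations are symmetric under exchange of the two twists together with `[∞]` and `[0] = b (a
n)`. With this, everything proved for `bendRight` also applies to `bendLeft`, where the twists
change roles. -/
theorem mirror (h : TwistAction a b n) : TwistAction b a (b (a n)) where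
  braid x := (h.braid x).symm
  fix := h.zero_fix
  loop := by rw [h.loop]

theorem half_twist_aux (h : TwistAction a b n) : a (b (a (a n))) = b (b (a n)) := by
  rw [h.braid, h.zero_fix]

/-- This is `[1/2] * [-1] = [-1/2]`, an isotopy that needs no 5-move. -/
theorem half_twist (h : TwistAction a b n) : a (a (b (a (a n)))) = n := by
  rw [h.half_twist_aux, h.loop]

theorem conj_inv (h : TwistAction a b n) (x : X) : a (b (a⁻¹ x)) = b⁻¹ (a (b x)) := by
  rw [Equiv.Perm.eq_inv_iff_eq, ← h.braid]; simp

theorem conj_inv' (h : TwistAction a b n) (x : X) : b (a (b⁻¹ x)) = a⁻¹ (b (a x)) := by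
  rw [Equiv.Perm.eq_inv_iff_eq, h.braid]; simp

/-- The tangle `[2/5]`. -/
def special (a b : Equiv.Perm X) (n : X) : X := a (b⁻¹ (a (a n)))

/-- The twelve classes of rational tangles. -/
def Orbit (a b : Equiv.Perm X) (n x : X) : Prop :=
  x = n ∨ x = special a b n ∨ (∃ j : ℕ, x = (b ^ j) (b (a n))) ∨ ∃ j : ℕ, x = (b ^ j) (a (a n))

theorem five_apply (ha : a ^ 5 = 1) (x : X) : a (a (a (a (a x)))) = x := by
  have := Equiv.congr_fun ha x
  simpa [pow_succ] using this

theorem inv_apply (hb : b ^ 5 = 1) (x : X) : b⁻¹ x = b (b (b (b x))) := by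
  rw [Equiv.Perm.inv_eq_iff_eq, five_apply hb]

/-- In the model modulo 5, `1/3` and `-1/2` are the same pair up to sign. After two more twists `a`
both sides are `n`, the one by `a ^ 5 = 1` and the other by `half_twist`. -/
theorem a_half (h : TwistAction a b n) (ha : a ^ 5 = 1) : a (a (a n)) = b (a (a n)) := by
  apply a.injective; apply a.injective
  rw [h.half_twist, five_apply ha]

theorem a_zero_two (h : TwistAction a b n) :
    a (b (b (b (a n)))) = b⁻¹ (a n) := by
  have h1 : b (b (a n)) = a⁻¹ n := by rw [Equiv.Perm.eq_inv_iff_eq, h.loop]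
  rw [h1, h.conj_inv, h.fix]

theorem a_zero_three (h : TwistAction a b n) (ha : a ^ 5 = 1) :
    a (b⁻¹ (a n)) = b⁻¹ (a (a n)) := by
  rw [Equiv.Perm.eq_inv_iff_eq, h.conj_inv', ← h.a_half ha]; simp

theorem a_half_two (h : TwistAction a b n) (ha : a ^ 5 = 1) :
    a (b (b (a (a n)))) = b (b (b (a n))) := by
  rw [← h.a_half ha, h.braid, h.half_twist_aux]

theorem a_half_three (h : TwistAction a b n) (ha : a ^ 5 = 1) (hb : b ^ 5 = 1) :
    a (b (b (b (a (a n))))) = b (b (b (a (a n)))) := by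
  have h1 : b (b (a (a n))) = a⁻¹ (b (b (b (a n)))) := by
    rw [Equiv.Perm.eq_inv_iff_eq, h.a_half_two ha]
  have h2 : b (b (b (b (a n)))) = b⁻¹ (a n) := (inv_apply hb _).symm
  conv_lhs => rw [h1]
  rw [h.conj_inv, h2, h.a_zero_three ha, Equiv.Perm.inv_eq_iff_eq, inv_apply hb]

/-- With `y = b³ (a² n)`, which `a` fixes by `a_half_three`, the element `special` is `a (b y)`; the
braid relation gives `b a b y = a b a y = a b y`. -/
theorem b_special (h : TwistAction a b n) (ha : a ^ 5 = 1) (hb : b ^ 5 = 1) :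
    b (special a b n) = special a b n := by
  unfold special
  rw [inv_apply hb]
  conv_lhs => rw [← h.a_half_three ha hb, ← h.braid]
  rw [h.a_half_three ha hb, h.a_half_three ha hb]

/-- The lemmas above run through a cycle of `a`: `b² (a² n)`, `b³ (a n)`, `b⁻¹ (a n)`, `b⁻¹ (a² n)`,
`special`. The fifth twist closes it. -/
theorem a_special (h : TwistAction a b n) (ha : a ^ 5 = 1) :
    a (special a b n) = b (b (a (a n))) := by
  unfold special
  rw [← h.a_zero_three ha, ← h.a_zero_two, ← h.a_half_two ha, five_apply ha]

theorem pow_mod_five (hb : b ^ 5 = 1) (j : ℕ) : b ^ j = b ^ (j % 5) := by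
  conv_lhs => rw [← Nat.div_add_mod j 5, pow_add, pow_mul, hb, one_pow, one_mul]

theorem orbit_b (h : TwistAction a b n) (ha : a ^ 5 = 1) (hb : b ^ 5 = 1) {x : X}
    (hx : Orbit a b n x) : Orbit a b n (b x) := by
  rcases hx with rfl | rfl | ⟨j, rfl⟩ | ⟨j, rfl⟩
  · exact .inl h.fix
  · exact .inr (.inl (h.b_special ha hb))
  · exact .inr (.inr (.inl ⟨j + 1, by rw [pow_succ']; rfl⟩))
  · exact .inr (.inr (.inr ⟨j + 1, by rw [pow_succ']; rfl⟩))

/-- Only the closure of the list of twelve under both twists is needed, not that the twelve classes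
differ. -/
theorem orbit_a (h : TwistAction a b n) (ha : a ^ 5 = 1) (hb : b ^ 5 = 1) {x : X}
    (hx : Orbit a b n x) : Orbit a b n (a x) := by
  rcases hx with rfl | rfl | ⟨j, rfl⟩ | ⟨j, rfl⟩
  · exact .inr (.inr (.inl ⟨4, by simp [pow_succ, five_apply hb]⟩))
  · exact .inr (.inr (.inr ⟨2, by rw [h.a_special ha]; rfl⟩))
  · rw [pow_mod_five hb]
    have : j % 5 < 5 := Nat.mod_lt _ (by norm_num)
    interval_cases j % 5
    · exact .inr (.inr (.inl ⟨0, h.zero_fix⟩))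
    · exact .inl h.loop
    · exact .inr (.inr (.inl ⟨3, by
        have := h.a_zero_two
        rw [inv_apply hb] at this
        simpa [pow_succ] using this⟩))
    · refine .inr (.inr (.inr ⟨4, ?_⟩))
      have := h.a_zero_three ha
      rw [inv_apply hb, inv_apply hb] at this
      simpa [pow_succ] using this
    · refine .inr (.inr (.inr ⟨0, ?_⟩))
      simp [pow_succ, five_apply hb]
  · rw [pow_mod_five hb]
    have : j % 5 < 5 := Nat.mod_lt _ (by norm_num)
    interval_cases j % 5
    · exact .inr (.inr (.inr ⟨1, h.a_half ha⟩))
    · exact .inr (.inr (.inl ⟨1, h.half_twist_aux⟩))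
    · exact .inr (.inr (.inl ⟨2, h.a_half_two ha⟩))
    · exact .inr (.inr (.inr ⟨3, h.a_half_three ha hb⟩))
    · exact .inr (.inl (by unfold special; rw [inv_apply hb]; rfl))

theorem orbit_b_inv (h : TwistAction a b n) (ha : a ^ 5 = 1) (hb : b ^ 5 = 1) {x : X}
    (hx : Orbit a b n x) : Orbit a b n (b⁻¹ x) := by
  rw [inv_apply hb]
  exact h.orbit_b ha hb (h.orbit_b ha hb (h.orbit_b ha hb (h.orbit_b ha hb hx)))

theorem orbit_a_inv (h : TwistAction a b n) (ha : a ^ 5 = 1) (hb : b ^ 5 = 1) {x : X}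
    (hx : Orbit a b n x) : Orbit a b n (a⁻¹ x) := by
  rw [inv_apply ha]
  exact h.orbit_a ha hb (h.orbit_a ha hb (h.orbit_a ha hb (h.orbit_a ha hb hx)))

end TwistAction

/-! ### Classes of tangles -/

/-- Equivalence of tangles as a setoid. -/
def tangleSetoid (p : Prop) (m n : ℕ) : Setoid (Tangle m n) :=
  ⟨TangleEquiv p, .refl, .symm, .trans⟩

/-- The classes of tangles. -/
abbrev TangleClass (p : Prop) (m n : ℕ) : Type := Quotient (tangleSetoid p m n)

variable {p : Prop}

/-- The class of a tangle. -/
def cls (p : Prop) {m n : ℕ} (T : Tangle m n) : TangleClass p m n :=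
  Quotient.mk (tangleSetoid p m n) T

theorem cls_eq {m n : ℕ} {T T' : Tangle m n} : cls p T = cls p T' ↔ TangleEquiv p T T' :=
  Quotient.eq (r := tangleSetoid p m n)

theorem cls_surj {m n : ℕ} (x : TangleClass p m n) : ∃ T, cls p T = x := Quotient.exists_rep x

/-- Composition with a fixed tangle on top. -/
def compClass {a b c : ℕ} (T : Tangle b c) (x : TangleClass p a b) : TangleClass p a c :=
  Quotient.map' (s₁ := tangleSetoid p a b) (s₂ := tangleSetoid p a c) (·.comp T)
    (fun _ _ h => h.comp (.refl T)) x

@[simp] theorem compClass_cls {a b c : ℕ} (S : Tangle a b) (T : Tangle b c) :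
    compClass T (cls p S) = cls p (S.comp T) := rfl

theorem cross_cancel {i n : ℕ} (h : i + 2 ≤ n) (b : Bool) :
    WordEquiv p n n [(i, .cross b), (i, .cross !b)] [] :=
  .mv (.reidemeister_two i b) (by simp [h]; omega) rfl

theorem compClass_cross_cancel {a b i : ℕ} (T T' : Tangle b b) (h : i + 2 ≤ b) (c : Bool)
    (hT : T.word = [(i, .cross c)]) (hT' : T'.word = [(i, .cross !c)]) (x : TangleClass p a b) :
    compClass T' (compClass T x) = x := by
  obtain ⟨S, rfl⟩ := cls_surj x
  refine cls_eq.2 ?_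
  have := WordEquiv.pre (p := p) S.word S.valid (cross_cancel h c)
  simpa [TangleEquiv, hT, hT'] using this

/-- The half twists of three strands as permutations of the classes of tangles. -/
def twistPerm (p : Prop) (i : Fin 2) : Equiv.Perm (TangleClass p 1 3) where
  toFun := compClass (twist i true)
  invFun := compClass (twist i false)
  left_inv := compClass_cross_cancel _ _ (by omega) true rfl rfl
  right_inv := compClass_cross_cancel _ _ (by omega) false rfl rfl

theorem twistPerm_pow_five (hp : p) (i : Fin 2) : twistPerm p i ^ 5 = 1 := by
  ext x
  obtain ⟨S, rfl⟩ := cls_surj x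
  refine cls_eq.2 ?_
  have h : WordEquiv p 3 3 [] (List.replicate 5 (i.val, .cross true)) :=
    .five hp (.insert i true) rfl (by fin_cases i <;> rfl)
  have := WordEquiv.pre S.word S.valid h.symm
  simpa [TangleEquiv, List.replicate] using this

/-- The three relations are Reidemeister III, the removal of a kink at the bent minimum, and a
minimum pulled back and forth through two cancelling pairs of crossings. -/
theorem twistAction (p : Prop) :
    TwistAction (twistPerm p 0) (twistPerm p 1) (cls p (bendRight inftyTangle)) where
  braid x := by
    obtain ⟨S, rfl⟩ := cls_surj x
    refine cls_eq.2 ?_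
    have := WordEquiv.pre (p := p) S.word S.valid
      (.mv (k := 3) (.reidemeister_three 0 true) rfl rfl)
    simpa [TangleEquiv] using this
  fix := cls_eq.2 (.mv (.reidemeister_one_cup 1 true) rfl rfl)
  loop := by
    refine cls_eq.2 ?_
    show WordEquiv p 1 3 [(1, .cup), (0, .cross true), (1, .cross true), (1, .cross true),
      (0, .cross true)] [(1, .cup)]
    calc
      WordEquiv p 1 3 _ [(0, .cup), (1, .cross false), (1, .cross true), (1, .cross true),
          (0, .cross true)] :=
        .suf (k := 3) [(1, .cross true), (1, .cross true), (0, .cross true)] rfl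
          (.mv (.slide_cup 0 true) rfl rfl)
      WordEquiv p 1 3 _ [(0, .cup), (1, .cross true), (0, .cross true)] :=
        .ctx (n := 3) (k := 3) [(0, .cup)] [(1, .cross true), (0, .cross true)]
          (cross_cancel (by norm_num) false) rfl rfl
      WordEquiv p 1 3 _ [(1, .cup), (0, .cross false), (0, .cross true)] :=
        .suf (k := 3) [(0, .cross true)] rfl (.symm (.mv (.slide_cup 0 false) rfl rfl))
      WordEquiv p 1 3 _ _ :=
        .pre (n := 3) [(1, .cup)] rfl (cross_cancel (by norm_num) false)

theorem cls_bendRight_zero :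
    cls p (bendRight zeroTangle) =
      twistPerm p 1 (twistPerm p 0 (cls p (bendRight inftyTangle))) := by
  refine cls_eq.2 ?_
  show WordEquiv p 1 3 [(1, .cup), (0, .cap), (0, .cup)] [(1, .cup), (0, .cross true),
    (1, .cross true)]
  calc
    WordEquiv p 1 3 _ [(0, .cup)] :=
      .suf (k := 1) [(0, .cup)] rfl (.mv (.zigzag_right 0) rfl rfl)
    WordEquiv p 1 3 _ [(0, .cup), (1, .cross false), (1, .cross true)] :=
      .pre (n := 3) [(0, .cup)] rfl (.symm (cross_cancel (by norm_num) false))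
    WordEquiv p 1 3 _ _ :=
      .suf (k := 3) [(1, .cross true)] rfl (.symm (.mv (.slide_cup 0 true) rfl rfl))

theorem cls_bendLeft_infty :
    cls p (bendLeft inftyTangle) = cls p (bendRight zeroTangle) :=
  cls_eq.2 (.symm (.suf (k := 1) [(0, .cup)] rfl (.mv (.zigzag_right 0) rfl rfl)))

theorem twistAction_left (p : Prop) :
    TwistAction (twistPerm p 1) (twistPerm p 0) (cls p (bendLeft inftyTangle)) := by
  rw [cls_bendLeft_infty, cls_bendRight_zero]
  exact (twistAction p).mirror

/-! ### The monoid of classes of 2-tangles -/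

instance : Monoid (TangleClass p 2 2) where
  mul := Quotient.map₂ (sa := tangleSetoid p 2 2) (sb := tangleSetoid p 2 2)
    (sc := tangleSetoid p 2 2) prod (fun _ _ h _ _ h' => h.prod h')
  one := cls p zeroTangle
  mul_assoc x y z := by
    obtain ⟨A, rfl⟩ := cls_surj x
    obtain ⟨B, rfl⟩ := cls_surj y
    obtain ⟨C, rfl⟩ := cls_surj z
    exact cls_eq.2 (prod_assoc A B C)
  one_mul x := by
    obtain ⟨A, rfl⟩ := cls_surj x
    exact cls_eq.2 (zero_prod A)
  mul_one x := by
    obtain ⟨A, rfl⟩ := cls_surj x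
    exact cls_eq.2 (prod_zero A)

theorem cls_prod (A B : Tangle 2 2) : cls p (prod A B) = cls p A * cls p B := rfl
theorem cls_zero : cls p zeroTangle = 1 := rfl

theorem cls_prodList (l : List (Tangle 2 2)) : cls p (prodList l) = (l.map (cls p)).prod := by
  induction l with
  | nil => rfl
  | cons A l ih => rw [List.map_cons, List.prod_cons, ← ih]; rfl

/-! ### Twists and crossings as braid generators on bent classes. -/

/-- `bendRight` on classes. -/
def bendR (x : TangleClass p 2 2) : TangleClass p 1 3 :=
  Quotient.map' (s₁ := tangleSetoid p 2 2) (s₂ := tangleSetoid p 1 3) bendRight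
    (fun _ _ h => h.bendRight) x

/-- `bendLeft` on classes. -/
def bendL (x : TangleClass p 2 2) : TangleClass p 1 3 :=
  Quotient.map' (s₁ := tangleSetoid p 2 2) (s₂ := tangleSetoid p 1 3) bendLeft
    (fun _ _ h => h.bendLeft) x

theorem bendR_injective : Function.Injective (bendR (p := p)) := by
  intro x y h
  obtain ⟨A, rfl⟩ := cls_surj x
  obtain ⟨B, rfl⟩ := cls_surj y
  exact cls_eq.2 (cls_eq.1 h).of_bendRight

theorem bendL_injective : Function.Injective (bendL (p := p)) := by
  intro x y h
  obtain ⟨A, rfl⟩ := cls_surj x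
  obtain ⟨B, rfl⟩ := cls_surj y
  exact cls_eq.2 (cls_eq.1 h).of_bendLeft

/-- Add a half twist on top. -/
abbrev top (b : Bool) (x : TangleClass p 2 2) : TangleClass p 2 2 := compClass (crossing b) x

theorem bendR_top (b : Bool) (x : TangleClass p 2 2) :
    bendR (top b x) = (bif b then twistPerm p 0 else (twistPerm p 0)⁻¹) (bendR x) := by
  obtain ⟨A, rfl⟩ := cls_surj x
  cases b <;> rfl

theorem bendL_top (b : Bool) (x : TangleClass p 2 2) :
    bendL (top b x) = (bif b then twistPerm p 1 else (twistPerm p 1)⁻¹) (bendL x) := by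
  obtain ⟨A, rfl⟩ := cls_surj x
  have h (b : Bool) : cls p (bendLeft (A.comp (crossing b))) =
      cls p ((bendLeft A).comp (twist 1 b)) :=
    congrArg (cls p) (Tangle.ext (by simp))
  cases b
  · exact h false
  · exact h true

theorem bendR_mul_crossing (b : Bool) (x : TangleClass p 2 2) :
    bendR (x * cls p (crossing b)) =
      (bif b then (twistPerm p 1)⁻¹ else twistPerm p 1) (bendR x) := by
  obtain ⟨A, rfl⟩ := cls_surj x
  have := cls_eq.2 (bendRight_prod_crossing (p := p) A b)
  cases b <;> exact this

theorem bendL_crossing_mul (b : Bool) (x : TangleClass p 2 2) :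
    bendL (cls p (crossing b) * x) =
      (bif b then (twistPerm p 0)⁻¹ else twistPerm p 0) (bendL x) := by
  obtain ⟨A, rfl⟩ := cls_surj x
  have := cls_eq.2 (bendLeft_crossing_prod (p := p) A b)
  cases b <;> exact this

end FiveMove

namespace FiveMove

variable {p : Prop}

/-! ### A strand that passes over a tangle -/

/-- The leftmost of `m + 1` strands passes to the right. -/
def sweep (b : Bool) (m : ℕ) : List Slice := (List.range m).map fun j => (j, .cross b)

theorem sweep_add (b : Bool) (m k : ℕ) : sweep b (m + k) = sweep b m ++ shift m (sweep b k) := by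
  simp [sweep, List.range_add, shift]

theorem target_sweep (b : Bool) (m : ℕ) : target (sweep b m) (m + 1) = some (m + 1) := by
  induction m with
  | zero => rfl
  | succ m ih =>
    rw [sweep_add, target_append]
    have := target_shift 0 1 _ _ _ ih
    simp only [shift_zero, zero_add] at this
    rw [this]
    simp [sweep]

/-- A strand can be pulled over or under a single piece; `sweep_word` extends this to a whole
tangle. -/
theorem sweep_piece (b : Bool) (e : Piece) :
    WordEquiv p (e.dom + 1) (e.cod + 1) ((1, e) :: sweep b e.cod) (sweep b e.dom ++ [(0, e)]) := by
  cases e with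
  | cup =>
    show WordEquiv p 1 3 [(1, .cup), (0, .cross b), (1, .cross b)] [(0, .cup)]
    have h : WordEquiv p 1 3 [(1, .cup), (0, .cross b), (1, .cross b)]
      [(0, .cup), (1, .cross !b), (1, .cross b)] :=
      .suf (k := 3) [(1, .cross b)] rfl (.mv (.slide_cup 0 b) rfl rfl)
    refine h.trans (.pre (n := 3) [(0, .cup)] rfl ?_)
    simpa using cross_cancel (p := p) (i := 1) (n := 3) (by norm_num) (!b)
  | cap =>
    show WordEquiv p 3 1 [(1, .cap)] [(0, .cross b), (1, .cross b), (0, .cap)]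
    have h : WordEquiv p 3 1 [(0, .cross b), (0, .cross !b), (1, .cap)]
      [(0, .cross b), (1, .cross b), (0, .cap)] := by
      simpa using WordEquiv.pre (p := p) (n := 3) (k := 1) (n' := 3) [(0, .cross b)] rfl
        (.mv (.slide_cap 0 (!b)) rfl rfl)
    refine .trans (.symm ?_) h
    exact .suf (k := 3) [(1, .cap)] rfl (cross_cancel (by norm_num) b)
  | cross c =>
    show WordEquiv p 3 3 [(1, .cross c), (0, .cross b), (1, .cross b)]
      [(0, .cross b), (1, .cross b), (0, .cross c)]
    rcases Bool.eq_or_eq_not c b with rfl | rfl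
    · exact .symm (.mv (.reidemeister_three 0 c) rfl rfl)
    -- The generating Reidemeister III move has three equal signs. The mixed case is reduced to it
    -- by the insertion of a cancelling pair.
    · calc
        WordEquiv p 3 3 _ [(1, .cross !b), (0, .cross b), (1, .cross b), (0, .cross b),
            (0, .cross !b)] :=
          .pre (n := 3) [(1, .cross !b), (0, .cross b), (1, .cross b)] rfl
            (.symm (cross_cancel (by norm_num) b))
        WordEquiv p 3 3 _ [(1, .cross !b), (1, .cross b), (0, .cross b), (1, .cross b),
            (0, .cross !b)] :=
          .ctx (n := 3) (k := 3) [(1, .cross !b)] [(0, .cross !b)]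
            (.mv (.reidemeister_three 0 b) rfl rfl) rfl rfl
        WordEquiv p 3 3 _ _ := by
          simpa using WordEquiv.suf (p := p) (n := 3) (k := 3) (k' := 3)
            [(0, .cross b), (1, .cross b), (0, .cross !b)] rfl
            (cross_cancel (i := 1) (by norm_num) (!b))

theorem sweep_slice (b : Bool) (i r : ℕ) (e : Piece) :
    WordEquiv p (i + e.dom + r + 1) (i + e.cod + r + 1)
      ((1 + i, e) :: sweep b (i + e.cod + r)) (sweep b (i + e.dom + r) ++ [(i, e)]) := by
  have h1 : WordEquiv p (i + e.dom + r + 1) (i + e.cod + r + 1)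
      (sweep b i ++ [(i + 1, e)]) ((i + 1, e) :: sweep b i) := by
    have := WordEquiv.exchange_right (p := p) 0 0 r e (target_sweep b i)
    convert this using 1 <;> first | omega | simp
  have h2 : WordEquiv p (i + e.dom + r + 1) (i + e.cod + r + 1)
      ((i + 1, e) :: shift i (sweep b e.cod)) (shift i (sweep b e.dom) ++ [(i, e)]) := by
    have := WordEquiv.shift i r (sweep_piece (p := p) b e)
    convert this using 1 <;> first | omega | simp
  have h3 : WordEquiv p (i + e.dom + r + 1) (i + e.cod + r + 1)
      ((i, e) :: shift (i + e.cod) (sweep b r)) (shift (i + e.dom) (sweep b r) ++ [(i, e)]) := by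
    have := WordEquiv.exchange_left (p := p) i 0 0 e (target_sweep b r)
    convert this using 1 <;> first | omega | simp
  have t1 : target (sweep b i) (i + e.dom + r + 1) = some (i + e.dom + r + 1) := by
    have := target_shift 0 (e.dom + r) _ _ _ (target_sweep b i)
    rw [shift_zero] at this
    convert this using 2 <;> omega
  have t2 : target (shift i (sweep b e.dom)) (i + e.dom + r + 1) = some (i + e.dom + r + 1) := by
    have := target_shift i r _ _ _ (target_sweep b e.dom)
    convert this using 2 <;> omega
  have t2' : target (shift i (sweep b e.cod)) (i + e.cod + r + 1) = some (i + e.cod + r + 1) := by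
    have := target_shift i r _ _ _ (target_sweep b e.cod)
    convert this using 2 <;> omega
  have t3 : target (shift (i + e.cod) (sweep b r)) (i + e.cod + r + 1) =
      some (i + e.cod + r + 1) := by
    have := target_shift (i + e.cod) 0 _ _ _ (target_sweep b r)
    convert this using 2 <;> omega
  rw [add_comm 1 i]
  simp only [sweep_add, List.append_assoc]
  calc
    WordEquiv p (i + e.dom + r + 1) (i + e.cod + r + 1) _
        (sweep b i ++ (i + 1, e) :: (shift i (sweep b e.cod) ++ shift (i + e.cod) (sweep b r))) := by
      have := h1.symm.suf (shift i (sweep b e.cod) ++ shift (i + e.cod) (sweep b r))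
        (by rw [target_append, t2']; exact t3)
      simpa using this
    WordEquiv p (i + e.dom + r + 1) (i + e.cod + r + 1) _
        (sweep b i ++ (shift i (sweep b e.dom) ++ (i, e) :: shift (i + e.cod) (sweep b r))) := by
      have := WordEquiv.ctx (sweep b i) (shift (i + e.cod) (sweep b r)) h2 t1 t3
      simpa using this
    WordEquiv p (i + e.dom + r + 1) (i + e.cod + r + 1) _ _ := by
      have := (h3.pre _ t2).pre _ t1
      simpa using this

theorem sweep_word (b : Bool) {m m' : ℕ} {w : List Slice} (h : target w m = some m') :
    WordEquiv p (m + 1) (m' + 1) (shift 1 w ++ sweep b m') (sweep b m ++ w) := by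
  induction w generalizing m with
  | nil => simp only [target, Option.some.injEq] at h; subst h; simp; rfl
  | cons s w ih =>
    obtain ⟨i, e⟩ := s
    simp only [target] at h
    split_ifs at h with hi
    obtain ⟨r, rfl⟩ := Nat.exists_eq_add_of_le hi
    rw [show i + e.dom + r - e.dom + e.cod = i + e.cod + r by omega] at h
    have h1 : WordEquiv p (i + e.dom + r + 1) (m' + 1) _ _ := (ih h).pre [(1 + i, e)] (by
      simp only [target]; rw [if_pos (by omega)]; congr 1; omega)
    have h2 := (sweep_slice (p := p) b i r e).suf w (k' := m' + 1) (by
      have := target_shift 0 1 _ _ _ h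
      simpa [shift_zero] using this)
    refine h1.trans ?_
    simpa using h2

/-! ### Connected sums -/

/-- Closing a strand on the right or on the left gives the same link. -/
theorem closure_left (W : Tangle 1 1) :
    WordEquiv p 0 0 ((0, .cup) :: (W.word ++ [(0, .cap)]))
      ((0, .cup) :: (shift 1 W.word ++ [(0, .cap)])) := by
  -- A kink is made at the bottom, its crossing is dragged along `W`, which moves `W` to the other
  -- strand, and the kink is removed at the top.
  calc
    WordEquiv p 0 0 _ ((0, .cup) :: (0, .cross true) :: (W.word ++ [(0, .cap)])) :=
      .suf (k := 2) (W.word ++ [(0, .cap)]) (by simp)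
        (.symm (.mv (.reidemeister_one_cup 0 true) rfl rfl))
    WordEquiv p 0 0 _ ((0, .cup) :: (shift 1 W.word ++ [(0, .cross true), (0, .cap)])) := by
      have := WordEquiv.ctx (n' := 0) (k' := 0) [(0, .cup)] [(0, .cap)]
        (sweep_word (p := p) true W.valid).symm rfl rfl
      simpa [sweep] using this
    WordEquiv p 0 0 _ _ := by
      have := WordEquiv.pre (p := p) (n := 2) (k := 0) (n' := 0) ((0, .cup) :: shift 1 W.word)
        (by simp) (.mv (.reidemeister_one_cap 0 true) rfl rfl)
      simpa using this

/-- The tangle `Y` on the left half of a bent strand. -/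
def bendStrand (Y : Tangle 1 1) : Tangle 1 1 :=
  ⟨(1, .cup) :: (shift 1 Y.word ++ [(0, .cap)]), by simp⟩

/-- Two strands side by side, closed to one circle. -/
def pairClosure (X Y : Tangle 1 1) : LinkDiagram :=
  ⟨(0, .cup) :: (X.word ++ (shift 1 Y.word ++ [(0, .cap)])), by simp⟩

theorem closure_comp_bendStrand (X Y : Tangle 1 1) :
    TangleEquiv p (closure (X.comp (bendStrand Y))) (pairClosure X Y) := by
  unfold TangleEquiv
  simp only [word_closure, Tangle.word_comp, bendStrand, pairClosure, List.append_assoc,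
    List.cons_append, List.nil_append]
  calc
    WordEquiv p 0 0 _ ((0, .cup) :: (X.word ++ (1, .cup) :: (shift 1 Y.word ++
        [(2, .cap), (0, .cap)]))) := by
      have := WordEquiv.pre (p := p) (n := 2) (k := 0) (n' := 0) ((0, .cup) :: X.word) (by simp)
        (.pre (n := 4) [(1, .cup)] rfl
          (.pre (n := 4) (n' := 4) (shift 1 Y.word) (by simp) (.mv (.exchange 0 0 .cap .cap) rfl rfl)))
      simpa using this
    WordEquiv p 0 0 _ ((0, .cup) :: (X.word ++ (1, .cup) :: (2, .cap) :: (shift 1 Y.word ++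
        [(0, .cap)]))) := by
      have := WordEquiv.pre (p := p) (k := 0) (n' := 0) ((0, .cup) :: X.word) (by simp)
        (.ctx (n' := 2) [(1, .cup)] [(0, .cap)]
          (.exR (i := 1) (x := 2) (N := 4) Y .cap (by simp) (by simp)) rfl rfl)
      simpa using this
    WordEquiv p 0 0 _ _ := by
      have := WordEquiv.ctx (p := p) (k' := 0) (n' := 0) ((0, .cup) :: X.word)
        (shift 1 Y.word ++ [(0, .cap)])
        (.mv (n := 2) (k := 2) (.zigzag_left 1) rfl rfl) (by simp) (by simp)
      simpa using this

theorem closure_bendStrand (Y : Tangle 1 1) :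
    TangleEquiv p (closure (bendStrand Y)) (closure Y) := by
  have h := closure_comp_bendStrand (p := p) ⟨[], rfl⟩ Y
  refine TangleEquiv.trans (T' := pairClosure ⟨[], rfl⟩ Y) h ?_
  have := (closure_left (p := p) Y).symm
  simpa [TangleEquiv, pairClosure] using this

theorem IsBasicSum.exists_closure {L : LinkDiagram} (h : IsBasicSum L) :
    ∃ A : Tangle 1 1, TangleEquiv False L (closure A) := by
  cases h with
  | trivialKnot => exact ⟨⟨[], rfl⟩, .refl _⟩
  | trivialLink₂ =>
    refine ⟨⟨[(0, .cup), (0, .cap)], rfl⟩, ?_⟩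
    show WordEquiv False 0 0 [(0, .cup), (0, .cap), (0, .cup), (0, .cap)]
      [(0, .cup), (0, .cup), (0, .cap), (0, .cap)]
    calc
      WordEquiv False 0 0 _ [(0, .cup), (0, .cup), (2, .cap), (0, .cap)] :=
        .ctx (n := 2) (k := 2) [(0, .cup)] [(0, .cap)]
          (.symm (.mv (.exchange 0 0 .cup .cap) rfl rfl)) rfl rfl
      WordEquiv False 0 0 _ _ :=
        .pre (n := 4) [(0, .cup), (0, .cup)] rfl (.symm (.mv (.exchange 0 0 .cap .cap) rfl rfl))
  | hopfLink =>
    exact ⟨⟨[(1, .cup), (0, .cross true), (0, .cross true), (1, .cap)], rfl⟩, .refl _⟩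
  | figureEight =>
    exact ⟨⟨[(1, .cup), (2, .cup), (0, .cross true), (1, .cross false), (0, .cross true),
      (1, .cross false), (2, .cap), (1, .cap)], rfl⟩, .refl _⟩
  | connectedSum _ _ h =>
    obtain ⟨A, B, _, _, h⟩ := h
    exact ⟨_, isotopic_iff.1 h⟩

/-- Isotopy enters `IsBasicSum` only through connected sums, so invariance is obtained from the sum
with the trivial knot. For this `L` has to be opened to a strand, which `exists_closure` provides.
-/
theorem IsBasicSum.congr {L L' : LinkDiagram} (h : IsBasicSum L) (h' : TangleEquiv False L' L) :
    IsBasicSum L' := by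
  obtain ⟨A, hA⟩ := h.exists_closure
  refine .connectedSum h .trivialKnot ⟨A, ⟨[], rfl⟩, isotopic_iff.2 hA, .refl _, ?_⟩
  refine isotopic_iff.2 (h'.trans (hA.trans ?_))
  rw [show A.comp ⟨[], rfl⟩ = A from Tangle.ext (by simp)]

/-- A bend carries `Y` to the strand of `X`, so that the closed pair of strands becomes the closure
of a composition, as `IsConnectedSum` demands. -/
theorem isBasicSum_pairClosure {X Y : Tangle 1 1} (hX : IsBasicSum (closure X))
    (hY : IsBasicSum (closure Y)) : IsBasicSum (pairClosure X Y) :=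
  .connectedSum hX hY ⟨X, bendStrand Y, .refl _, isotopic_iff.2 (closure_bendStrand Y).symm,
    isotopic_iff.2 (closure_comp_bendStrand X Y).symm⟩

/-! ### Closures of 2-tangles as connected sums. -/

/-- The two right end points of a 2-tangle are joined. -/
def closeRight (A : Tangle 2 2) : Tangle 1 1 :=
  ⟨(1, .cup) :: (A.word ++ [(1, .cap)]), by simp⟩

/-- The two left end points of a 2-tangle are joined. -/
def closeLeft (A : Tangle 2 2) : Tangle 1 1 :=
  ⟨(0, .cup) :: (shift 1 A.word ++ [(0, .cap)]), by simp⟩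

/-- The denominator closure. -/
def denominator (A : Tangle 2 2) : LinkDiagram := closure (closeRight A)

@[simp] theorem word_denominator (A : Tangle 2 2) :
    (denominator A).word = (0, .cup) :: (1, .cup) :: (A.word ++ [(1, .cap), (0, .cap)]) := by
  simp [denominator, closeRight]

theorem closure_closeLeft (A : Tangle 2 2) :
    TangleEquiv p (closure (closeLeft A)) (denominator A) := by
  refine TangleEquiv.symm ?_
  calc
    WordEquiv p 0 0 _ ((0, .cup) :: (2, .cup) :: (shift 1 A.word ++ [(2, .cap), (0, .cap)])) := by
      simpa [closeRight] using closure_left (p := p) (closeRight A)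
    WordEquiv p 0 0 _ ((0, .cup) :: (0, .cup) :: (shift 1 A.word ++ [(2, .cap), (0, .cap)])) :=
      .suf (k := 4) (shift 1 A.word ++ [(2, .cap), (0, .cap)]) (by simp)
        (.mv (.exchange 0 0 .cup .cup) rfl rfl)
    WordEquiv p 0 0 _ _ := by
      have := WordEquiv.pre (p := p) (n := 4) (n' := 0) (k := 0)
        ((0, .cup) :: (0, .cup) :: shift 1 A.word) (by simp)
        (.symm (.mv (.exchange 0 0 .cap .cap) rfl rfl))
      simpa [closeLeft] using this

/-- The denominator closure joins the left ends of `A` to each other, and likewise the right ends of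
`S`. What remains are two arcs between the columns, hence a connected sum. -/
theorem denominator_prod (A S : Tangle 2 2) :
    TangleEquiv p (denominator (prod A S)) (pairClosure (closeLeft A) (closeRight S)) := by
  calc
    WordEquiv p 0 0 _ ((0, .cup) :: (2, .cup) :: (2, .cup) :: (shift 1 A.word ++
        (shift 3 S.word ++ [(2, .cap), (2, .cap), (0, .cap)]))) := by
      simpa [closeRight] using closure_left (p := p) (closeRight (prod A S))
    WordEquiv p 0 0 _ ((0, .cup) :: (2, .cup) :: (4, .cup) :: (shift 1 A.word ++
        (shift 3 S.word ++ [(2, .cap), (2, .cap), (0, .cap)]))) := by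
      have := WordEquiv.ctx (p := p) (n := 2) (n' := 0) (k := 6) (k' := 0)
        [(0, .cup)] (shift 1 A.word ++ (shift 3 S.word ++ [(2, .cap), (2, .cap), (0, .cap)]))
        (.symm (.mv (.exchange 2 0 .cup .cup) rfl rfl)) rfl (by simp)
      simpa using this
    WordEquiv p 0 0 _ ((0, .cup) :: (0, .cup) :: (4, .cup) :: (shift 1 A.word ++
        (shift 3 S.word ++ [(2, .cap), (2, .cap), (0, .cap)]))) :=
      .suf (n := 0) (k := 4) ((4, .cup) :: (shift 1 A.word ++
        (shift 3 S.word ++ [(2, .cap), (2, .cap), (0, .cap)]))) (by simp)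
        (.mv (.exchange 0 0 .cup .cup) rfl rfl)
    WordEquiv p 0 0 _ ((0, .cup) :: (0, .cup) :: (shift 1 A.word ++ (4, .cup) ::
        (shift 3 S.word ++ [(2, .cap), (2, .cap), (0, .cap)]))) := by
      have := WordEquiv.ctx (p := p) (n' := 0) (k' := 0)
        [(0, .cup), (0, .cup)] (shift 3 S.word ++ [(2, .cap), (2, .cap), (0, .cap)])
        (.symm (.exR (i := 1) (x := 4) (N := 4) A .cup (by simp) (by simp))) rfl (by simp)
      simpa using this
    WordEquiv p 0 0 _ ((0, .cup) :: (0, .cup) :: (shift 1 A.word ++ (4, .cup) ::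
        (shift 3 S.word ++ [(4, .cap), (2, .cap), (0, .cap)]))) := by
      have := WordEquiv.pre (p := p) (n' := 0) (n := 4) (k := 0)
        ((0, .cup) :: (0, .cup) :: shift 1 A.word) (by simp)
        (.pre (n := 6) ((4, .cup) :: shift 3 S.word) (by simp)
          (.suf (k := 2) [(0, .cap)] rfl (.mv (.exchange 2 0 .cap .cap) rfl rfl)))
      simpa using this
    WordEquiv p 0 0 _ ((0, .cup) :: (0, .cup) :: (shift 1 A.word ++ (4, .cup) ::
        (shift 3 S.word ++ [(4, .cap), (0, .cap), (0, .cap)]))) := by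
      have := WordEquiv.pre (p := p) (n' := 0) (n := 4) (k := 0)
        ((0, .cup) :: (0, .cup) :: shift 1 A.word) (by simp)
        (.pre (n := 6) ((4, .cup) :: shift 3 S.word) (by simp)
          (.pre (n := 4) [(4, .cap)] rfl (.symm (.mv (.exchange 0 0 .cap .cap) rfl rfl))))
      simpa using this
    WordEquiv p 0 0 _ _ := by
      have h : WordEquiv p 4 2 ((4, .cup) :: (shift 3 S.word ++ [(4, .cap), (0, .cap)]))
          ((0, .cap) :: (2, .cup) :: (shift 1 S.word ++ [(2, .cap)])) := by
        have := WordEquiv.exL (p := p) (i := 0) (x := 1) (y := 3) (N := 4) (closeRight S) .cap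
          (by simp) (by simp) (by simp)
        simpa [closeRight] using this.symm
      have := WordEquiv.ctx (p := p) (n' := 0) (n := 4) (k := 2) (k' := 0)
        ((0, .cup) :: (0, .cup) :: shift 1 A.word) [(0, .cap)] h (by simp) rfl
      simpa [pairClosure, closeLeft, closeRight] using this

theorem isBasicSum_denominator_prod {A S : Tangle 2 2} (hA : IsBasicSum (denominator A))
    (hS : IsBasicSum (denominator S)) : IsBasicSum (denominator (prod A S)) :=
  (isBasicSum_pairClosure (hA.congr (closure_closeLeft A)) hS).congr (denominator_prod A S)

/-- The two vertical strands of `[∞]` close `A` on its right and `S` on its left. The outer arcs of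
the numerator are the only connection that is left. -/
theorem isBasicSum_numerator_infty {A S : Tangle 2 2} (hA : IsBasicSum (denominator A))
    (hS : IsBasicSum (denominator S)) :
    IsBasicSum (numerator (prod A (prod inftyTangle S))) := by
  refine (isBasicSum_pairClosure hA (hS.congr (closure_closeLeft S))).congr ?_
  have h : WordEquiv False 4 2 ((3, .cup) :: (shift 4 S.word ++ [(3, .cap), (1, .cap)]))
      ((1, .cap) :: (1, .cup) :: (shift 2 S.word ++ [(1, .cap)])) := by
    have := WordEquiv.exL (p := False) (i := 1) (x := 1) (y := 3) (N := 4) (closeLeft S) .cap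
      (by simp) (by simp) (by simp)
    simpa [closeLeft] using this.symm
  have := WordEquiv.ctx (p := False) (n' := 0) (n := 4) (k := 2) (k' := 0)
        ((0, .cup) :: (1, .cup) :: A.word) [(0, .cap)] h (by simp) rfl
  simpa [pairClosure, closeLeft, closeRight, TangleEquiv] using this

end FiveMove

namespace FiveMove

variable {p : Prop}

/-! ### Rational tangles up to 5-moves -/

/-- The tangle `[1/2]`. -/
def halfTangle : Tangle 2 2 := (crossing true).comp (crossing true)

/-- A tangle that is 5-move equivalent to `[2/5]`, with the figure eight knot as its denominator. -/
def specialTangle : Tangle 2 2 := (prod halfTangle (crossing true)).comp (crossing true)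

theorem cls_half : cls p halfTangle = top true (top true (cls p inftyTangle)) := rfl

theorem cls_special :
    cls p specialTangle = top true (cls p halfTangle * cls p (crossing true)) := rfl

theorem crossing_mul (b : Bool) : cls p (crossing b) * cls p (crossing !b) = 1 := by
  apply bendR_injective
  rw [← one_mul (cls p (crossing b)), bendR_mul_crossing, bendR_mul_crossing]
  cases b <;> simp

theorem bendR_mul_pow (x : TangleClass p 2 2) (j : ℕ) :
    bendR (x * cls p (crossing false) ^ j) = (twistPerm p 1 ^ j) (bendR x) := by
  induction j with
  | zero => simp
  | succ j ih =>
    rw [pow_succ, ← mul_assoc, bendR_mul_crossing, ih, pow_succ']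
    rfl

theorem crossing_pow_five (hp : p) : cls p (crossing false) ^ 5 = 1 := by
  apply bendR_injective
  rw [← one_mul (_ ^ 5), bendR_mul_pow, twistPerm_pow_five hp]
  rfl

theorem crossing_inv (hp : p) : cls p (crossing true) = cls p (crossing false) ^ 4 := by
  rw [← mul_one (cls p (crossing true)), ← crossing_pow_five hp, pow_succ', ← mul_assoc,
    show cls p (crossing true) * cls p (crossing false) = 1 from crossing_mul true, one_mul]

theorem bendR_one : bendR (1 : TangleClass p 2 2) =
    twistPerm p 1 (twistPerm p 0 (bendR (cls p inftyTangle))) := cls_bendRight_zero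

theorem half_mul_crossing_false :
    cls p halfTangle * cls p (crossing false) =
      top false (top false (cls p inftyTangle)) := by
  apply bendR_injective
  simp only [bendR_mul_crossing, cls_half, bendR_top, cond_true, cond_false]
  rw [Equiv.Perm.eq_inv_iff_eq, Equiv.Perm.eq_inv_iff_eq]
  exact (twistAction p).half_twist

theorem crossing_false_mul_half :
    cls p (crossing false) * cls p halfTangle =
      top false (top false (cls p inftyTangle)) := by
  apply bendL_injective
  simp only [bendL_crossing_mul, cls_half, bendL_top, cond_true, cond_false]
  rw [Equiv.Perm.eq_inv_iff_eq, Equiv.Perm.eq_inv_iff_eq]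
  exact (twistAction_left p).half_twist

/-- Both products with `[-1]` are `[-1/2]`. The case of `[1]` follows because it is inverse to
`[-1]`. -/
theorem half_commute (b : Bool) : Commute (cls p halfTangle) (cls p (crossing b)) := by
  have h : Commute (cls p halfTangle) (cls p (crossing false)) :=
    half_mul_crossing_false.trans crossing_false_mul_half.symm
  cases b
  · exact h
  · have h1 : cls p (crossing true) * cls p (crossing false) = 1 := crossing_mul true
    have h2 : cls p (crossing false) * cls p (crossing true) = 1 := crossing_mul false
    calc cls p halfTangle * cls p (crossing true)
      _ = cls p (crossing true) * cls p (crossing false) * cls p halfTangle *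
            cls p (crossing true) := by rw [h1, one_mul]
      _ = cls p (crossing true) * cls p halfTangle := by
        rw [mul_assoc (cls p (crossing true)), ← h.eq, mul_assoc, mul_assoc, h2, mul_one]

theorem special_mul (hp : p) :
    cls p specialTangle * cls p (crossing false) = cls p specialTangle := by
  apply bendR_injective
  simp only [bendR_mul_crossing, cls_special, cls_half, bendR_top, cond_true, cond_false]
  exact (twistAction p).b_special (twistPerm_pow_five hp 0) (twistPerm_pow_five hp 1)

theorem mul_special (hp : p) :
    cls p (crossing false) * cls p specialTangle = cls p specialTangle := by
  apply bendL_injective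
  -- The crossing inside `specialTangle` is brought to the left of `[1/2]`, where `bendL` sees it as
  -- a twist.
  rw [cls_special, (half_commute true).eq]
  simp only [bendL_crossing_mul, cls_half, bendL_top, cond_true, cond_false]
  exact (twistAction_left p).b_special (twistPerm_pow_five hp 1) (twistPerm_pow_five hp 0)

/-- The classes of rational tangles up to 5-moves. -/
def IsRat (x : TangleClass True 2 2) : Prop :=
  TwistAction.Orbit (twistPerm True 0) (twistPerm True 1) (bendR (cls True inftyTangle)) (bendR x)

theorem isRat_infty : IsRat (cls True inftyTangle) := .inl rfl

theorem IsRat.top {x : TangleClass True 2 2} (h : IsRat x) (b : Bool) : IsRat (top b x) := by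
  unfold IsRat
  rw [bendR_top]
  have := twistPerm_pow_five (p := True) trivial
  cases b
  · exact (twistAction True).orbit_a_inv (this 0) (this 1) h
  · exact (twistAction True).orbit_a (this 0) (this 1) h

theorem IsRat.mul_crossing {x : TangleClass True 2 2} (h : IsRat x) (b : Bool) :
    IsRat (x * cls True (crossing b)) := by
  unfold IsRat
  rw [bendR_mul_crossing]
  have := twistPerm_pow_five (p := True) trivial
  cases b
  · exact (twistAction True).orbit_b (this 0) (this 1) h
  · exact (twistAction True).orbit_b_inv (this 0) (this 1) h

theorem IsRat.mul_pow {x : TangleClass True 2 2} (h : IsRat x) (b : Bool) (n : ℕ) :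
    IsRat (x * cls True (crossing b) ^ n) := by
  induction n with
  | zero => simpa using h
  | succ n ih => rw [pow_succ, ← mul_assoc]; exact ih.mul_crossing b

theorem orbit_exists {u : TangleClass True 1 3}
    (h : TwistAction.Orbit (twistPerm True 0) (twistPerm True 1) (bendR (cls True inftyTangle)) u) :
    ∃ x, bendR x = u ∧ (x = cls True inftyTangle ∨ x = cls True specialTangle ∨
      (∃ j : ℕ, x = cls True (crossing false) ^ j) ∨
      ∃ j : ℕ, x = cls True halfTangle * cls True (crossing false) ^ j) := by
  rcases h with rfl | rfl | ⟨j, rfl⟩ | ⟨j, rfl⟩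
  · exact ⟨_, rfl, .inl rfl⟩
  · refine ⟨_, ?_, .inr (.inl rfl)⟩
    simp only [cls_special, cls_half, bendR_top, bendR_mul_crossing, cond_true]
    rfl
  · refine ⟨_, ?_, .inr (.inr (.inl ⟨j, rfl⟩))⟩
    rw [← one_mul (_ ^ j), bendR_mul_pow, bendR_one]
  · exact ⟨_, bendR_mul_pow _ _, .inr (.inr (.inr ⟨j, rfl⟩))⟩

theorem IsRat.cases {x : TangleClass True 2 2} (h : IsRat x) :
    x = cls True inftyTangle ∨ x = cls True specialTangle ∨
      (∃ j : ℕ, x = cls True (crossing false) ^ j) ∨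
      ∃ j : ℕ, x = cls True halfTangle * cls True (crossing false) ^ j := by
  obtain ⟨y, hy, h'⟩ := orbit_exists h
  rw [bendR_injective hy] at h'
  exact h'

theorem isRat_one : IsRat 1 :=
  .inr (.inr (.inl ⟨0, by rw [bendR_one]; rfl⟩))

theorem isRat_half : IsRat (cls True halfTangle) := (isRat_infty.top true).top true

theorem isRat_special : IsRat (cls True specialTangle) :=
  (isRat_half.mul_crossing true).top true

theorem cls_horizontalTwist (a : ℤ) :
    cls p (horizontalTwist a) = cls p (crossing (decide (0 ≤ a))) ^ a.natAbs := by
  rw [horizontalTwist, cls_prodList, List.map_replicate, List.prod_replicate]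

theorem cls_comp_column (A : Tangle 2 2) (b : Bool) (n : ℕ) :
    cls p (A.comp ((List.replicate n (crossing b)).foldr Tangle.comp inftyTangle)) =
      (top b)^[n] (cls p A) := by
  induction n generalizing A with
  | zero => exact congrArg (cls p) (Tangle.ext (by simp))
  | succ n ih =>
    rw [Function.iterate_succ_apply, top, compClass_cls, ← ih]
    exact congrArg (cls p) (Tangle.ext (by simp [List.replicate_succ]))

theorem cls_comp_verticalTwist (A : Tangle 2 2) (a : ℤ) :
    cls p (A.comp (verticalTwist a)) = (top (decide (0 ≤ a)))^[a.natAbs] (cls p A) :=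
  cls_comp_column _ _ _

theorem isRat_contFracTangle (l : List ℤ) :
    IsRat (cls True (contFracTangle l).1) ∧ IsRat (cls True (contFracTangle l).2) := by
  induction l with
  | nil => exact ⟨isRat_infty, isRat_one⟩
  | cons a l ih =>
    refine ⟨?_, ?_⟩
    · show IsRat (cls True (prod _ _))
      rw [cls_prod, cls_horizontalTwist]
      exact ih.2.mul_pow _ _
    · show IsRat (cls True (Tangle.comp _ _))
      rw [cls_comp_verticalTwist]
      exact Function.Iterate.rec (motive := IsRat) ih.1 (fun _ h => h.top _) _

theorem isRat_rationalTangle (x : OnePoint ℚ) : IsRat (cls True (rationalTangle x)) := by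
  cases x with
  | infty => exact isRat_infty
  | coe x => exact (isRat_contFracTangle _).1

/-! ### Numerators and denominators -/

/-- The denominator closure of a bent tangle. -/
def bentClosure (U : Tangle 1 3) : LinkDiagram :=
  ⟨(0, .cup) :: (U.word ++ [(1, .cap), (0, .cap)]), by simp⟩

theorem TangleEquiv.bentClosure {U U' : Tangle 1 3} (h : TangleEquiv p U U') :
    TangleEquiv p (bentClosure U) (bentClosure U') := by
  have := WordEquiv.ctx (k' := 0) (n' := 0) [(0, .cup)] [(1, .cap), (0, .cap)]
    (h.whisker 0 1) rfl rfl
  simpa [TangleEquiv, FiveMove.bentClosure] using this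

theorem bentClosure_bendRight (T : Tangle 2 2) : bentClosure (bendRight T) = denominator T :=
  Tangle.ext (by simp [bentClosure])

theorem bentClosure_twist (U : Tangle 1 3) (b : Bool) :
    TangleEquiv p (bentClosure (U.comp (twist 1 b))) (bentClosure U) := by
  have := WordEquiv.pre (p := p) (n := 4) (k := 0) (n' := 0) ((0, .cup) :: U.word) (by simp)
    (.suf (k := 2) [(0, .cap)] rfl (.mv (.reidemeister_one_cap 1 b) rfl rfl))
  simpa [TangleEquiv, bentClosure] using this

theorem denominator_prod_crossing (T : Tangle 2 2) (b : Bool) :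
    TangleEquiv p (denominator (prod T (crossing b))) (denominator T) := by
  rw [← bentClosure_bendRight, ← bentClosure_bendRight]
  exact (bendRight_prod_crossing T b).bentClosure.trans (bentClosure_twist _ _)

/-- The change from one closure to the other is itself a braid on the three bent ends. Since
rational classes are closed under the twists, a numerator of a rational tangle is a denominator of
one up to 5-moves. -/
theorem numerator_equiv (T : Tangle 2 2) :
    TangleEquiv p (numerator T)
      (bentClosure (((bendRight T).comp (twist 1 true)).comp (twist 0 true))) := by
  unfold TangleEquiv
  simp only [word_numerator, bentClosure, Tangle.word_comp, word_bendRight, word_twist,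
    List.append_assoc, List.cons_append, List.nil_append]
  calc
    WordEquiv p 0 0 _ ((0, .cup) :: (1, .cup) :: (2, .cap) :: (T.word ++ [(0, .cap)])) := by
      have := WordEquiv.ctx (p := p) (n := 2) (k := 2) (n' := 0) (k' := 0) [(0, .cup)]
        (T.word ++ [(0, .cap)]) (.symm (.mv (.zigzag_left 1) rfl rfl)) rfl (by simp)
      simpa using this
    WordEquiv p 0 0 _ ((0, .cup) :: (1, .cup) :: (T.word ++ [(2, .cap), (0, .cap)])) := by
      have := WordEquiv.ctx (p := p) (n' := 0) (k' := 0) [(0, .cup), (1, .cup)] [(0, .cap)]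
        (.symm (.exR (i := 0) (x := 2) (N := 4) T .cap (by simp) (by simp))) rfl rfl
      simpa using this
    WordEquiv p 0 0 _ ((0, .cup) :: (1, .cup) :: (T.word ++ [(0, .cap), (0, .cap)])) := by
      have := WordEquiv.pre (p := p) (n := 4) (k := 0) (n' := 0)
        ((0, .cup) :: (1, .cup) :: T.word) (by simp)
        (.symm (.mv (.exchange 0 0 .cap .cap) rfl rfl))
      simpa using this
    WordEquiv p 0 0 _ ((0, .cup) :: (1, .cup) :: (T.word ++ [(1, .cross true), (1, .cross false),
        (0, .cap), (0, .cap)])) := by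
      have := WordEquiv.ctx (p := p) (n' := 0) (k' := 0)
        ((0, .cup) :: (1, .cup) :: T.word) [(0, .cap), (0, .cap)]
        (.symm (cross_cancel (i := 1) (n := 4) (by norm_num) true)) (by simp) rfl
      simpa using this
    WordEquiv p 0 0 _ _ := by
      have := WordEquiv.pre (p := p) (n := 4) (k := 0) (n' := 0)
        ((0, .cup) :: (1, .cup) :: T.word) (by simp)
        (.ctx (n := 4) (k := 2) [(1, .cross true)] [(0, .cap)]
          (.symm (.mv (.slide_cap 0 true) rfl rfl)) rfl rfl)
      simpa using this

/-- A twist on top of one column is carried along the closing arcs to the top of the other; its sign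
is reversed twice on the way. -/
theorem numerator_prod_comp_crossing (A T : Tangle 2 2) (b : Bool) :
    TangleEquiv p (numerator (prod A (T.comp (crossing b))))
      (numerator (prod (A.comp (crossing b)) T)) := by
  unfold TangleEquiv
  simp only [word_numerator, word_prod, Tangle.word_comp, word_crossing, shift_append, shift_cons,
    shift_nil, List.append_assoc, List.cons_append, List.nil_append]
  calc
    WordEquiv p 0 0 _ ((0, .cup) :: (1, .cup) :: (A.word ++ (shift 2 T.word ++
        [(1, .cross !b), (2, .cap), (0, .cap)]))) := by
      have := WordEquiv.pre (p := p) (n := 4) (k := 0) (n' := 0)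
        ((0, .cup) :: (1, .cup) :: A.word) (by simp)
        (.pre (n := 4) (shift 2 T.word) (by simp)
          (.suf (k := 2) [(0, .cap)] rfl (.symm (.mv (.slide_cap 1 (!b)) rfl rfl))))
      simpa using this
    WordEquiv p 0 0 _ ((0, .cup) :: (1, .cup) :: (A.word ++ (shift 2 T.word ++
        [(1, .cross !b), (0, .cap), (0, .cap)]))) := by
      have := WordEquiv.pre (p := p) (n := 4) (k := 0) (n' := 0)
        ((0, .cup) :: (1, .cup) :: A.word) (by simp)
        (.pre (n := 4) (shift 2 T.word) (by simp)
          (.pre (n := 4) [(1, .cross !b)] rfl (.symm (.mv (.exchange 0 0 .cap .cap) rfl rfl))))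
      simpa using this
    WordEquiv p 0 0 _ ((0, .cup) :: (1, .cup) :: (A.word ++ (shift 2 T.word ++
        [(0, .cross b), (1, .cap), (0, .cap)]))) := by
      have := WordEquiv.pre (p := p) (n := 4) (k := 0) (n' := 0)
        ((0, .cup) :: (1, .cup) :: A.word) (by simp)
        (.pre (n := 4) (shift 2 T.word) (by simp)
          (.suf (k := 2) [(0, .cap)] rfl (.symm (.mv (.slide_cap 0 b) rfl rfl))))
      simpa using this
    WordEquiv p 0 0 _ _ := by
      have := WordEquiv.ctx (p := p) (n' := 0) (k' := 0)
        ((0, .cup) :: (1, .cup) :: A.word) [(1, .cap), (0, .cap)]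
        (.symm (.exL (i := 0) (x := 2) (y := 2) (N := 4) T (.cross b) (by simp) (by simp)
          (by simp))) (by simp) rfl
      simpa using this

theorem numerator_prod_infty (A : Tangle 2 2) : numerator (prod A inftyTangle) = denominator A :=
  Tangle.ext (by simp)

/-! ### Basic sums -/

theorem isBasicSum_denominator_zero : IsBasicSum (denominator zeroTangle) := by
  refine IsBasicSum.trivialKnot.congr ?_
  show WordEquiv False 0 0 [(0, .cup), (1, .cup), (0, .cap), (0, .cup), (1, .cap), (0, .cap)]
    [(0, .cup), (0, .cap)]
  calc
    WordEquiv False 0 0 _ [(0, .cup), (0, .cup), (1, .cap), (0, .cap)] :=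
      .ctx (n := 2) (k := 2) [(0, .cup)] [(0, .cup), (1, .cap), (0, .cap)]
        (.mv (.zigzag_right 0) rfl rfl) rfl rfl
    WordEquiv False 0 0 _ _ :=
      .ctx (n := 2) (k := 2) [(0, .cup)] [(0, .cap)] (.mv (.zigzag_left 0) rfl rfl) rfl rfl

theorem isBasicSum_denominator_infty : IsBasicSum (denominator inftyTangle) := by
  refine IsBasicSum.trivialLink₂.congr ?_
  show WordEquiv False 0 0 [(0, .cup), (1, .cup), (1, .cap), (0, .cap)]
    [(0, .cup), (0, .cap), (0, .cup), (0, .cap)]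
  calc
    WordEquiv False 0 0 _ [(0, .cup), (2, .cup), (2, .cap), (0, .cap)] :=
      closure_left (closeRight inftyTangle)
    WordEquiv False 0 0 _ [(0, .cup), (2, .cup), (0, .cap), (0, .cap)] :=
      .pre (n := 4) [(0, .cup), (2, .cup)] rfl (.symm (.mv (.exchange 0 0 .cap .cap) rfl rfl))
    WordEquiv False 0 0 _ _ :=
      .ctx (n := 2) (k := 2) [(0, .cup)] [(0, .cap)]
        (.symm (.mv (.exchange 0 0 .cap .cup) rfl rfl)) rfl rfl

theorem isBasicSum_denominator_half : IsBasicSum (denominator halfTangle) := IsBasicSum.hopfLink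

/-- The last three crossings of the closed braid are turned into `[1] * [1/2]`, which commutes to
`P`. The remaining crossing travels around `P` on the right from below to above. All steps are
isotopies, as membership in the third family requires. -/
theorem figureEight_equiv : TangleEquiv False figureEight (denominator specialTangle) := by
  have hP : TangleEquiv False (prod (crossing true) halfTangle)
      (prod halfTangle (crossing true)) := cls_eq.1 (half_commute true).eq.symm
  set P : Tangle 2 2 := prod halfTangle (crossing true) with hPdef
  calc
    WordEquiv False 0 0 _ [(0, .cup), (1, .cup), (0, .cross true), (2, .cup), (1, .cross false),
        (0, .cross true), (1, .cross false), (2, .cap), (1, .cap), (0, .cap)] :=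
      .ctx (n := 4) (k := 6) [(0, .cup), (1, .cup)]
        [(1, .cross false), (0, .cross true), (1, .cross false), (2, .cap), (1, .cap), (0, .cap)]
        (.symm (.mv (.exchange 0 0 (.cross true) .cup) rfl rfl)) rfl rfl
    WordEquiv False 0 0 _ [(0, .cup), (1, .cup), (0, .cross true), (1, .cup), (2, .cross true),
        (0, .cross true), (1, .cross false), (2, .cap), (1, .cap), (0, .cap)] :=
      .ctx (n := 4) (k := 6) [(0, .cup), (1, .cup), (0, .cross true)]
        [(0, .cross true), (1, .cross false), (2, .cap), (1, .cap), (0, .cap)]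
        (.mv (.slide_cup 1 false) rfl rfl) rfl rfl
    WordEquiv False 0 0 _ [(0, .cup), (1, .cup), (0, .cross true), (1, .cup), (2, .cross true),
        (0, .cross true), (2, .cross true), (1, .cap), (1, .cap), (0, .cap)] :=
      .ctx (n := 6) (k := 4)
        [(0, .cup), (1, .cup), (0, .cross true), (1, .cup), (2, .cross true), (0, .cross true)]
        [(1, .cap), (0, .cap)] (.mv (.slide_cap 1 false) rfl rfl) rfl rfl
    WordEquiv False 0 0 _ [(0, .cup), (1, .cup), (0, .cross true), (1, .cup), (0, .cross true),
        (2, .cross true), (2, .cross true), (1, .cap), (1, .cap), (0, .cap)] :=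
      .ctx (n := 6) (k := 6)
        [(0, .cup), (1, .cup), (0, .cross true), (1, .cup)]
        [(2, .cross true), (1, .cap), (1, .cap), (0, .cap)]
        (.symm (.mv (.exchange 0 0 (.cross true) (.cross true)) rfl rfl)) rfl rfl
    WordEquiv False 0 0 _ ((0, .cup) :: (1, .cup) :: (0, .cross true) :: (P.word ++
        [(1, .cap), (0, .cap)])) := by
      have := WordEquiv.ctx (n' := 0) (k' := 0) [(0, .cup), (1, .cup), (0, .cross true)]
        [(1, .cap), (0, .cap)] (hP.whisker 0 2) rfl rfl
      simpa [halfTangle] using this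
    WordEquiv False 0 0 _ ((0, .cup) :: (0, .cup) :: (1, .cross false) :: (P.word ++
        [(1, .cap), (0, .cap)])) :=
      .ctx (n := 2) (k := 4) [(0, .cup)] (P.word ++ [(1, .cap), (0, .cap)])
        (.mv (.slide_cup 0 true) rfl rfl) rfl (by simp)
    WordEquiv False 0 0 _ ((0, .cup) :: (2, .cup) :: (1, .cross false) :: (P.word ++
        [(1, .cap), (0, .cap)])) :=
      .suf (k := 4) ((1, .cross false) :: (P.word ++ [(1, .cap), (0, .cap)])) (by simp)
        (.symm (.mv (.exchange 0 0 .cup .cup) rfl rfl))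
    WordEquiv False 0 0 _ ((0, .cup) :: (1, .cup) :: (2, .cross true) :: (P.word ++
        [(1, .cap), (0, .cap)])) :=
      .ctx (n := 2) (k := 4) [(0, .cup)] (P.word ++ [(1, .cap), (0, .cap)])
        (.mv (.slide_cup 1 false) rfl rfl) rfl (by simp)
    WordEquiv False 0 0 _ ((0, .cup) :: (1, .cup) :: (P.word ++
        [(2, .cross true), (1, .cap), (0, .cap)])) := by
      have := WordEquiv.ctx (p := False) (n' := 0) (k' := 0) [(0, .cup), (1, .cup)]
        [(1, .cap), (0, .cap)]
        (.symm (.exR (i := 0) (x := 2) (N := 4) P (.cross true) (by simp) (by simp))) rfl rfl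
      simpa using this
    WordEquiv False 0 0 _ ((0, .cup) :: (1, .cup) :: (P.word ++
        [(1, .cross false), (2, .cap), (0, .cap)])) := by
      have := WordEquiv.pre (p := False) (n' := 0) (n := 4) (k := 0) ((0, .cup) :: (1, .cup) :: P.word)
        (by simp) (.suf (k := 2) [(0, .cap)] rfl (.symm (.mv (.slide_cap 1 false) rfl rfl)))
      simpa using this
    WordEquiv False 0 0 _ ((0, .cup) :: (1, .cup) :: (P.word ++
        [(1, .cross false), (0, .cap), (0, .cap)])) := by
      have := WordEquiv.pre (p := False) (n' := 0) (n := 4) (k := 0) ((0, .cup) :: (1, .cup) :: P.word)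
        (by simp) (.pre (n := 4) [(1, .cross false)] rfl
          (.symm (.mv (.exchange 0 0 .cap .cap) rfl rfl)))
      simpa using this
    WordEquiv False 0 0 _ ((0, .cup) :: (1, .cup) :: (P.word ++
        [(0, .cross true), (1, .cap), (0, .cap)])) := by
      have := WordEquiv.pre (p := False) (n' := 0) (n := 4) (k := 0) ((0, .cup) :: (1, .cup) :: P.word)
        (by simp) (.suf (k := 2) [(0, .cap)] rfl (.symm (.mv (.slide_cap 0 true) rfl rfl)))
      simpa using this
    WordEquiv False 0 0 _ _ := .of_eq (by simp [specialTangle, hPdef])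

theorem isBasicSum_denominator_special : IsBasicSum (denominator specialTangle) :=
  IsBasicSum.figureEight.congr figureEight_equiv.symm

theorem exists_isBasicSum_denominator_mul_pow {A : Tangle 2 2} (hA : IsBasicSum (denominator A))
    (j : ℕ) : ∃ B, cls True B = cls True A * cls True (crossing false) ^ j ∧
      IsBasicSum (denominator B) := by
  induction j with
  | zero => exact ⟨A, by simp, hA⟩
  | succ j ih =>
    obtain ⟨B, hB, h⟩ := ih
    exact ⟨prod B (crossing false), by rw [cls_prod, hB, pow_succ, mul_assoc],
      h.congr (denominator_prod_crossing B false)⟩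

/-- The four kinds of classes have the denominators `T₂`, `4₁`, `T₁` and `H`; crossings multiplied
on the right are mere kinks there. -/
theorem IsRat.exists_denominator {x : TangleClass True 2 2} (h : IsRat x) :
    ∃ A, cls True A = x ∧ IsBasicSum (denominator A) := by
  rcases h.cases with rfl | rfl | ⟨j, rfl⟩ | ⟨j, rfl⟩
  · exact ⟨_, rfl, isBasicSum_denominator_infty⟩
  · exact ⟨_, rfl, isBasicSum_denominator_special⟩
  · obtain ⟨B, hB, h⟩ := exists_isBasicSum_denominator_mul_pow isBasicSum_denominator_zero j
    exact ⟨B, by rw [hB, cls_zero, one_mul], h⟩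
  · exact exists_isBasicSum_denominator_mul_pow isBasicSum_denominator_half j

theorem exists_denominator_prod (l : List (TangleClass True 2 2)) (h : ∀ x ∈ l, IsRat x) :
    ∃ A, cls True A = l.prod ∧ IsBasicSum (denominator A) := by
  induction l with
  | nil => exact ⟨_, cls_zero, isBasicSum_denominator_zero⟩
  | cons x l ih =>
    obtain ⟨A, hA, h1⟩ := (h x (by simp)).exists_denominator
    obtain ⟨S, hS, h2⟩ := ih fun y hy => h y (by simp [hy])
    exact ⟨prod A S, by rw [cls_prod, hA, hS, List.prod_cons], isBasicSum_denominator_prod h1 h2⟩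

/-- The numerator of a class of tangles is 5-move equivalent to a basic sum. -/
def BasicNumerator (x : TangleClass True 2 2) : Prop :=
  ∀ A, cls True A = x → ∃ L, IsBasicSum L ∧ TangleEquiv True (numerator A) L

theorem BasicNumerator.of_exists {x : TangleClass True 2 2} {A : Tangle 2 2} (hA : cls True A = x)
    {L : LinkDiagram} (hL : IsBasicSum L) (h : TangleEquiv True (numerator A) L) :
    BasicNumerator x := by
  rintro B rfl
  exact ⟨L, hL, (cls_eq.1 hA).symm.numerator.trans h⟩

theorem IsRat.basicNumerator {x : TangleClass True 2 2} (h : IsRat x) : BasicNumerator x := by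
  obtain ⟨A, rfl⟩ := cls_surj x
  have h5 := twistPerm_pow_five (p := True) trivial
  have h1 : TwistAction.Orbit (twistPerm True 0) (twistPerm True 1) (bendR (cls True inftyTangle))
      (cls True (((bendRight A).comp (twist 1 true)).comp (twist 0 true))) :=
    (twistAction True).orbit_a (h5 0) (h5 1) ((twistAction True).orbit_b (h5 0) (h5 1) h)
  obtain ⟨y, hy, h2⟩ := orbit_exists h1
  have hyr : IsRat y := by unfold IsRat; rw [hy]; exact h1
  obtain ⟨B, rfl, hB⟩ := hyr.exists_denominator
  refine .of_exists rfl hB ((numerator_equiv A).trans ?_)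
  rw [← bentClosure_bendRight]
  exact (cls_eq.1 hy).symm.bentClosure

theorem basicNumerator_mul_top {x y : TangleClass True 2 2} (b : Bool)
    (h : BasicNumerator (top b x * y)) : BasicNumerator (x * top b y) := by
  obtain ⟨A, rfl⟩ := cls_surj x
  obtain ⟨T, rfl⟩ := cls_surj y
  obtain ⟨L, hL, h'⟩ := h _ (cls_prod (A.comp (crossing b)) T)
  exact .of_exists (cls_prod A (T.comp (crossing b))) hL
    ((numerator_prod_comp_crossing A T b).trans h')

theorem IsRat.basicNumerator_mul_infty {x : TangleClass True 2 2} (h : IsRat x) :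
    BasicNumerator (x * cls True inftyTangle) := by
  obtain ⟨A, rfl, hA⟩ := h.exists_denominator
  exact .of_exists (cls_prod A inftyTangle) hA (by rw [numerator_prod_infty])

/-- Both twists of `[1/2]` are carried over to the other column. This leaves `[∞]`, for which the
numerator is a denominator. -/
theorem IsRat.basicNumerator_mul_half {x : TangleClass True 2 2} (h : IsRat x) :
    BasicNumerator (x * cls True halfTangle) :=
  basicNumerator_mul_top _ (basicNumerator_mul_top _
    ((h.top true).top true).basicNumerator_mul_infty)

theorem IsRat.basicNumerator_mul_special {x : TangleClass True 2 2} (h : IsRat x) :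
    BasicNumerator (x * cls True specialTangle) := by
  rw [cls_special]
  refine basicNumerator_mul_top _ ?_
  rw [(half_commute true).eq, ← mul_assoc]
  exact ((h.top true).mul_crossing true).basicNumerator_mul_half

theorem basicNumerator_infty {l : List (TangleClass True 2 2)} (h : ∀ x ∈ l, IsRat x)
    (hl : cls True inftyTangle ∈ l) : BasicNumerator l.prod := by
  obtain ⟨u, v, rfl⟩ := List.append_of_mem hl
  obtain ⟨A, hA, h1⟩ := exists_denominator_prod u fun x hx => h x (by simp [hx])
  obtain ⟨S, hS, h2⟩ := exists_denominator_prod v fun x hx => h x (by simp [hx])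
  exact .of_exists (A := prod A (prod inftyTangle S))
    (by rw [cls_prod, cls_prod, hA, hS, List.prod_append, List.prod_cons])
    (isBasicSum_numerator_infty h1 h2) (.refl _)

/-! ### The normal form of Montesinos links -/

/-- A crossing commutes past columns `[1/2]` until it meets a column `[2/5]`, which absorbs it. -/
theorem crossing_mul_prod {y : List (TangleClass True 2 2)}
    (hy : ∀ z ∈ y, z = cls True specialTangle ∨ z = cls True halfTangle)
    (hs : cls True specialTangle ∈ y) : cls True (crossing false) * y.prod = y.prod := by
  induction y with
  | nil => simp at hs
  | cons z y ih =>
    rw [List.prod_cons, ← mul_assoc]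
    rcases hy z (by simp) with rfl | rfl
    · rw [mul_special trivial]
    · by_cases h : cls True specialTangle ∈ y
      · rw [← (half_commute false).eq, mul_assoc, ih (fun z hz => hy z (by simp [hz])) h]
      -- The classes of `[2/5]` and `[1/2]` are not known to differ at this point. Here the head,
      -- which is `[1/2]`, must also be `[2/5]`.
      · have h' : cls True specialTangle = cls True halfTangle := by simpa [h] using hs
        rw [← h', mul_special trivial]

theorem pow_crossing_mul_prod {y : List (TangleClass True 2 2)}
    (hy : ∀ z ∈ y, z = cls True specialTangle ∨ z = cls True halfTangle)
    (hs : cls True specialTangle ∈ y) (j : ℕ) :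
    cls True (crossing false) ^ j * y.prod = y.prod := by
  induction j with
  | zero => simp
  | succ j ih => rw [pow_succ, mul_assoc, crossing_mul_prod hy hs, ih]

theorem special_mul_pow (j : ℕ) :
    cls True specialTangle * cls True (crossing false) ^ j = cls True specialTangle := by
  induction j with
  | zero => simp
  | succ j ih => rw [pow_succ, ← mul_assoc, ih, special_mul trivial]

/-- Without `[2/5]` all crossings collect in one power behind the columns `[1/2]`. The presence of
one `[2/5]` removes every crossing, while the order of the columns is kept. -/
theorem prod_normalForm (l : List (TangleClass True 2 2)) (h : ∀ x ∈ l, IsRat x) :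
    cls True inftyTangle ∈ l ∨
    (∃ m j : ℕ, l.prod = cls True halfTangle ^ m * cls True (crossing false) ^ j) ∨
    ∃ y : List (TangleClass True 2 2),
      (∀ z ∈ y, z = cls True specialTangle ∨ z = cls True halfTangle) ∧
      cls True specialTangle ∈ y ∧ l.prod = y.prod := by
  induction l with
  | nil => exact .inr (.inl ⟨0, 0, by simp⟩)
  | cons x l ih =>
    have hc (m j : ℕ) := ((half_commute (p := True) false).pow_pow m j).eq
    rcases ih fun y hy => h y (by simp [hy]) with ih | ⟨m, j, ih⟩ | ⟨y, hy, hs, ih⟩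
    · exact .inl (by simp [ih])
    · rcases (h x (by simp)).cases with rfl | rfl | ⟨i, rfl⟩ | ⟨i, rfl⟩
      · exact .inl (by simp)
      · refine .inr (.inr ⟨cls True specialTangle :: List.replicate m (cls True halfTangle),
          ?_, by simp, ?_⟩)
        · intro z hz
          rcases List.mem_cons.1 hz with rfl | hz
          · exact .inl rfl
          · exact .inr (List.eq_of_mem_replicate hz)
        · rw [List.prod_cons, ih, hc, ← mul_assoc, special_mul_pow, List.prod_cons,
            List.prod_replicate]
      · exact .inr (.inl ⟨m, i + j, by rw [List.prod_cons, ih, ← mul_assoc, ← hc, mul_assoc,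
          ← pow_add]⟩)
      · exact .inr (.inl ⟨m + 1, i + j, by
          rw [List.prod_cons, ih, mul_assoc, ← mul_assoc (_ ^ i), ← hc, mul_assoc, ← pow_add,
            ← mul_assoc, ← pow_succ']⟩)
    · rcases (h x (by simp)).cases with rfl | rfl | ⟨i, rfl⟩ | ⟨i, rfl⟩
      · exact .inl (by simp)
      · refine .inr (.inr ⟨cls True specialTangle :: y, ?_, by simp, by simp [ih]⟩)
        intro z hz
        rcases List.mem_cons.1 hz with rfl | hz
        · exact .inl rfl
        · exact hy z hz
      · exact .inr (.inr ⟨y, hy, hs, by rw [List.prod_cons, ih, pow_crossing_mul_prod hy hs]⟩)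
      · refine .inr (.inr ⟨cls True halfTangle :: y, ?_, by simp [hs], ?_⟩)
        · intro z hz
          rcases List.mem_cons.1 hz with rfl | hz
          · exact .inr rfl
          · exact hy z hz
        · rw [List.prod_cons, ih, mul_assoc, pow_crossing_mul_prod hy hs, List.prod_cons]

/-! ### The classes of the particular columns `[s]`, `[1/2]` and `[2/5]`. -/

theorem contFrac_zero (a : ℤ) : contFrac a 0 = [] := by rw [contFrac]; simp

theorem contFrac_intCast (s : ℤ) : contFrac s 1 = [s] := by
  rw [contFrac]; simp [contFrac_zero]

theorem contFrac_half : contFrac 1 2 = [0, 2] := by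
  rw [contFrac]
  simp only [OfNat.ofNat_ne_zero, ↓reduceDIte]
  norm_num [contFrac_intCast]

theorem contFrac_two_fifths : contFrac 2 5 = [0, 2, 2] := by
  rw [contFrac]
  norm_num
  rw [contFrac]
  norm_num [contFrac_intCast]

theorem rationalTangle_coe (x : ℚ) :
    rationalTangle (x : OnePoint ℚ) = (contFracTangle (contFrac x.num x.den)).1 := rfl

theorem rationalTangle_half :
    rationalTangle ((1 / 2 : ℚ) : OnePoint ℚ) = (contFracTangle [0, 2]).1 := by
  rw [rationalTangle_coe, ← contFrac_half]
  norm_num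

theorem rationalTangle_two_fifths :
    rationalTangle ((2 / 5 : ℚ) : OnePoint ℚ) = (contFracTangle [0, 2, 2]).1 := by
  rw [rationalTangle_coe, ← contFrac_two_fifths]
  norm_num

theorem rationalTangle_intCast (s : ℤ) :
    rationalTangle ((s : ℚ) : OnePoint ℚ) = (contFracTangle [s]).1 := by
  rw [rationalTangle_coe, ← contFrac_intCast]
  norm_num

theorem cls_rationalTangle_half :
    cls p (rationalTangle ((1 / 2 : ℚ) : OnePoint ℚ)) = cls p halfTangle := by
  rw [rationalTangle_half]
  show cls p (prod (inftyTangle.comp (verticalTwist 2)) (horizontalTwist 0)) = _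
  rw [cls_prod, cls_comp_verticalTwist, cls_horizontalTwist]
  simp [cls_half]

theorem cls_rationalTangle_two_fifths :
    cls True (rationalTangle ((2 / 5 : ℚ) : OnePoint ℚ)) = cls True specialTangle := by
  rw [rationalTangle_two_fifths]
  show cls True (prod ((prod zeroTangle (horizontalTwist 2)).comp (verticalTwist 2))
    (horizontalTwist 0)) = _
  rw [cls_prod, cls_comp_verticalTwist, cls_prod, cls_horizontalTwist, cls_horizontalTwist]
  apply bendR_injective
  -- Two vertical twists on `[2]` give `a (a (b⁻¹ (a n)))`, whereas `specialTangle` is `a (b⁻¹ (a (a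
  -- n)))`, literally `[3/5]`. They agree because `2/3` and `3/2` are the same pair modulo 5 up to
  -- sign.
  have h := (twistAction True).a_zero_three (twistPerm_pow_five trivial 0)
  rw [cls_special, cls_half, cls_zero]
  simp only [Int.natAbs_zero, pow_zero, mul_one, show Int.natAbs 2 = 2 from rfl, pow_two,
    Nat.ofNat_nonneg, decide_true, Function.iterate_succ, Function.iterate_zero,
    Function.comp_apply, id_eq, ← mul_assoc, bendR_top, bendR_mul_crossing, cond_true, bendR_one,
    show ∀ x, (twistPerm True 1)⁻¹ (twistPerm True 1 x) = x from (twistPerm True 1).symm_apply_apply]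
  exact congrArg _ h

theorem cls_rationalTangle_intCast (s : ℤ) :
    cls p (rationalTangle ((s : ℚ) : OnePoint ℚ)) =
      cls p (crossing (decide (0 ≤ s))) ^ s.natAbs := by
  rw [rationalTangle_intCast]
  show cls p (prod zeroTangle (horizontalTwist s)) = _
  rw [cls_prod, cls_horizontalTwist, cls_zero, one_mul]

/-- The integer `s` is the representative of `-j` modulo 5 between `-2` and `2`. -/
theorem exists_cls_rationalTangle_intCast (j : ℕ) : ∃ s : ℤ, -2 ≤ s ∧ s ≤ 2 ∧
    cls True (rationalTangle ((s : ℚ) : OnePoint ℚ)) = cls True (crossing false) ^ j := by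
  have h5 : cls True (crossing false) ^ 5 = 1 := crossing_pow_five trivial
  rw [← Nat.div_add_mod j 5, pow_add, pow_mul, h5, one_pow, one_mul]
  have : j % 5 < 5 := Nat.mod_lt _ (by norm_num)
  interval_cases j % 5
  · exact ⟨0, by norm_num, by norm_num, by rw [cls_rationalTangle_intCast]; simp⟩
  · exact ⟨-1, by norm_num, by norm_num, by rw [cls_rationalTangle_intCast]; simp⟩
  · exact ⟨-2, by norm_num, by norm_num, by rw [cls_rationalTangle_intCast]; simp⟩
  · refine ⟨2, by norm_num, by norm_num, ?_⟩
    rw [cls_rationalTangle_intCast]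
    simp only [Nat.ofNat_nonneg, decide_true, crossing_inv trivial, ← pow_mul]
    rw [show (4 * (2 : ℤ).natAbs) = 5 + 3 from rfl, pow_add, h5, one_mul]
  · refine ⟨1, by norm_num, by norm_num, ?_⟩
    rw [cls_rationalTangle_intCast]
    simp [crossing_inv trivial]

/-! ### Sorting the Montesinos links into the three families. -/

theorem fiveMoveEquiv_numerator {A B : Tangle 2 2} (h : cls True A = cls True B) :
    FiveMoveEquiv (numerator A) (numerator B) :=
  fiveMoveEquiv_iff.2 (cls_eq.1 h).numerator

theorem BasicNumerator.exists {x : TangleClass True 2 2} (h : BasicNumerator x) {A : Tangle 2 2}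
    (hA : cls True A = x) : ∃ L, IsBasicSum L ∧ FiveMoveEquiv (numerator A) L := by
  obtain ⟨L, hL, h⟩ := h A hA
  exact ⟨L, hL, fiveMoveEquiv_iff.2 h⟩

theorem exists_columnList {y : List (TangleClass True 2 2)}
    (hy : ∀ z ∈ y, z = cls True specialTangle ∨ z = cls True halfTangle)
    (hs : cls True specialTangle ∈ y) :
    ∃ (k m : ℕ) (x : List (OnePoint ℚ)), 1 ≤ k ∧ k + m = y.length ∧ IsColumnList k m x ∧
      x.map (fun q => cls True (rationalTangle q)) = y := by
  have key : ∀ y : List (TangleClass True 2 2),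
      (∀ z ∈ y, z = cls True specialTangle ∨ z = cls True halfTangle) →
      ∃ (k m : ℕ) (x : List (OnePoint ℚ)), (cls True specialTangle ∈ y → 1 ≤ k) ∧
        k + m = y.length ∧ IsColumnList k m x ∧
        x.map (fun q => cls True (rationalTangle q)) = y := by
    intro y hy
    induction y with
    | nil => exact ⟨0, 0, [], by simp, by simp, .refl _, rfl⟩
    | cons z y ih =>
      obtain ⟨k, m, x, h1, h2, h3, h4⟩ := ih fun z hz => hy z (by simp [hz])
      by_cases hz : z = cls True specialTangle
      · refine ⟨k + 1, m, ((2 / 5 : ℚ) : OnePoint ℚ) :: x, by simp, by simp; omega,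
          h3.cons _, ?_⟩
        rw [List.map_cons, h4, cls_rationalTangle_two_fifths, hz]
      · refine ⟨k, m + 1, ((1 / 2 : ℚ) : OnePoint ℚ) :: x, fun h => h1 ?_, by simp; omega,
          (h3.cons _).trans List.perm_middle.symm, ?_⟩
        · simpa [Ne.symm hz] using h
        · rw [List.map_cons, h4, cls_rationalTangle_half, (hy z (by simp)).resolve_left hz]
  obtain ⟨k, m, x, h1, h2⟩ := key y hy
  exact ⟨k, m, x, h1 hs, h2⟩

theorem cls_prodList_rational (x : List (OnePoint ℚ)) :
    cls True (prodList (x.map rationalTangle)) =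
      (x.map fun q => cls True (rationalTangle q)).prod := by
  rw [cls_prodList, List.map_map]; rfl

theorem montesinos_cases (x : List (OnePoint ℚ)) :
    (∃ (m : ℕ) (s : ℤ), 3 ≤ m ∧ -2 ≤ s ∧ s ≤ 2 ∧
      FiveMoveEquiv (montesinos x) (halfPretzel m s)) ∨
    (∃ (k m : ℕ) (y : List (OnePoint ℚ)), 1 ≤ k ∧ 3 ≤ k + m ∧ IsColumnList k m y ∧
      FiveMoveEquiv (montesinos x) (montesinos y)) ∨
    (∃ L : LinkDiagram, IsBasicSum L ∧ FiveMoveEquiv (montesinos x) L) := by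
  have hx := cls_prodList_rational x
  rcases prod_normalForm (x.map fun q => cls True (rationalTangle q)) (by
    intro z hz
    obtain ⟨q, _, rfl⟩ := List.mem_map.1 hz
    exact isRat_rationalTangle q) with h | ⟨m, j, h⟩ | ⟨y, hy, hs, h⟩
  · refine .inr (.inr ((basicNumerator_infty ?_ h).exists hx))
    intro z hz
    obtain ⟨q, _, rfl⟩ := List.mem_map.1 hz
    exact isRat_rationalTangle q
  · rw [h] at hx
    -- With fewer than three columns `[1/2]` the link is a numerator of at most two rational
    -- classes, hence a basic sum up to 5-moves.
    rcases lt_or_ge m 3 with hm | hm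
    · refine .inr (.inr (BasicNumerator.exists ?_ hx))
      have hj : IsRat (cls True (crossing false) ^ j) := by
        simpa using isRat_one.mul_pow false j
      interval_cases m
      · simpa using hj.basicNumerator
      · simpa using (isRat_half.mul_pow false j).basicNumerator
      · rw [pow_two, mul_assoc, ((half_commute false).pow_right j).eq, ← mul_assoc]
        exact (isRat_half.mul_pow false j).basicNumerator_mul_half
    · obtain ⟨s, hs1, hs2, hs⟩ := exists_cls_rationalTangle_intCast j
      refine .inl ⟨m, s, hm, hs1, hs2, fiveMoveEquiv_numerator ?_⟩
      rw [hx, cls_prodList_rational]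
      simp only [List.map_append, List.map_replicate, cls_rationalTangle_half, List.map_cons, hs,
        List.prod_append, List.prod_replicate, List.map_nil, List.prod_cons, List.prod_nil, mul_one]
  · rw [h] at hx
    obtain ⟨k, m, x', hk, hkm, hx', hy'⟩ := exists_columnList hy hs
    rcases lt_or_ge (k + m) 3 with h3 | h3
    · refine .inr (.inr (BasicNumerator.exists ?_ hx))
      rw [hkm] at h3
      match y, h3, hy, hs with
      | [z], _, hy, hs =>
        obtain rfl : cls True specialTangle = z := by simpa using hs
        simpa using isRat_special.basicNumerator
      | [z, w], _, hy, hs =>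
        have hz : IsRat z := by
          rcases hy z (by simp) with rfl | rfl
          exacts [isRat_special, isRat_half]
        rw [List.prod_cons, List.prod_cons, List.prod_nil, mul_one]
        rcases hy w (by simp) with rfl | rfl
        exacts [hz.basicNumerator_mul_special, hz.basicNumerator_mul_half]
    · refine .inr (.inl ⟨k, m, x', hk, h3, hx', fiveMoveEquiv_numerator ?_⟩)
      rw [hx, cls_prodList_rational, hy']

end FiveMove

/-! ### Invariants of diagrams from representations. -/

namespace FiveMove

/-! ## Evaluation of diagrams in a tower of algebras -/

/-- A `K`-algebra with elements for the elementary pieces of a diagram; the endomorphism `L` adds a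
strand on the left.  The relations are those of the planar isotopies. -/
structure Tower (K R : Type*) [CommRing K] [Ring R] [Algebra K R] where
  L : R →ₐ[K] R
  piece : Piece → R
  cup_mul : ∀ x, piece .cup * L (L x) = x * piece .cup
  cap_mul : ∀ x, piece .cap * x = L (L x) * piece .cap
  cross_mul : ∀ b x, piece (.cross b) * L (L x) = L (L x) * piece (.cross b)
  zigzag_left : piece .cup * L (piece .cap) = 1
  zigzag_right : L (piece .cup) * piece .cap = 1

namespace Tower

variable {K R : Type*} [CommRing K] [Ring R] [Algebra K R] (t : Tower K R)

/-- The endomorphism that adds `n` strands on the left. -/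
def lift (n : ℕ) : R →ₐ[K] R := t.L ^ n

@[simp] theorem lift_zero (x : R) : t.lift 0 x = x := rfl

@[simp] theorem lift_one (x : R) : t.lift 1 x = t.L x := rfl

theorem lift_add (m n : ℕ) (x : R) : t.lift (m + n) x = t.lift m (t.lift n x) := by
  simp only [lift, pow_add]
  rfl

/-- The product of the elements of the pieces of a diagram, from bottom to top. -/
def eval (w : List Slice) : R := (w.map fun a => t.lift a.1 (t.piece a.2)).prod

@[simp] theorem eval_nil : t.eval [] = 1 := rfl

@[simp] theorem eval_cons (i : ℕ) (e : Piece) (w : List Slice) :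
    t.eval ((i, e) :: w) = t.lift i (t.piece e) * t.eval w := by simp [eval]

@[simp] theorem eval_append (w w' : List Slice) : t.eval (w ++ w') = t.eval w * t.eval w' := by
  simp [eval]

@[simp] theorem eval_shift (i : ℕ) (w : List Slice) :
    t.eval (shift i w) = t.lift i (t.eval w) := by
  induction w with
  | nil => simp [shift]
  | cons a w ih =>
    obtain ⟨j, e⟩ := a
    rw [eval_cons, map_mul, ← ih, ← lift_add]
    simp [shift]

theorem piece_mul (e : Piece) (x : R) :
    t.piece e * t.lift e.cod x = t.lift e.dom x * t.piece e := by
  cases e with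
  | cup => exact t.cup_mul x
  | cap => exact t.cap_mul x
  | cross b => exact t.cross_mul b x

/-- The elements of a part of a diagram commute with everything far to the right. -/
theorem eval_mul {w : List Slice} {m n : ℕ} (h : target w m = some n) (x : R) :
    t.eval w * t.lift n x = t.lift m x * t.eval w := by
  induction w generalizing m with
  | nil => simp_all [target]
  | cons a w ih =>
    obtain ⟨i, e⟩ := a
    simp only [target] at h
    split_ifs at h with hi
    obtain ⟨r, rfl⟩ := Nat.exists_eq_add_of_le hi
    have h' := ih h
    rw [show i + e.dom + r - e.dom + e.cod = i + (e.cod + r) by omega] at h'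
    rw [eval_cons, mul_assoc, h', ← mul_assoc, lift_add, ← map_mul, lift_add, piece_mul, map_mul,
      ← lift_add, ← lift_add, mul_assoc]

/-- The relations for the crossings: the Reidemeister moves of type I and the 5-moves hold up to
factors from a group `G` of units, the others hold exactly. -/
structure IsInvariant (G : Subgroup Kˣ) : Prop where
  slide_cup : ∀ b, t.L (t.piece .cup) * t.piece (.cross b) =
    t.piece .cup * t.L (t.piece (.cross !b))
  slide_cap : ∀ b, t.piece (.cross b) * t.L (t.piece .cap) =
    t.L (t.piece (.cross !b)) * t.piece .cap
  one_cup : ∀ b, ∃ g ∈ G, t.piece .cup * t.piece (.cross b) = g • t.piece .cup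
  one_cap : ∀ b, ∃ g ∈ G, t.piece (.cross b) * t.piece .cap = g • t.piece .cap
  two : ∀ b, t.piece (.cross b) * t.piece (.cross !b) = 1
  three : ∀ b, t.piece (.cross b) * t.L (t.piece (.cross b)) * t.piece (.cross b) =
    t.L (t.piece (.cross b)) * t.piece (.cross b) * t.L (t.piece (.cross b))
  five : ∀ b, ∃ g ∈ G, t.piece (.cross b) ^ 5 = g • (1 : R)
  injective : Function.Injective (algebraMap K R)

variable {t} {G : Subgroup Kˣ}

theorem lift_units_smul (i : ℕ) (g : Kˣ) (x : R) : t.lift i (g • x) = g • t.lift i x := by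
  simp [Units.smul_def]

theorem IsInvariant.isotopyMove (ht : t.IsInvariant G) {l r : List Slice} (h : IsotopyMove l r) :
    ∃ g ∈ G, t.eval l = g • t.eval r := by
  cases h with
  | exchange i d e f =>
    refine ⟨1, G.one_mem, ?_⟩
    simp only [eval_cons, eval_nil, mul_one, one_smul, add_assoc]
    rw [lift_add, ← map_mul, lift_add _ e.cod, piece_mul, map_mul, lift_add, lift_add]
  | zigzag_left i =>
    refine ⟨1, G.one_mem, ?_⟩
    simp [lift_add, ← map_mul, t.zigzag_left]
  | zigzag_right i =>
    refine ⟨1, G.one_mem, ?_⟩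
    simp [lift_add, ← map_mul, t.zigzag_right]
  | slide_cup i b =>
    refine ⟨1, G.one_mem, ?_⟩
    simp [lift_add, ← map_mul, ht.slide_cup]
  | slide_cap i b =>
    refine ⟨1, G.one_mem, ?_⟩
    simp [lift_add, ← map_mul, ht.slide_cap]
  | reidemeister_one_cup i b =>
    obtain ⟨g, hg, h⟩ := ht.one_cup b
    refine ⟨g, hg, ?_⟩
    simp [← map_mul, h, lift_units_smul]
  | reidemeister_one_cap i b =>
    obtain ⟨g, hg, h⟩ := ht.one_cap b
    refine ⟨g, hg, ?_⟩
    simp [← map_mul, h, lift_units_smul]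
  | reidemeister_two i b =>
    refine ⟨1, G.one_mem, ?_⟩
    simp [← map_mul, ht.two]
  | reidemeister_three i b =>
    refine ⟨1, G.one_mem, ?_⟩
    simp [lift_add, ← map_mul, ← mul_assoc, ht.three]

theorem IsInvariant.fiveTwist (ht : t.IsInvariant G) {l r : List Slice} (h : FiveTwist l r) :
    ∃ g ∈ G, t.eval l = g • t.eval r := by
  cases h with
  | insert i b =>
    obtain ⟨g, hg, h⟩ := ht.five b
    refine ⟨g⁻¹, G.inv_mem hg, ?_⟩
    have : t.eval (List.replicate 5 (i, Piece.cross b)) = g • (1 : R) := by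
      rw [eval, List.map_replicate, List.prod_replicate, ← map_pow, h, lift_units_smul, map_one]
    rw [this]
    simp

/-- Evaluations of equivalent diagrams agree up to a factor from `G`. -/
theorem IsInvariant.eval_equiv (ht : t.IsInvariant G) {m n : ℕ} {T T' : Tangle m n} {p : Prop}
    (h : TangleEquiv p T T') : ∃ g ∈ G, t.eval T.word = g • t.eval T'.word := by
  unfold TangleEquiv WordEquiv at h
  generalize T.word = w, T'.word = w' at h ⊢
  induction h with
  | rel w w' h =>
    obtain ⟨-, -, u, v, l, r, hm, rfl, rfl⟩ := h
    obtain ⟨g, hg, h⟩ : ∃ g ∈ G, t.eval l = g • t.eval r := by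
      rcases hm with hm | ⟨-, hm⟩
      exacts [ht.isotopyMove hm, ht.fiveTwist hm]
    exact ⟨g, hg, by simp [h, Units.smul_def]⟩
  | refl w => exact ⟨1, G.one_mem, by simp⟩
  | symm w w' _ ih =>
    obtain ⟨g, hg, h⟩ := ih
    exact ⟨g⁻¹, G.inv_mem hg, by simp [h]⟩
  | trans w w' w'' _ _ ih ih' =>
    obtain ⟨g, hg, h⟩ := ih
    obtain ⟨g', hg', h'⟩ := ih'
    exact ⟨g * g', G.mul_mem hg hg', by simp [h, h', mul_smul]⟩

end Tower

end FiveMove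

namespace FiveMove

/-! ## The Kauffman bracket -/

variable {K R : Type*} [CommRing K] [Ring R] [Algebra K R]

/-- The value of a circle in the Kauffman bracket with the variable `A`. -/
def loopValue (A : Kˣ) : K := -(A : K) ^ 2 - ((A⁻¹ : Kˣ) : K) ^ 2

namespace Tower

/-- The element of a local maximum below a local minimum. -/
def hook (t : Tower K R) : R := t.piece .cap * t.piece .cup

/-- The element of a linear combination of the tangles `[0]` and `[∞]`. -/
def skein (t : Tower K R) (x : K × K) : R := x.1 • t.hook + x.2 • (1 : R)

/-- The skein relations of the Kauffman bracket. -/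
structure IsBracket (t : Tower K R) (A : Kˣ) : Prop where
  loop : t.piece .cup * t.piece .cap = loopValue A • (1 : R)
  cross_true : t.piece (.cross true) = t.skein (((A⁻¹ : Kˣ) : K), (A : K))
  cross_false : t.piece (.cross false) = t.skein ((A : K), ((A⁻¹ : Kˣ) : K))
  injective : Function.Injective (algebraMap K R)

variable {t : Tower K R} {A : Kˣ}

theorem IsBracket.cross (ht : t.IsBracket A) (b : Bool) :
    t.piece (.cross b) = t.skein (((cond b A⁻¹ A : Kˣ) : K), ((cond b A A⁻¹ : Kˣ) : K)) := by
  cases b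
  exacts [ht.cross_false, ht.cross_true]

theorem IsBracket.hook_mul_hook (ht : t.IsBracket A) : t.hook * t.hook = loopValue A • t.hook := by
  rw [hook, mul_assoc, ← mul_assoc (t.piece .cup), ht.loop]
  simp

theorem IsBracket.skein_mul (ht : t.IsBracket A) (x y : K × K) :
    t.skein x * t.skein y =
      t.skein (x.1 * y.1 * loopValue A + x.1 * y.2 + x.2 * y.1, x.2 * y.2) := by
  simp only [skein, add_mul, mul_add, smul_mul_smul_comm, ht.hook_mul_hook, one_mul, mul_one]
  module

/-- The Temperley–Lieb relation `e₁ e₂ e₁ = e₁`: two zigzags are straightened. -/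
theorem hook_lift_hook (t : Tower K R) : t.hook * t.L t.hook * t.hook = t.hook := by
  rw [hook, map_mul]
  calc _ = t.piece .cap * (t.piece .cup * t.L (t.piece .cap)) *
      (t.L (t.piece .cup) * t.piece .cap) * t.piece .cup := by noncomm_ring
    _ = _ := by rw [t.zigzag_left, t.zigzag_right]; simp

theorem lift_hook_hook (t : Tower K R) : t.L t.hook * t.hook * t.L t.hook = t.L t.hook := by
  rw [hook, map_mul]
  calc _ = t.L (t.piece .cap) * (t.L (t.piece .cup) * t.piece .cap) *
      (t.piece .cup * t.L (t.piece .cap)) * t.L (t.piece .cup) := by noncomm_ring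
    _ = _ := by rw [t.zigzag_left, t.zigzag_right]; simp

theorem cup_mul_skein (ht : t.IsBracket A) (x : K × K) :
    t.piece .cup * t.skein x = (x.1 * loopValue A + x.2) • t.piece .cup := by
  rw [skein, hook, mul_add, mul_smul_comm, ← mul_assoc, ht.loop]
  simp [add_smul, mul_smul]

theorem skein_mul_cap (ht : t.IsBracket A) (x : K × K) :
    t.skein x * t.piece .cap = (x.1 * loopValue A + x.2) • t.piece .cap := by
  rw [skein, hook, add_mul, smul_mul_assoc, mul_assoc, ht.loop]
  simp [add_smul, mul_smul]

theorem lift_cup_mul_skein (t : Tower K R) (x : K × K) :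
    t.L (t.piece .cup) * t.skein x = x.1 • t.piece .cup + x.2 • t.L (t.piece .cup) := by
  rw [skein, hook, mul_add, mul_smul_comm, ← mul_assoc, t.zigzag_right]
  simp

theorem cup_mul_lift_skein (t : Tower K R) (x : K × K) :
    t.piece .cup * t.L (t.skein x) = x.1 • t.L (t.piece .cup) + x.2 • t.piece .cup := by
  rw [skein, hook, map_add, map_smul, map_smul, map_mul, mul_add, mul_smul_comm, ← mul_assoc,
    t.zigzag_left]
  simp

theorem skein_mul_lift_cap (t : Tower K R) (x : K × K) :
    t.skein x * t.L (t.piece .cap) = x.1 • t.piece .cap + x.2 • t.L (t.piece .cap) := by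
  rw [skein, hook, add_mul, smul_mul_assoc, mul_assoc, t.zigzag_left]
  simp

theorem lift_skein_mul_cap (t : Tower K R) (x : K × K) :
    t.L (t.skein x) * t.piece .cap = x.1 • t.L (t.piece .cap) + x.2 • t.piece .cap := by
  rw [skein, hook, map_add, map_smul, map_smul, map_mul, add_mul, smul_mul_assoc, mul_assoc,
    t.zigzag_right]
  simp

end Tower

/-- The equation for the variable of the Kauffman bracket under which five half twists are a scalar:
`A` is a primitive root of unity of order `40`, or `8`. -/
def IsFiveRoot (A : Kˣ) : Prop :=
  (A : K) ^ 8 - (A : K) ^ 4 + 1 - ((A⁻¹ : Kˣ) : K) ^ 4 + ((A⁻¹ : Kˣ) : K) ^ 8 = 0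

/-- With `ζ = -A⁴` the equation reads `ζ² + ζ + 1 + ζ⁻¹ + ζ⁻² = 0`, so `ζ⁵ = 1`. The sign `-1` is
thus a power of `A`, which allows kink factors `-A^(±3)` in the group generated by `A`. -/
theorem IsFiveRoot.pow_twenty {A : Kˣ} (hA : IsFiveRoot A) : A ^ 20 = -1 := by
  ext
  have h : (A : K) * ((A⁻¹ : Kˣ) : K) = 1 := A.mul_inv
  simp only [IsFiveRoot] at hA
  generalize ((A⁻¹ : Kˣ) : K) = b at *
  push_cast
  generalize (A : K) = a at *
  have h4 : a ^ 4 * b ^ 4 = 1 := by rw [← mul_pow, h, one_pow]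
  have h8 : a ^ 8 * b ^ 8 = 1 := by rw [← mul_pow, h, one_pow]
  linear_combination (a ^ 8 + a ^ 12) * hA + (a ^ 4 + a ^ 8) * h4 - (1 + a ^ 4) * h8

namespace Tower

variable {t : Tower K R} {A : Kˣ}

/-- A positive crossing acts with the two characteristic values `A` and `-A⁻³`. Their ratio is
`-A⁴`, whose fifth power is `1`, so five half twists are the scalar `A⁵`. -/
theorem IsBracket.isInvariant (ht : t.IsBracket A) (hA : IsFiveRoot A) :
    t.IsInvariant (Subgroup.zpowers A) := by
  have h : (A : K) * ((A⁻¹ : Kˣ) : K) = 1 := A.mul_inv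
  have h20 := hA.pow_twenty
  have e1 : ∀ b : Bool, ∃ g ∈ Subgroup.zpowers A,
      ((cond b A⁻¹ A : Kˣ) : K) * loopValue A + ((cond b A A⁻¹ : Kˣ) : K) = (g : K) := by
    have h' : ((A : K)) ^ 20 = -1 := by
      rw [← Units.val_pow_eq_pow_val, h20]
      simp
    intro b
    cases b
    -- The kink factors are `-A³ = A²³` and, in the other case, `-A⁻³ = A¹⁷`, by `A ^ 20 = -1`.
    · refine ⟨A ^ 23, Subgroup.npow_mem_zpowers _ _, ?_⟩
      simp only [cond, loopValue, Units.val_pow_eq_pow_val]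
      linear_combination -(((A⁻¹ : Kˣ) : K)) * h - (A : K) ^ 3 * h'
    · refine ⟨A ^ 17, Subgroup.npow_mem_zpowers _ _, ?_⟩
      simp only [cond, loopValue, Units.val_pow_eq_pow_val]
      generalize ((A⁻¹ : Kˣ) : K) = b at *
      generalize (A : K) = a at *
      have h3 : a ^ 3 * b ^ 3 = 1 := by rw [← mul_pow, h, one_pow]
      linear_combination -a * h + a ^ 17 * h3 - b ^ 3 * h'
  have e5 : ∀ b : Bool, ∃ g ∈ Subgroup.zpowers A, t.piece (.cross b) ^ 5 = g • (1 : R) := by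
    intro b
    refine ⟨(cond b A A⁻¹) ^ 5, Subgroup.pow_mem _ (by cases b <;> simp) _, ?_⟩
    have hb : ((cond b A A⁻¹ : Kˣ) : K) * ((cond b A⁻¹ A : Kˣ) : K) = 1 := by cases b <;> simp
    have hl : loopValue A = -((cond b A A⁻¹ : Kˣ) : K) ^ 2 - ((cond b A⁻¹ A : Kˣ) : K) ^ 2 := by
      cases b <;> (simp [loopValue]; try ring)
    have hr : ((cond b A A⁻¹ : Kˣ) : K) ^ 8 - ((cond b A A⁻¹ : Kˣ) : K) ^ 4 + 1 -
        ((cond b A⁻¹ A : Kˣ) : K) ^ 4 + ((cond b A⁻¹ A : Kˣ) : K) ^ 8 = 0 := by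
      rw [← hA]
      cases b <;> (simp; try ring)
    rw [ht.cross b, Units.smul_def, Units.val_pow_eq_pow_val]
    generalize ((cond b A A⁻¹ : Kˣ) : K) = a at *
    generalize ((cond b A⁻¹ A : Kˣ) : K) = c at *
    -- One more crossing multiplies the coefficient of `[∞]` by `a`, and adds a multiple of it to
    -- `-c³` times the coefficient of `[0]`. After five crossings the latter coefficient vanishes by
    -- `hr`.
    have step : ∀ x y : K, t.skein (x, y) * t.skein (c, a) =
        t.skein (-c ^ 3 * x + y * c, y * a) := by
      intro x y
      rw [ht.skein_mul, hl]
      congr 2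
      linear_combination -x * a * hb
    rw [pow_succ, pow_succ, pow_succ, pow_two, step, step, step, step, skein]
    rw [show -c ^ 3 * (-c ^ 3 * (-c ^ 3 * (-c ^ 3 * c + a * c) + a * a * c) + a * a * a * c) +
        a * a * a * a * c = 0 by
      linear_combination c ^ 5 * hr + (-c ^ 9 + c ^ 5 * (a * c + 1) + c ^ 4 * a ^ 3 -
        c * a ^ 4 * (1 + a * c + a ^ 2 * c ^ 2 + a ^ 3 * c ^ 3)) * hb]
    rw [zero_smul, zero_add]
    congr 1
    ring
  refine ⟨?_, ?_, ?_, ?_, ?_, ?_, e5, ht.injective⟩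
  · intro b
    rw [ht.cross, ht.cross, lift_cup_mul_skein, cup_mul_lift_skein]
    cases b <;> simp [add_comm]
  · intro b
    rw [ht.cross, ht.cross, skein_mul_lift_cap, lift_skein_mul_cap]
    cases b <;> simp [add_comm]
  · intro b
    obtain ⟨g, hg, h⟩ := e1 b
    exact ⟨g, hg, by rw [ht.cross, cup_mul_skein ht, h, Units.smul_def]⟩
  · intro b
    obtain ⟨g, hg, h⟩ := e1 b
    exact ⟨g, hg, by rw [ht.cross, skein_mul_cap ht, h, Units.smul_def]⟩
  · intro b
    rw [ht.cross, ht.cross, ht.skein_mul]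
    have h1 : t.skein (0, 1) = 1 := by simp [skein]
    rw [← h1]
    congr 2
    · cases b <;> (simp [loopValue]; try ring)
    · cases b <;> simp
  · intro b
    have e1 := t.hook_lift_hook
    have e2 := t.lift_hook_hook
    have e3 := ht.hook_mul_hook
    have e4 : t.L t.hook * t.L t.hook = loopValue A • t.L t.hook := by rw [← map_mul, e3, map_smul]
    have hb : ((cond b A A⁻¹ : Kˣ) : K) * ((cond b A⁻¹ A : Kˣ) : K) = 1 := by cases b <;> simp
    have hl : loopValue A = -((cond b A A⁻¹ : Kˣ) : K) ^ 2 - ((cond b A⁻¹ A : Kˣ) : K) ^ 2 := by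
      cases b <;> (simp [loopValue]; try ring)
    rw [ht.cross b]
    generalize ((cond b A A⁻¹ : Kˣ) : K) = a at *
    generalize ((cond b A⁻¹ A : Kˣ) : K) = c at *
    simp only [skein, map_add, map_smul, map_one]
    generalize t.hook = x at *
    generalize t.L x = y at *
    simp only [add_mul, mul_add, one_mul, mul_one, smul_mul_assoc,
      mul_smul_comm, e1, e2, e3, e4, hl]
    match_scalars
    · linear_combination (-c ^ 3 - a ^ 2 * c) * hb
    · ring
    · ring
    · linear_combination (c ^ 3 + a ^ 2 * c) * hb
    · ring

end Tower

end FiveMove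

namespace FiveMove

/-! ## The Kauffman bracket of Montesinos links -/

variable {K R : Type*} [CommRing K] [Ring R] [Algebra K R]

namespace Tower

variable {t : Tower K R} {A : Kˣ}

theorem lift_two (t : Tower K R) (x : R) : t.lift 2 x = t.L (t.L x) := rfl

theorem eval_comp {a b c : ℕ} (S : Tangle a b) (T : Tangle b c) :
    t.eval (S.comp T).word = t.eval S.word * t.eval T.word := by
  simp [Tangle.comp]

/-- Side by side, `[0]` is the unit and `[∞] * [∞]` is `[∞]` times a circle. This algebra has two
characters, recorded by `HasChar`, which turn Montesinos links into products over their columns. -/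
theorem IsBracket.eval_prod (ht : t.IsBracket A) {S T : Tangle 2 2} {x y : K × K}
    (hS : t.eval S.word = t.skein x) (hT : t.eval T.word = t.skein y) :
    t.eval (prod S T).word =
      t.skein (x.1 * y.1, x.1 * y.2 + x.2 * y.1 + loopValue A * x.2 * y.2) := by
  have e1 : t.lift 2 (t.skein y) * t.L (t.piece .cap) =
      y.1 • (t.lift 2 (t.piece .cap)) + y.2 • t.L (t.piece .cap) := by
    have := congrArg t.L (lift_skein_mul_cap t y)
    simpa only [map_mul, map_add, map_smul, lift_two] using this
  have e2 : t.L (t.piece .cup) * t.piece .cap = 1 := t.zigzag_right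
  have e3 : t.L (t.piece .cup) * t.L (t.piece .cap) = loopValue A • (1 : R) := by
    rw [← map_mul, ht.loop, map_smul, map_one]
  have e4 : t.L (t.piece .cup) * t.lift 2 (t.piece .cap) = 1 := by
    have := congrArg t.L t.zigzag_left
    simpa only [map_mul, map_one, lift_two] using this
  have e5 : t.piece .cup * t.lift 2 (t.piece .cap) = t.hook := t.cup_mul _
  simp only [word_prod, eval_cons, eval_append, eval_nil, mul_one, eval_shift, hS, hT, lift_one]
  rw [e1, ← mul_assoc, lift_cup_mul_skein]
  simp only [add_mul, mul_add, smul_mul_smul_comm, e3, e4, e5, t.zigzag_left]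
  simp only [skein]
  module

/-- The characters of the algebra of 2-tangles with the product `*`. -/
def HasChar (t : Tower K R) (A : Kˣ) (T : Tangle 2 2) (p q : K) : Prop :=
  ∃ x, t.eval T.word = t.skein x ∧ x.1 = p ∧ x.1 + loopValue A * x.2 = q

theorem HasChar.prod (ht : t.IsBracket A) {S T : Tangle 2 2} {p q p' q' : K}
    (hS : t.HasChar A S p q) (hT : t.HasChar A T p' q') :
    t.HasChar A (prod S T) (p * p') (q * q') := by
  obtain ⟨x, hx, rfl, rfl⟩ := hS
  obtain ⟨y, hy, rfl, rfl⟩ := hT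
  exact ⟨_, ht.eval_prod hx hy, rfl, by ring⟩

theorem hasChar_zeroTangle (t : Tower K R) (A : Kˣ) : t.HasChar A zeroTangle 1 1 :=
  ⟨(1, 0), by simp [skein, hook], by simp⟩

theorem HasChar.prodList (ht : t.IsBracket A) {ι : Type*} (T : ι → Tangle 2 2) (p q : ι → K)
    (l : List ι) (h : ∀ i ∈ l, t.HasChar A (T i) (p i) (q i)) :
    t.HasChar A (prodList (l.map T)) (l.map p).prod (l.map q).prod := by
  induction l with
  | nil => exact hasChar_zeroTangle t A
  | cons i l ih =>
    simp only [List.forall_mem_cons] at h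
    simpa [FiveMove.prodList] using h.1.prod ht (ih h.2)

/-- With `δ = loopValue A` the numerators of `[0]` and `[∞]` are two circles and one, so the value
is `δ² x₁ + δ x₂`, written here in the characters. -/
theorem HasChar.eval_numerator (ht : t.IsBracket A) {T : Tangle 2 2} {p q : K}
    (h : t.HasChar A T p q) :
    t.eval (numerator T).word = ((loopValue A ^ 2 - 1) * p + q) • (1 : R) := by
  obtain ⟨x, hx, rfl, rfl⟩ := h
  simp only [word_numerator, eval_cons, eval_append, eval_nil, mul_one, lift_zero, hx]
  rw [skein_mul_cap ht, mul_smul_comm, ht.loop, smul_smul]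
  congr 1
  ring

theorem IsBracket.eval_denominator (ht : t.IsBracket A) {T : Tangle 2 2} {x : K × K}
    (h : t.eval T.word = t.skein x) :
    t.eval (denominator T).word = (loopValue A * (x.1 + loopValue A * x.2)) • (1 : R) := by
  simp only [word_denominator, eval_cons, eval_append, eval_nil, mul_one, lift_zero, h, lift_one]
  rw [← mul_assoc (t.skein x), skein_mul_lift_cap, ← mul_assoc (t.L _), mul_add, mul_smul_comm,
    mul_smul_comm, t.zigzag_right, ← map_mul, ht.loop, map_smul, map_one, smul_smul, ← add_smul,
    smul_mul_assoc, one_mul, mul_smul_comm, ht.loop, smul_smul]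
  congr 1
  ring

theorem IsBracket.eval_crossing (ht : t.IsBracket A) (b : Bool) :
    t.eval (crossing b).word =
      t.skein (((cond b A⁻¹ A : Kˣ) : K), ((cond b A A⁻¹ : Kˣ) : K)) := by
  simp [ht.cross]

theorem IsBracket.hasChar_crossing (ht : t.IsBracket A) (b : Bool) :
    t.HasChar A (crossing b) ((cond b A⁻¹ A : Kˣ) : K) (-((cond b A A⁻¹ : Kˣ) : K) ^ 3) := by
  refine ⟨_, ht.eval_crossing b, rfl, ?_⟩
  have h : (A : K) * ((A⁻¹ : Kˣ) : K) = 1 := A.mul_inv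
  cases b
  · simp only [loopValue, cond]
    linear_combination -(A : K) * h
  · simp only [loopValue, cond]
    linear_combination -((A⁻¹ : Kˣ) : K) * h

/-- The values of the characters on `[s]`. -/
theorem IsBracket.hasChar_horizontalTwist (ht : t.IsBracket A) (s : ℤ) :
    t.HasChar A (horizontalTwist s) ((A ^ (-s) : Kˣ) : K) (((-A ^ 3) ^ s : Kˣ) : K) := by
  have h := HasChar.prodList ht (fun b : Bool => crossing b) _ _
    (List.replicate s.natAbs (decide (0 ≤ s))) fun b _ => ht.hasChar_crossing b
  simp only [List.map_replicate, List.prod_replicate] at h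
  rw [← horizontalTwist] at h
  convert h using 1
  · rcases le_or_gt 0 s with hs | hs
    · obtain ⟨n, rfl⟩ := Int.eq_ofNat_of_zero_le hs
      simp
    · obtain ⟨n, rfl⟩ := Int.exists_eq_neg_ofNat hs.le
      simp only [hs.not_ge, decide_false, cond, neg_neg, Int.natAbs_neg, Int.natAbs_natCast,
        zpow_natCast, Units.val_pow_eq_pow_val]
  · rcases le_or_gt 0 s with hs | hs
    · obtain ⟨n, rfl⟩ := Int.eq_ofNat_of_zero_le hs
      simp
    · obtain ⟨n, rfl⟩ := Int.exists_eq_neg_ofNat hs.le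
      simp only [hs.not_ge, decide_false, cond, Int.natAbs_neg, Int.natAbs_natCast,
        zpow_natCast, zpow_neg, ← inv_pow, inv_neg, Units.val_pow_eq_pow_val, Units.val_neg]

end Tower

/-! ### The golden section equation and the characters of the columns. -/

/-- The element `A ^ 4 + A ^ (-4)`; it satisfies the equation of the golden section. -/
def golden (A : Kˣ) : K := (A : K) ^ 4 + ((A⁻¹ : Kˣ) : K) ^ 4

theorem loopValue_sq (A : Kˣ) : loopValue A ^ 2 = golden A + 2 := by
  have h : (A : K) * ((A⁻¹ : Kˣ) : K) = 1 := A.mul_inv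
  simp only [loopValue, golden]
  linear_combination 2 * ((A : K) * ((A⁻¹ : Kˣ) : K) + 1) * h

theorem IsFiveRoot.golden_sq {A : Kˣ} (hA : IsFiveRoot A) : golden A ^ 2 = golden A + 1 := by
  have h : (A : K) * ((A⁻¹ : Kˣ) : K) = 1 := A.mul_inv
  have h4 : (A : K) ^ 4 * ((A⁻¹ : Kˣ) : K) ^ 4 = 1 := by rw [← mul_pow, h, one_pow]
  simp only [IsFiveRoot, golden] at *
  linear_combination hA + 2 * h4

theorem IsFiveRoot.of_golden {A : Kˣ} (hA : golden A ^ 2 = golden A + 1) : IsFiveRoot A := by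
  have h : (A : K) * ((A⁻¹ : Kˣ) : K) = 1 := A.mul_inv
  have h4 : (A : K) ^ 4 * ((A⁻¹ : Kˣ) : K) ^ 4 = 1 := by rw [← mul_pow, h, one_pow]
  simp only [IsFiveRoot, golden] at *
  linear_combination hA - 2 * h4

namespace Tower

variable {t : Tower K R} {A : Kˣ}

theorem IsBracket.eval_halfTangle (ht : t.IsBracket A) :
    t.eval halfTangle.word = t.skein (1 - ((A⁻¹ : Kˣ) : K) ^ 4, (A : K) ^ 2) := by
  have h : (A : K) * ((A⁻¹ : Kˣ) : K) = 1 := A.mul_inv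
  rw [halfTangle, eval_comp, ht.eval_crossing, ht.skein_mul]
  congr 2
  · simp only [loopValue, cond]
    linear_combination (1 - ((A⁻¹ : Kˣ) : K) * (A : K)) * h
  · simp [pow_two]

theorem IsBracket.hasChar_halfTangle (ht : t.IsBracket A) :
    t.HasChar A halfTangle (1 - ((A⁻¹ : Kˣ) : K) ^ 4) (-golden A) := by
  have h : (A : K) * ((A⁻¹ : Kˣ) : K) = 1 := A.mul_inv
  refine ⟨_, ht.eval_halfTangle, rfl, ?_⟩
  simp only [loopValue, golden]
  linear_combination (-1 - ((A⁻¹ : Kˣ) : K) * (A : K)) * h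

/-- The vanishing of the second character has two uses: links with a column `[2/5]` have only one
term in their bracket, and the bracket of `4₁`, the denominator, is zero. -/
theorem IsBracket.eval_specialTangle (ht : t.IsBracket A) (hA : IsFiveRoot A) : ∃ x,
    t.eval specialTangle.word = t.skein x ∧
      x.1 = ((A⁻¹ : Kˣ) : K) ^ 12 * (1 - (A : K) ^ 8) ∧ x.1 + loopValue A * x.2 = 0 := by
  have h : (A : K) * ((A⁻¹ : Kˣ) : K) = 1 := A.mul_inv
  refine ⟨_, by
    rw [specialTangle, eval_comp, ht.eval_prod ht.eval_halfTangle (ht.eval_crossing true),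
      ht.eval_crossing, ht.skein_mul], ?_, ?_⟩
  · simp only [loopValue, cond, IsFiveRoot] at *
    generalize ((A⁻¹ : Kˣ) : K) = b at *
    generalize (A : K) = a at *
    clear ht
    grind
  · simp only [loopValue, cond, IsFiveRoot] at *
    generalize ((A⁻¹ : Kˣ) : K) = b at *
    generalize (A : K) = a at *
    clear ht
    grind

theorem IsBracket.hasChar_specialTangle (ht : t.IsBracket A) (hA : IsFiveRoot A) :
    t.HasChar A specialTangle (((A⁻¹ : Kˣ) : K) ^ 12 * (1 - (A : K) ^ 8)) 0 := 
  ht.eval_specialTangle hA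

end Tower

/-! ### Brackets of the two families. -/

theorem halfPretzel_equiv {p : Prop} (m : ℕ) (s : ℤ) : TangleEquiv p (halfPretzel m s)
    (numerator (prodList (List.replicate m halfTangle ++ [horizontalTwist s]))) := by
  apply TangleEquiv.numerator
  rw [← cls_eq]
  simp only [cls_prodList, List.map_append, List.map_replicate, List.map_cons, List.map_nil,
    cls_rationalTangle_half, cls_rationalTangle_intCast, cls_horizontalTwist]

open Classical in
/-- The tangle `[1/2]`, or a tangle that is 5-move equivalent to `[2/5]`. -/
noncomputable def columnTangle (x : OnePoint ℚ) : Tangle 2 2 :=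
  if x = ((1 / 2 : ℚ) : OnePoint ℚ) then halfTangle else specialTangle

theorem columnTangle_half : columnTangle ((1 / 2 : ℚ) : OnePoint ℚ) = halfTangle := if_pos rfl

theorem columnTangle_two_fifths : columnTangle ((2 / 5 : ℚ) : OnePoint ℚ) = specialTangle :=
  if_neg fun h => by
    have := OnePoint.coe_injective h
    norm_num at this

theorem IsColumnList.equiv {k m : ℕ} {y : List (OnePoint ℚ)} (hy : IsColumnList k m y) :
    TangleEquiv True (montesinos y) (numerator (prodList (y.map columnTangle))) := by
  apply TangleEquiv.numerator
  rw [← cls_eq, cls_prodList, cls_prodList, List.map_map, List.map_map]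
  congr 1
  apply List.map_congr_left
  intro x hx
  have := hy.mem_iff.1 hx
  rw [List.mem_append, List.mem_replicate, List.mem_replicate] at this
  rcases this with ⟨-, rfl⟩ | ⟨-, rfl⟩
  · rw [Function.comp_apply, Function.comp_apply, columnTangle_two_fifths,
      cls_rationalTangle_two_fifths]
  · rw [Function.comp_apply, Function.comp_apply, columnTangle_half, cls_rationalTangle_half]

namespace Tower

variable {t : Tower K R} {A : Kˣ}

/-- The bracket of the links `M[m[1/2], [s]]`. -/
theorem IsBracket.eval_halfPretzel (ht : t.IsBracket A) (hA : IsFiveRoot A) (m : ℕ) (s : ℤ) :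
    ∃ g ∈ Subgroup.zpowers A, t.eval (halfPretzel m s).word =
      g • ((golden A ^ 2 * (1 - ((A⁻¹ : Kˣ) : K) ^ 4) ^ m * ((A ^ (-s) : Kˣ) : K) +
        (-golden A) ^ m * (((-A ^ 3) ^ s : Kˣ) : K)) • (1 : R)) := by
  obtain ⟨g, hg, h⟩ := (ht.isInvariant hA).eval_equiv (halfPretzel_equiv (p := True) m s)
  refine ⟨g, hg, h.trans ?_⟩
  have h1 := HasChar.prodList ht (ι := Tangle 2 2 × K × K) (·.1) (·.2.1) (·.2.2)
    (List.replicate m (halfTangle, 1 - ((A⁻¹ : Kˣ) : K) ^ 4, -golden A) ++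
      [(horizontalTwist s, ((A ^ (-s) : Kˣ) : K), (((-A ^ 3) ^ s : Kˣ) : K))]) (by
      intro i hi
      rw [List.mem_append, List.mem_replicate, List.mem_singleton] at hi
      rcases hi with ⟨-, rfl⟩ | rfl
      exacts [ht.hasChar_halfTangle, ht.hasChar_horizontalTwist s])
  simp only [List.map_append, List.map_replicate, List.map_cons, List.map_nil, List.prod_append,
    List.prod_replicate, List.prod_singleton] at h1
  rw [h1.eval_numerator ht, loopValue_sq, hA.golden_sq]
  congr 2
  ring

open Classical in
/-- The bracket of the links `M[k[2/5], m[1/2]]`. -/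
theorem IsBracket.eval_columnList (ht : t.IsBracket A) (hA : IsFiveRoot A) {k m : ℕ} (hk : 1 ≤ k)
    {y : List (OnePoint ℚ)} (hy : IsColumnList k m y) :
    ∃ g ∈ Subgroup.zpowers A, t.eval (montesinos y).word =
      g • ((golden A ^ 2 * (1 - (A : K) ^ 8) ^ k * (1 - ((A⁻¹ : Kˣ) : K) ^ 4) ^ m) • (1 : R)) := by
  obtain ⟨g, hg, h⟩ := (ht.isInvariant hA).eval_equiv hy.equiv
  have h1 := HasChar.prodList ht columnTangle
    (fun x => if x = ((1 / 2 : ℚ) : OnePoint ℚ) then 1 - ((A⁻¹ : Kˣ) : K) ^ 4 else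
      ((A⁻¹ : Kˣ) : K) ^ 12 * (1 - (A : K) ^ 8))
    (fun x => if x = ((1 / 2 : ℚ) : OnePoint ℚ) then -golden A else 0) y (by
      intro x hx
      simp only [columnTangle]
      split_ifs
      exacts [ht.hasChar_halfTangle, ht.hasChar_specialTangle hA])
  have hne : ((2 / 5 : ℚ) : OnePoint ℚ) ≠ ((1 / 2 : ℚ) : OnePoint ℚ) := fun h => by
    have := OnePoint.coe_injective h
    norm_num at this
  rw [(hy.map _).prod_eq, (hy.map _).prod_eq] at h1
  simp only [List.map_append, List.map_replicate, List.prod_append, List.prod_replicate, if_pos,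
    if_neg hne, zero_pow (Nat.one_le_iff_ne_zero.1 hk), zero_mul] at h1
  refine ⟨g * (A⁻¹) ^ (12 * k), Subgroup.mul_mem _ hg (by
    rw [inv_pow]
    exact Subgroup.inv_mem _ (Subgroup.npow_mem_zpowers _ _)), ?_⟩
  rw [h, h1.eval_numerator ht, loopValue_sq, hA.golden_sq, mul_smul]
  congr 1
  rw [Units.smul_def, smul_smul, Units.val_pow_eq_pow_val]
  congr 1
  rw [mul_pow]
  ring

end Tower

end FiveMove

namespace FiveMove

/-! ## Connected sums and the Kauffman bracket -/

/-- `L` is a connected sum of `a` copies of `T₂`, `b` copies of `H` and `f` copies of `4₁`. -/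
inductive BasicCount : LinkDiagram → ℕ → ℕ → ℕ → Prop
  | trivialKnot : BasicCount trivialKnot 0 0 0
  | trivialLink₂ : BasicCount trivialLink₂ 1 0 0
  | hopfLink : BasicCount hopfLink 0 1 0
  | figureEight : BasicCount figureEight 0 0 1
  | connectedSum {L₁ L₂ L : LinkDiagram} {a b f a' b' f' : ℕ} :
      BasicCount L₁ a b f → BasicCount L₂ a' b' f' → IsConnectedSum L₁ L₂ L →
      BasicCount L (a + a') (b + b') (f + f')

theorem IsBasicSum.exists_count {L : LinkDiagram} (h : IsBasicSum L) :
    ∃ a b f, BasicCount L a b f := by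
  induction h with
  | trivialKnot => exact ⟨_, _, _, .trivialKnot⟩
  | trivialLink₂ => exact ⟨_, _, _, .trivialLink₂⟩
  | hopfLink => exact ⟨_, _, _, .hopfLink⟩
  | figureEight => exact ⟨_, _, _, .figureEight⟩
  | connectedSum _ _ h ih ih' =>
    obtain ⟨_, _, _, h1⟩ := ih
    obtain ⟨_, _, _, h2⟩ := ih'
    exact ⟨_, _, _, .connectedSum h1 h2 h⟩

variable {K R : Type*} [CommRing K] [Ring R] [Algebra K R]

namespace Tower

variable (t : Tower K R)

/-- The elements of the diagrams without crossings and maxima that start from one strand. -/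
inductive IsCups : ℕ → R → Prop
  | one : IsCups 1 1
  | cup {n : ℕ} {x : R} (i : ℕ) : i ≤ n → IsCups n x → IsCups (n + 2) (x * t.lift i (t.piece .cup))

/-- The linear combinations of diagrams without crossings and maxima. -/
def cupSpan (n : ℕ) : Submodule K R := Submodule.span K {x | t.IsCups n x}

variable {t} {A : Kˣ}

theorem mul_lift_mem_cupSpan {n i : ℕ} (hi : i ≤ n) {x : R} (hx : x ∈ t.cupSpan n) :
    x * t.lift i (t.piece .cup) ∈ t.cupSpan (n + 2) := by
  induction hx using Submodule.span_induction with
  | mem x hx => exact Submodule.subset_span (.cup i hi hx)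
  | zero => simp
  | add x y _ _ hx hy => rw [add_mul]; exact add_mem hx hy
  | smul c x _ hx => rw [smul_mul_assoc]; exact Submodule.smul_mem _ c hx

/-- The new maximum is compared with the last minimum: they form a circle or a zigzag, or the
maximum slides past it to earlier ones. Only one strand comes from below, so a maximum cannot reach
the bottom. -/
theorem IsBracket.isCups_mul_cap (ht : t.IsBracket A) {n : ℕ} {x : R} (hx : t.IsCups n x) :
    ∀ {j k : ℕ}, n = k + 2 → j ≤ k → x * t.lift j (t.piece .cap) ∈ t.cupSpan k := by
  induction hx with
  | one => omega
  | @cup n x i hi hx ih =>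
    intro j k hn hj
    obtain rfl : n = k := by omega
    have hx' : x ∈ t.cupSpan n := Submodule.subset_span hx
    rw [mul_assoc]
    obtain rfl | rfl | rfl | ⟨d, rfl⟩ | ⟨d, rfl⟩ :
        j = i ∨ j = i + 1 ∨ i = j + 1 ∨ (∃ d, j = i + 2 + d) ∨ ∃ d, i = j + 2 + d := by
      rcases lt_trichotomy i j with h | h | h
      · rcases Nat.eq_or_lt_of_le h with h | h
        · omega
        · exact .inr (.inr (.inr (.inl ⟨j - (i + 2), by omega⟩)))
      · omega
      · rcases Nat.eq_or_lt_of_le h with h | h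
        · omega
        · exact .inr (.inr (.inr (.inr ⟨i - (j + 2), by omega⟩)))
    · rw [← map_mul, ht.loop, map_smul, map_one, mul_smul_comm, mul_one]
      exact Submodule.smul_mem _ _ hx'
    · rw [lift_add, ← map_mul, lift_one, t.zigzag_left, map_one, mul_one]
      exact hx'
    · rw [lift_add, ← map_mul, lift_one, t.zigzag_right, map_one, mul_one]
      exact hx'
    · rw [add_assoc, lift_add, ← map_mul, lift_add, lift_two, t.cup_mul, map_mul, ← lift_add,
        ← mul_assoc]
      obtain ⟨k, rfl⟩ : ∃ k, n = k + 2 := ⟨n - 2, by omega⟩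
      exact mul_lift_mem_cupSpan (by omega) (ih rfl (by omega))
    · rw [add_assoc, lift_add, ← map_mul, lift_add, lift_two, ← t.cap_mul, map_mul, ← lift_add,
        ← mul_assoc]
      obtain ⟨k, rfl⟩ : ∃ k, n = k + 2 := ⟨n - 2, by omega⟩
      exact mul_lift_mem_cupSpan (by omega) (ih rfl (by omega))

theorem IsBracket.mul_cap_mem_cupSpan (ht : t.IsBracket A) {k j : ℕ} (hj : j ≤ k) {x : R}
    (hx : x ∈ t.cupSpan (k + 2)) : x * t.lift j (t.piece .cap) ∈ t.cupSpan k := by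
  induction hx using Submodule.span_induction with
  | mem x hx => exact ht.isCups_mul_cap hx rfl hj
  | zero => simp
  | add x y _ _ hx hy => rw [add_mul]; exact add_mem hx hy
  | smul c x _ hx => rw [smul_mul_assoc]; exact Submodule.smul_mem _ c hx

theorem IsBracket.eval_mem_cupSpan (ht : t.IsBracket A) {w : List Slice} {m n : ℕ}
    (hw : target w m = some n) {x : R} (hx : x ∈ t.cupSpan m) : x * t.eval w ∈ t.cupSpan n := by
  induction w generalizing m x with
  | nil =>
    obtain rfl : m = n := by simpa [target] using hw
    simpa using hx
  | cons a w ih =>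
    obtain ⟨i, e⟩ := a
    simp only [target] at hw
    split_ifs at hw with hi
    rw [eval_cons, ← mul_assoc]
    refine ih hw ?_
    cases e with
    | cup => exact mul_lift_mem_cupSpan hi hx
    | cap =>
      obtain ⟨k, rfl⟩ : ∃ k, m = k + 2 := ⟨m - 2, by simp at hi; omega⟩
      exact ht.mul_cap_mem_cupSpan (k := k) (by simp at hi; omega) hx
    | cross b =>
      obtain ⟨k, rfl⟩ : ∃ k, m = k + 2 := ⟨m - 2, by simp at hi; omega⟩
      have hi' : i ≤ k := by simp at hi; omega
      rw [ht.cross, skein, map_add, map_smul, map_smul, map_one, hook, map_mul, mul_add,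
        mul_smul_comm, mul_smul_comm, mul_one, ← mul_assoc]
      exact add_mem (Submodule.smul_mem _ _ (mul_lift_mem_cupSpan hi'
        (ht.mul_cap_mem_cupSpan hi' hx))) (Submodule.smul_mem _ _ hx)

/-- Resolution of crossings and removal of maxima leave diagrams with minima only, and from one
strand to one strand this is the strand alone. -/
theorem IsBracket.eval_strand (ht : t.IsBracket A) (T : Tangle 1 1) :
    ∃ c : K, t.eval T.word = c • (1 : R) := by
  have h := ht.eval_mem_cupSpan T.valid (Submodule.subset_span IsCups.one)
  have h1 : {x | t.IsCups 1 x} = {1} := by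
    ext x
    simp only [Set.mem_ofPred_eq, Set.mem_singleton_iff]
    constructor
    · generalize hn : 1 = n
      rintro (_ | ⟨i, hi, hx⟩)
      · rfl
      · omega
    · rintro rfl
      exact .one
  rw [cupSpan, h1, one_mul, Submodule.mem_span_singleton] at h
  obtain ⟨c, h⟩ := h
  exact ⟨c, h.symm⟩

theorem eval_closure {d c : K} (hd : t.piece .cup * t.piece .cap = d • (1 : R)) {T : Tangle 1 1}
    (h : t.eval T.word = c • (1 : R)) : t.eval (closure T).word = (d * c) • (1 : R) := by
  simp only [word_closure, eval_cons, eval_append, eval_nil, mul_one, lift_zero, h, smul_mul_assoc,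
    one_mul, mul_smul_comm, hd, smul_smul]
  rw [mul_comm]

theorem smul_one_injective {G : Subgroup Kˣ} (ht : t.IsInvariant G) {a b : K}
    (h : a • (1 : R) = b • 1) : a = b := by
  apply ht.injective
  rw [Algebra.algebraMap_eq_smul_one, Algebra.algebraMap_eq_smul_one, h]

/-- The scalars of the cut-open summands multiply, whereas each closure contributes a circle; the
extra circle is cancelled, whence `hd`. The factor `0 ^ f`, with `0 ^ 0 = 1`, records that any copy
of `4₁` kills the bracket. -/
theorem IsBracket.eval_basicCount [IsDomain K] (ht : t.IsBracket A) (hA : IsFiveRoot A)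
    (hd : loopValue A ≠ 0) {L : LinkDiagram} {a b f : ℕ} (h : BasicCount L a b f) :
    ∃ g ∈ Subgroup.zpowers A, t.eval L.word =
      g • ((loopValue A ^ (a + 1) * (-golden A) ^ b * 0 ^ f) • (1 : R)) := by
  have hi := ht.isInvariant hA
  induction h with
  | trivialKnot => exact ⟨1, one_mem _, by simp [trivialKnot, ht.loop]⟩
  | trivialLink₂ =>
    exact ⟨1, one_mem _, by simp [trivialLink₂, ht.loop, smul_smul, pow_two]⟩
  | hopfLink =>
    have h : hopfLink = denominator halfTangle := rfl
    obtain ⟨x, hx, -, h2⟩ := ht.hasChar_halfTangle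
    exact ⟨1, one_mem _, by rw [h, ht.eval_denominator hx, h2]; simp⟩
  | figureEight =>
    obtain ⟨x, hx, -, h2⟩ := ht.hasChar_specialTangle hA
    obtain ⟨g, hg, h⟩ := hi.eval_equiv figureEight_equiv
    exact ⟨g, hg, by rw [h, ht.eval_denominator hx, h2]; simp⟩
  | @connectedSum L₁ L₂ L a b f a' b' f' _ _ h ih ih' =>
    obtain ⟨S, T, h1, h2, h3⟩ := h
    obtain ⟨c, hc⟩ := ht.eval_strand S
    obtain ⟨c', hc'⟩ := ht.eval_strand T
    have hcc : t.eval (S.comp T).word = (c * c') • (1 : R) := by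
      rw [eval_comp, hc, hc', smul_mul_smul_comm, mul_one]
    obtain ⟨g1, hg1, e1⟩ := hi.eval_equiv (isotopic_iff.1 h1)
    obtain ⟨g2, hg2, e2⟩ := hi.eval_equiv (isotopic_iff.1 h2)
    obtain ⟨g3, hg3, e3⟩ := hi.eval_equiv (isotopic_iff.1 h3)
    obtain ⟨g4, hg4, e4⟩ := ih
    obtain ⟨g5, hg5, e5⟩ := ih'
    rw [eval_closure ht.loop hc] at e1
    rw [eval_closure ht.loop hc'] at e2
    rw [eval_closure ht.loop hcc] at e3
    refine ⟨g3 * (g1⁻¹ * g4) * (g2⁻¹ * g5), mul_mem (mul_mem hg3 (mul_mem (inv_mem hg1) hg4))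
      (mul_mem (inv_mem hg2) hg5), ?_⟩
    have k1 : loopValue A * c = (((g1⁻¹ * g4 : Kˣ)) : K) *
        (loopValue A ^ (a + 1) * (-golden A) ^ b * 0 ^ f) := by
      apply smul_one_injective hi
      rw [← smul_smul (((g1⁻¹ * g4 : Kˣ)) : K), ← Units.smul_def, mul_smul g1⁻¹, ← e4, e1, inv_smul_smul]
    have k2 : loopValue A * c' = (((g2⁻¹ * g5 : Kˣ)) : K) *
        (loopValue A ^ (a' + 1) * (-golden A) ^ b' * 0 ^ f') := by
      apply smul_one_injective hi
      rw [← smul_smul (((g2⁻¹ * g5 : Kˣ)) : K), ← Units.smul_def, mul_smul g2⁻¹, ← e5, e2,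
        inv_smul_smul]
    rw [e3, mul_assoc, mul_smul g3]
    congr 1
    rw [Units.smul_def, smul_smul]
    congr 1
    apply mul_left_cancel₀ hd
    rw [Units.val_mul]
    linear_combination loopValue A * c' * k1 + (((g1⁻¹ * g4 : Kˣ)) : K) *
        (loopValue A ^ (a + 1) * (-golden A) ^ b * 0 ^ f) * k2

end Tower

end FiveMove

namespace FiveMove

/-! ## The vertex model of the Kauffman bracket -/

section Head

variable (K : Type*) [CommRing K] (α : Type*)

/-- The functions of infinitely many states. -/
abbrev StateSpace : Type _ := Stream' α → K

variable {K α}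

/-- An operator for each value of the first state, acting on the other states. -/
def headLift : (α → Module.End K (StateSpace K α)) →ₐ[K] Module.End K (StateSpace K α) where
  toFun T :=
    { toFun := fun F x => T x.head (fun y => F (.cons x.head y)) x.tail
      map_add' := fun F G => by
        ext x
        exact congrFun ((T x.head).map_add _ _) _
      map_smul' := fun c F => by
        ext x
        exact congrFun ((T x.head).map_smul _ _) _ }
  map_one' := by
    ext F x
    simp
  map_mul' S T := by
    ext F x
    simp
  map_zero' := by
    ext F x
    simp
  map_add' S T := by
    ext F x
    simp
  commutes' c := by
    ext F x
    simp [Algebra.algebraMap_eq_smul_one]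

@[simp] theorem headLift_apply (T : α → Module.End K (StateSpace K α)) (F : StateSpace K α)
    (x : Stream' α) : headLift T F x = T x.head (fun y => F (.cons x.head y)) x.tail := rfl

/-- An operator that acts on all states but the first. -/
def tailLift : Module.End K (StateSpace K α) →ₐ[K] Module.End K (StateSpace K α) :=
  headLift.comp (Pi.constAlgHom K α _)

@[simp] theorem tailLift_apply (T : Module.End K (StateSpace K α)) (F : StateSpace K α)
    (x : Stream' α) : tailLift T F x = T (fun y => F (.cons x.head y)) x.tail := rfl

theorem algebraMap_end_injective (K α : Type*) [CommRing K] [Nonempty α] :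
    Function.Injective (algebraMap K (Module.End K (StateSpace K α))) := by
  intro a b h
  have := congrFun (LinearMap.congr_fun h fun _ => 1) (.const (Classical.arbitrary α))
  simpa [Algebra.algebraMap_eq_smul_one] using this

end Head

variable {K : Type*} [CommRing K]

/-- The local minimum of the vertex model. -/
def vertexCup (A : Kˣ) : Module.End K (StateSpace K Bool) where
  toFun F x := F (.cons false (.cons true x)) - (A : K) ^ 2 * F (.cons true (.cons false x))
  map_add' F G := by
    ext x
    simp
    ring
  map_smul' c F := by
    ext x
    simp
    ring

/-- The weights of a local maximum in the vertex model. -/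
def capWeight (A : Kˣ) : Bool → Bool → K
  | true, false => 1
  | false, true => -((A⁻¹ : Kˣ) : K) ^ 2
  | _, _ => 0

@[simp] theorem vertexCup_apply (A : Kˣ) (F : StateSpace K Bool) (x : Stream' Bool) :
    vertexCup A F x =
      F (.cons false (.cons true x)) - (A : K) ^ 2 * F (.cons true (.cons false x)) := rfl

/-- The local maximum of the vertex model. -/
def vertexCap (A : Kˣ) : Module.End K (StateSpace K Bool) where
  toFun F x := capWeight A x.head x.tail.head * F x.tail.tail
  map_add' F G := by
    ext x
    simp
    ring
  map_smul' c F := by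
    ext x
    simp
    ring

@[simp] theorem vertexCap_apply (A : Kˣ) (F : StateSpace K Bool) (x : Stream' Bool) :
    vertexCap A F x = capWeight A x.head x.tail.head * F x.tail.tail := rfl

theorem vertexCup_mul (A : Kˣ) (T : Module.End K (StateSpace K Bool)) :
    vertexCup A * tailLift (tailLift T) = T * vertexCup A := by
  ext F x
  have h : T (vertexCup A F) = T (fun y => F (.cons false (.cons true y))) -
      (A : K) ^ 2 • T (fun y => F (.cons true (.cons false y))) := by
    rw [← map_smul, ← map_sub]
    rfl
  simp [h]

theorem vertexCap_mul (A : Kˣ) (T : Module.End K (StateSpace K Bool)) :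
    vertexCap A * T = tailLift (tailLift T) * vertexCap A := by
  ext F x
  have h : T (fun y => vertexCap A F (.cons x.head (.cons x.tail.head y))) =
      capWeight A x.head x.tail.head • T F := by
    rw [← map_smul]
    rfl
  exact (congrFun h x.tail.tail).symm

/-- The vertex model of the Kauffman bracket. -/
def vertexModel (A : Kˣ) : Tower K (Module.End K (StateSpace K Bool)) where
  L := tailLift
  piece
    | .cup => vertexCup A
    | .cap => vertexCap A
    | .cross b => ((cond b A⁻¹ A : Kˣ) : K) • (vertexCap A * vertexCup A) +
        ((cond b A A⁻¹ : Kˣ) : K) • 1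
  cup_mul T := vertexCup_mul A T
  cap_mul T := vertexCap_mul A T
  cross_mul b T := by
    simp only [add_mul, mul_add, smul_mul_assoc, mul_smul_comm, one_mul, mul_one]
    rw [mul_assoc, vertexCup_mul, ← mul_assoc, vertexCap_mul, mul_assoc]
  zigzag_left := by
    ext F x
    have h : (A : K) * ((A⁻¹ : Kˣ) : K) = 1 := A.mul_inv
    rw [← Stream'.eta x]
    rcases x.head with _ | _
    · simp [capWeight]
    · simp [capWeight, ← mul_assoc, ← mul_pow, h]
  zigzag_right := by
    ext F x
    have h : (A : K) * ((A⁻¹ : Kˣ) : K) = 1 := A.mul_inv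
    rw [← Stream'.eta x]
    rcases x.head with _ | _
    · simp [capWeight, ← mul_assoc, ← mul_pow, h]
    · simp [capWeight]

theorem vertexModel_isBracket (A : Kˣ) : (vertexModel A).IsBracket A where
  loop := by
    ext F x
    simp [vertexModel, capWeight, loopValue]
    ring
  cross_true := rfl
  cross_false := rfl
  injective := algebraMap_end_injective _ _

end FiveMove

namespace FiveMove

/-! ## A spin model with five states

The square root of `5` and a fifth root of unity are `4` and `3` in `ZMod 11`. -/

/-- The states of the spin model: functions of the spins of infinitely many shaded regions. -/
abbrev SpinSpace : Type := StateSpace (ZMod 11) (ZMod 5)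

/-- The Boltzmann weights of the two kinds of crossings. -/
def spinWeight (b : Bool) (u : ZMod 5) : ZMod 11 := (cond b 3 4) ^ (u ^ 2).val

/-- The Boltzmann weights of a crossing between unshaded regions. -/
def spinMatrix (b : Bool) : Matrix (ZMod 5) (ZMod 5) (ZMod 11) :=
  .of fun x y => 3 * spinWeight (!b) (x - y)

/-- A matrix that acts on the first spin. -/
def headMatrix : Matrix (ZMod 5) (ZMod 5) (ZMod 11) →ₐ[ZMod 11] Module.End (ZMod 11) SpinSpace where
  toFun W :=
    { toFun := fun F x => ∑ y, W x.head y * F (.cons y x.tail)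
      map_add' := fun F G => by
        ext x
        simp [mul_add, Finset.sum_add_distrib]
      map_smul' := fun c F => by
        ext x
        simp only [Pi.smul_apply, smul_eq_mul, Finset.mul_sum, RingHom.id_apply]
        exact Finset.sum_congr rfl fun y _ => mul_left_comm _ _ _ }
  map_one' := by
    ext F x
    simp [Matrix.one_apply]
  map_mul' S T := by
    ext F x
    simp only [LinearMap.coe_mk, AddHom.coe_mk, Module.End.mul_apply, Matrix.mul_apply,
      Finset.sum_mul, Finset.mul_sum, Stream'.head_cons, Stream'.tail_cons, mul_assoc]
    exact Finset.sum_comm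
  map_zero' := by
    ext F x
    simp
  map_add' S T := by
    ext F x
    simp [add_mul, Finset.sum_add_distrib]
  commutes' c := by
    ext F x
    simp [Algebra.algebraMap_eq_smul_one, Matrix.smul_apply, Matrix.one_apply]

theorem headMatrix_apply (W : Matrix (ZMod 5) (ZMod 5) (ZMod 11)) (F : SpinSpace)
    (x : Stream' (ZMod 5)) : headMatrix W F x = ∑ y, W x.head y * F (.cons y x.tail) := rfl

/-- Multiplication with a function of the first spin. -/
def headMul (f : ZMod 5 → ZMod 11) : Module.End (ZMod 11) SpinSpace where
  toFun F x := f x.head * F x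
  map_add' F G := by
    ext x
    simp [mul_add]
  map_smul' c F := by
    ext x
    simp [mul_left_comm]

@[simp] theorem headMul_apply (f : ZMod 5 → ZMod 11) (F : SpinSpace) (x : Stream' (ZMod 5)) :
    headMul f F x = f x.head * F x := rfl

/-- A new first spin with a given value. -/
def spinInsert (a : ZMod 5) : Module.End (ZMod 11) SpinSpace where
  toFun F x := F (.cons a x)
  map_add' _ _ := rfl
  map_smul' _ _ := rfl

@[simp] theorem spinInsert_apply (a : ZMod 5) (F : SpinSpace) (x : Stream' (ZMod 5)) :
    spinInsert a F x = F (.cons a x) := rfl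

/-- The first spin is forgotten. -/
def spinTail : Module.End (ZMod 11) SpinSpace where
  toFun F x := F x.tail
  map_add' _ _ := rfl
  map_smul' _ _ := rfl

@[simp] theorem spinTail_apply (F : SpinSpace) (x : Stream' (ZMod 5)) :
    spinTail F x = F x.tail := rfl

/-- The sum over a new first spin. -/
def spinSum : Module.End (ZMod 11) SpinSpace := (3 : ZMod 11) • ∑ y, spinInsert y

theorem spinSum_apply (F : SpinSpace) (x : Stream' (ZMod 5)) :
    spinSum F x = 3 * ∑ y, F (.cons y x) := by
  simp [spinSum, Finset.sum_apply]

/-- The first spin is forced to have a given value. -/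
def spinEq (a : ZMod 5) : Module.End (ZMod 11) SpinSpace :=
  headMul (fun y => if y = a then 4 else 0) * spinTail

@[simp] theorem spinEq_apply (a : ZMod 5) (F : SpinSpace) (x : Stream' (ZMod 5)) :
    spinEq a F x = if x.head = a then 4 * F x.tail else 0 :=
  (ite_mul _ _ _ _).trans (if_congr Iff.rfl rfl (zero_mul _))

/-- The operators on a diagram whose leftmost region is shaded (and has a given spin), or not. -/
abbrev SpinAlgebra : Type :=
  (ZMod 5 → Module.End (ZMod 11) SpinSpace) × Module.End (ZMod 11) SpinSpace

theorem spinInsert_mul (a : ZMod 5) (S : ZMod 5 → Module.End (ZMod 11) SpinSpace) :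
    spinInsert a * headLift S = S a * spinInsert a := rfl

theorem spinTail_mul (T : Module.End (ZMod 11) SpinSpace) :
    spinTail * T = tailLift T * spinTail := rfl

theorem spinSum_mul (T : Module.End (ZMod 11) SpinSpace) :
    spinSum * tailLift T = T * spinSum := by
  simp only [spinSum, smul_mul_assoc, mul_smul_comm, Finset.sum_mul, Finset.mul_sum]
  rfl

theorem headMul_mul (f : ZMod 5 → ZMod 11) (S : ZMod 5 → Module.End (ZMod 11) SpinSpace) :
    headMul f * headLift S = headLift S * headMul f := by
  ext F x
  have h : S x.head (fun y => headMul f F (.cons x.head y)) =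
      f x.head • S x.head (fun y => F (.cons x.head y)) := by
    rw [← map_smul]
    rfl
  exact (congrFun h x.tail).symm

theorem spinEq_mul (a : ZMod 5) (S : ZMod 5 → Module.End (ZMod 11) SpinSpace) :
    spinEq a * S a = headLift S * spinEq a := by
  ext F x
  have h : S x.head (fun y => spinEq a F (.cons x.head y)) =
      (if x.head = a then 4 else 0 : ZMod 11) • S x.head F := by
    rw [← map_smul]
    congr 1
  show spinEq a (S a F) x = S x.head (fun y => spinEq a F (.cons x.head y)) x.tail
  rw [h, spinEq_apply]
  by_cases hx : x.head = a
  · simp [hx]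
  · simp [hx]

theorem headMatrix_mul (W : Matrix (ZMod 5) (ZMod 5) (ZMod 11))
    (T : Module.End (ZMod 11) SpinSpace) :
    headMatrix W * tailLift T = tailLift T * headMatrix W := by
  ext F x
  have h : T (fun y => headMatrix W F (.cons x.head y)) =
      ∑ y, W x.head y • T (fun z => F (.cons y z)) := by
    simp only [← map_smul, ← map_sum]
    congr 1
  rw [Module.End.mul_apply, Module.End.mul_apply, tailLift_apply, h, headMatrix_apply,
    Finset.sum_apply]
  rfl

theorem spinWeight_neg (b : Bool) (u : ZMod 5) : spinWeight b (-u) = spinWeight b u := by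
  simp [spinWeight]

theorem spinWeight_sub_comm (b : Bool) (x y : ZMod 5) :
    spinWeight b (x - y) = spinWeight b (y - x) := by
  rw [← spinWeight_neg, neg_sub]

theorem spinSum_spinEq (a : ZMod 5) : spinSum * spinEq a = 1 := by
  ext F x
  rw [Module.End.mul_apply, spinSum_apply]
  show 3 * ∑ y, spinEq a F (.cons y x) = F x
  rw [Finset.sum_eq_single a (fun y _ h => by simp [h]) (by simp)]
  have h : (3 : ZMod 11) * 4 = 1 := rfl
  simp [← mul_assoc, h]

theorem spinSum_headLift_spinEq : spinSum * headLift (fun a => spinEq a) = 1 := by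
  ext F x
  simp only [Module.End.mul_apply, spinSum_apply, headLift_apply, spinEq_apply,
    Stream'.head_cons, Stream'.tail_cons, Finset.sum_ite_eq,
    Finset.mem_univ, if_true, ← mul_assoc, show (3 : ZMod 11) * 4 = 1 from rfl, one_mul,
    Stream'.eta, Module.End.one_apply]

/-- The spin model. -/
def spinModel : Tower (ZMod 11) SpinAlgebra where
  -- A strand on the left exchanges the shading. Past it, a shaded leftmost region gives an unshaded
  -- one, and an unshaded leftmost region gives a shaded one whose spin is the first of the states.
  L := ((Pi.constAlgHom (ZMod 11) (ZMod 5) _).comp (AlgHom.snd _ _ _)).prod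
    (headLift.comp (AlgHom.fst _ _ _))
  piece
    -- On the shaded side the new region to the right is the old one, so its spin is copied; on the
    -- unshaded side a new shaded region appears and is summed over. The factors `4 = √5` and `3 =
    -- 1/√5` make every circle `4`.
    | .cup => (fun a => spinInsert a, spinSum)
    | .cap => (fun a => spinEq a, spinTail)
    | .cross b => (fun a => headMul fun y => spinWeight b (a - y), headMatrix (spinMatrix b))
  cup_mul x := Prod.ext (funext fun a => spinInsert_mul a _) (spinSum_mul _)
  cap_mul x := Prod.ext (funext fun a => spinEq_mul a _) (spinTail_mul _)
  cross_mul b x := Prod.ext (funext fun a => headMul_mul _ _) (headMatrix_mul _ _)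
  zigzag_left := Prod.ext rfl spinSum_headLift_spinEq
  zigzag_right := Prod.ext (funext fun a => spinSum_spinEq a) <| by
    ext F x
    show F (.cons x.head (Stream'.cons x.head x.tail).tail) = F x
    simp

/-! ### The relations of the crossings in the spin model. -/

section Crossing

variable (b : Bool)

/-- A crossing of the boundary strands of a shaded region on the left. -/
abbrev spinCross (a : ZMod 5) : Module.End (ZMod 11) SpinSpace :=
  headMul fun y => spinWeight b (a - y)

theorem spinSum_headMul (a : ZMod 5) :
    spinSum * spinCross b a = spinInsert a * headMatrix (spinMatrix !b) := by
  ext F x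
  simp [spinSum_apply, headMatrix_apply, spinMatrix, Finset.mul_sum, mul_assoc]

theorem headLift_spinInsert_headMatrix : headLift spinInsert * headMatrix (spinMatrix b) =
    spinSum * headLift (spinCross !b) := by
  ext F x
  simp [spinSum_apply, headMatrix_apply, spinMatrix, Finset.mul_sum, mul_assoc,
    spinWeight_sub_comm _ x.head]

theorem headMul_spinTail (a : ZMod 5) :
    spinCross b a * spinTail = headMatrix (spinMatrix !b) * spinEq a := by
  ext F x
  have h : (3 : ZMod 11) * 4 = 1 := rfl
  rw [Module.End.mul_apply, Module.End.mul_apply, headMatrix_apply,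
    Finset.sum_eq_single a (fun y _ h => by simp [h]) (by simp)]
  simp only [spinMatrix, Matrix.of_apply, Bool.not_not, headMul_apply, spinTail_apply,
    spinEq_apply, Stream'.head_cons, Stream'.tail_cons, if_true, spinWeight_sub_comm _ x.head]
  linear_combination -spinWeight b (a - x.head) * F x.tail * h

theorem headMatrix_spinEq : headMatrix (spinMatrix b) * headLift (fun a => spinEq a) =
    headLift (spinCross !b) * spinTail := by
  ext F x
  have : ∀ w z : ZMod 11, 3 * w * (4 * z) = (3 * 4) * (w * z) := fun w z => by ring
  simp only [Module.End.mul_apply, headMatrix_apply, spinMatrix, Matrix.of_apply, headLift_apply,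
    spinEq_apply, Stream'.head_cons, Stream'.tail_cons, headMul_apply, spinTail_apply,
    mul_ite, mul_zero, Finset.sum_ite_eq, Finset.mem_univ, if_true, this, Stream'.eta,
    show (3 : ZMod 11) * 4 = 1 from rfl, one_mul]

theorem spinWeight_zero : spinWeight b 0 = 1 := rfl

theorem spinInsert_headMul (a : ZMod 5) : spinInsert a * spinCross b a = spinInsert a := by
  ext F x
  simp [spinWeight_zero]

theorem headMul_spinEq (a : ZMod 5) : spinCross b a * spinEq a = spinEq a := by
  ext F x
  by_cases h : x.head = a
  · simp [h, spinWeight_zero]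
  · simp [h]

theorem sum_spinMatrix : ∀ b x, ∑ y, spinMatrix b x y = 1 := by decide

theorem sum_spinMatrix' : ∀ b y, ∑ x, spinMatrix b x y = 1 := by decide

theorem spinSum_headMatrix : spinSum * headMatrix (spinMatrix b) = spinSum := by
  ext F x
  simp only [Module.End.mul_apply, spinSum_apply, headMatrix_apply, Stream'.head_cons,
    Stream'.tail_cons]
  rw [Finset.sum_comm]
  simp only [← Finset.sum_mul, sum_spinMatrix', one_mul]

theorem headMatrix_spinTail : headMatrix (spinMatrix b) * spinTail = spinTail := by
  ext F x
  simp only [Module.End.mul_apply, headMatrix_apply, spinTail_apply, Stream'.tail_cons,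
    ← Finset.sum_mul, sum_spinMatrix, one_mul]

theorem spinWeight_mul : ∀ b u, spinWeight b u * spinWeight (!b) u = 1 := by decide

theorem spinWeight_pow : ∀ b u, spinWeight b u ^ 5 = 1 := by decide

theorem spinMatrix_mul : ∀ b, spinMatrix b * spinMatrix (!b) = 1 := by decide

theorem spinMatrix_pow : ∀ b, spinMatrix b ^ 5 = 1 := by decide

/-- Reidemeister III in the form of the star-triangle relation. For weights quadratic in the spins
it is an evaluation of Gauss sums, here a finite check. -/
theorem star_triangle : ∀ b a x z,
    spinWeight b (a - x) * (spinMatrix b x z * spinWeight b (a - z)) =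
      ∑ y, spinMatrix b x y * (spinWeight b (a - y) * spinMatrix b y z) := by decide

theorem headMul_eq_headMatrix (f : ZMod 5 → ZMod 11) :
    headMul f = headMatrix (Matrix.diagonal f) := by
  ext F x
  simp [headMatrix_apply, Matrix.diagonal_apply]

theorem star_triangle_matrix (a : ZMod 5) :
    Matrix.diagonal (fun y => spinWeight b (a - y)) * spinMatrix b *
      Matrix.diagonal (fun y => spinWeight b (a - y)) =
    spinMatrix b * Matrix.diagonal (fun y => spinWeight b (a - y)) * spinMatrix b := by
  have h := star_triangle b a
  generalize spinMatrix b = W at *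
  generalize spinWeight b = w at *
  ext x z
  rw [Matrix.mul_diagonal, Matrix.diagonal_mul, Matrix.mul_assoc, Matrix.mul_apply]
  simp only [Matrix.diagonal_mul]
  rw [mul_assoc, h]

theorem headMul_headMatrix_headMul (a : ZMod 5) :
    spinCross b a * headMatrix (spinMatrix b) * spinCross b a =
      headMatrix (spinMatrix b) * spinCross b a * headMatrix (spinMatrix b) := by
  have h := star_triangle_matrix b a
  generalize spinMatrix b = W at *
  rw [spinCross, headMul_eq_headMatrix, ← map_mul, ← map_mul, ← map_mul, ← map_mul, h]

theorem headMatrix_headLift_headMatrix :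
    headMatrix (spinMatrix b) * headLift (spinCross b) * headMatrix (spinMatrix b) =
      headLift (spinCross b) * headMatrix (spinMatrix b) * headLift (spinCross b) := by
  ext F x
  have h := congrFun (LinearMap.congr_fun (headMul_headMatrix_headMul b x.tail.head) F) x
  simp only [Module.End.mul_apply, headMatrix_apply, headLift_apply, headMul_apply,
    Stream'.head_cons, Stream'.tail_cons] at h ⊢
  simp only [spinWeight_sub_comm _ _ x.tail.head]
  exact h.symm

theorem headMul_one : headMul (fun _ => 1) = 1 := by
  ext F x
  simp

theorem headMul_mul_headMul (f g : ZMod 5 → ZMod 11) :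
    headMul f * headMul g = headMul fun y => f y * g y := by
  ext F x
  simp [mul_assoc]

theorem headMul_pow (f : ZMod 5 → ZMod 11) (n : ℕ) :
    headMul f ^ n = headMul fun y => f y ^ n := by
  induction n with
  | zero => simp [headMul_one]
  | succ n ih => simp only [pow_succ, ih, headMul_mul_headMul]

end Crossing

/-- The group of factors is trivial: the weight of a kink is `1`, and fifth powers of the weights
are `1`. The value itself is therefore an invariant, not only its class up to units. -/
theorem spinModel_isInvariant : spinModel.IsInvariant ⊥ where
  slide_cup b := Prod.ext (funext fun a => spinSum_headMul b a) (headLift_spinInsert_headMatrix b)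
  slide_cap b := Prod.ext (funext fun a => headMul_spinTail b a) (headMatrix_spinEq b)
  one_cup b := ⟨1, one_mem _, by
    rw [one_smul]
    exact Prod.ext (funext fun a => spinInsert_headMul b a) (spinSum_headMatrix b)⟩
  one_cap b := ⟨1, one_mem _, by
    rw [one_smul]
    exact Prod.ext (funext fun a => headMul_spinEq b a) (headMatrix_spinTail b)⟩
  two b := Prod.ext (funext fun a => by
      show headMul _ * headMul _ = 1
      simp only [headMul_mul_headMul, spinWeight_mul, headMul_one])
    (by
      show headMatrix _ * headMatrix _ = 1
      rw [← map_mul, spinMatrix_mul, map_one])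
  three b := Prod.ext (funext fun a => headMul_headMatrix_headMul b a)
    (headMatrix_headLift_headMatrix b)
  five b := ⟨1, one_mem _, by
    rw [one_smul]
    exact Prod.ext (funext fun a => by
      rw [Prod.pow_fst, Pi.pow_apply,
        show (spinModel.piece (.cross b)).1 a = headMul fun y => spinWeight b (a - y) from rfl]
      simp only [headMul_pow, spinWeight_pow, headMul_one]
      rfl)
      (by
        rw [Prod.pow_snd, show (spinModel.piece (.cross b)).2 = headMatrix (spinMatrix b) from rfl,
          ← map_pow, spinMatrix_pow, map_one]
        rfl)⟩
  injective := fun _ _ h => algebraMap_end_injective _ _ (congrArg Prod.snd h)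

/-! ### Evaluation of the spin model -/

/-- A 2-tangle that acts as the multiplication with a function of the difference of the spins to its
left and to its right. -/
def HasKernel (T : Tangle 2 2) (f : ZMod 5 → ZMod 11) : Prop :=
  ∀ a, (spinModel.eval T.word).1 a = headMul fun y => f (a - y)

/-- The kernel of the product of two 2-tangles. -/
def convolve (f g : ZMod 5 → ZMod 11) (u : ZMod 5) : ZMod 11 := 3 * ∑ v, f v * g (u - v)

theorem hasKernel_crossing (b : Bool) : HasKernel (crossing b) (spinWeight b) := by
  intro a
  simp [spinModel]

theorem hasKernel_zeroTangle : HasKernel zeroTangle fun u => if u = 0 then 4 else 0 := by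
  intro a
  have : (spinModel.eval zeroTangle.word).1 a = spinEq a * spinInsert a := by
    simp [spinModel]
  rw [this]
  ext F x
  by_cases h : x.head = a
  · subst h
    simp
  · have h' : a - x.head ≠ 0 := sub_ne_zero.2 (Ne.symm h)
    simp [h, h']

theorem HasKernel.comp {S T : Tangle 2 2} {f g : ZMod 5 → ZMod 11} (hS : HasKernel S f)
    (hT : HasKernel T g) : HasKernel (S.comp T) fun u => f u * g u := by
  intro a
  rw [Tower.eval_comp, Prod.fst_mul, Pi.mul_apply, hS, hT, headMul_mul_headMul]

theorem HasKernel.prod {S T : Tangle 2 2} {f g : ZMod 5 → ZMod 11} (hS : HasKernel S f)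
    (hT : HasKernel T g) : HasKernel (prod S T) (convolve f g) := by
  intro a
  have : (spinModel.eval (FiveMove.prod S T).word).1 a = spinSum * ((spinModel.eval S.word).1 a *
      (headLift (spinModel.eval T.word).1 * spinTail)) := by
    simp
    rfl
  rw [this, hS, show (spinModel.eval T.word).1 = _ from funext hT]
  ext F x
  simp only [Module.End.mul_apply, spinSum_apply, headMul_apply, headLift_apply, spinTail_apply,
    Stream'.head_cons, Stream'.tail_cons, ← mul_assoc, ← Finset.sum_mul, convolve]
  congr 2
  refine Fintype.sum_equiv (Equiv.subLeft a) _ _ fun y => ?_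
  simp

theorem HasKernel.numerator {T : Tangle 2 2} {f : ZMod 5 → ZMod 11} (h : HasKernel T f) :
    (spinModel.eval (numerator T).word).1 0 = (4 * f 0) • 1 := by
  have : (spinModel.eval (FiveMove.numerator T).word).1 0 =
      spinInsert 0 * ((spinModel.eval T.word).1 0 * spinEq 0) := by
    simp [spinModel]
  rw [this, h]
  ext F x
  simp
  ring

theorem HasKernel.denominator {T : Tangle 2 2} {f : ZMod 5 → ZMod 11} (h : HasKernel T f) :
    (spinModel.eval (denominator T).word).1 0 = (∑ u, f u) • 1 := by
  have : (spinModel.eval (FiveMove.denominator T).word).1 0 =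
      spinInsert 0 * (spinSum * ((spinModel.eval T.word).1 0 * (spinTail * spinEq 0))) := by
    simp
    rfl
  rw [this, h]
  ext F x
  simp only [Module.End.mul_apply, spinSum_apply, headMul_apply, spinTail_apply, spinEq_apply,
    spinInsert_apply, Stream'.head_cons, Stream'.tail_cons, if_true, ← Finset.sum_mul,
    LinearMap.smul_apply, Pi.smul_apply, smul_eq_mul, Module.End.one_apply]
  rw [Fintype.sum_equiv (Equiv.subLeft 0) (fun y : ZMod 5 => f (0 - y)) f fun y => rfl]
  have h : (3 : ZMod 11) * 4 = 1 := rfl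
  linear_combination (∑ u, f u) * F x * h

/-- Commutation with the rank one operators `G ↦ G(x₀) F`, applied to a constant function,
determines `S` as a scalar. -/
theorem exists_eq_smul_one {K α : Type*} [CommRing K] [Nonempty α]
    {S : Module.End K (StateSpace K α)} (h : ∀ X, S * X = X * S) : ∃ c : K, S = c • 1 := by
  refine ⟨S (fun _ => 1) (.const (Classical.arbitrary α)), ?_⟩
  ext F x
  let X : Module.End K (StateSpace K α) :=
    { toFun := fun G => G (.const (Classical.arbitrary α)) • F
      map_add' := fun G G' => by simp [add_smul]
      map_smul' := fun c G => by simp [mul_smul] }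
  have := congrFun (LinearMap.congr_fun (h X) fun _ => 1) x
  simpa [X] using this

/-- A strand with a tangle on it commutes with everything to its right. For a fixed spin on its left
these are all operators. -/
theorem spinModel_strand (T : Tangle 1 1) : ∃ c : ZMod 11,
    (spinModel.eval T.word).1 0 = c • (1 : Module.End (ZMod 11) SpinSpace) :=
  exists_eq_smul_one fun X => by
    have := spinModel.eval_mul T.valid (0, X)
    exact congrFun (congrArg Prod.fst this) 0

theorem spinModel_closure {T : Tangle 1 1} {c : ZMod 11}
    (h : (spinModel.eval T.word).1 0 = c • (1 : Module.End (ZMod 11) SpinSpace)) :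
    (spinModel.eval (closure T).word).1 0 = (4 * c) • 1 := by
  have : (spinModel.eval (closure T).word).1 0 =
      spinInsert 0 * ((spinModel.eval T.word).1 0 * spinEq 0) := by
    simp [spinModel]
  rw [this, h]
  ext F x
  simp
  ring

theorem spinModel_equiv {L L' : LinkDiagram} {p : Prop} (h : TangleEquiv p L L') :
    spinModel.eval L.word = spinModel.eval L'.word := by
  obtain ⟨g, hg, h⟩ := spinModel_isInvariant.eval_equiv h
  rw [Subgroup.mem_bot] at hg
  rw [h, hg, one_smul]

theorem spinModel_basicCount {L : LinkDiagram} {a b f : ℕ} (h : BasicCount L a b f) (hf : f = 0) :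
    (spinModel.eval L.word).1 0 = ((4 : ZMod 11) ^ (a + 1) * (-1) ^ b) • 1 := by
  induction h with
  | trivialKnot =>
    ext F x
    simp [trivialKnot, spinModel]
  | trivialLink₂ =>
    ext F x
    simp [trivialLink₂, spinModel]
    ring
  | hopfLink =>
    have h : hopfLink = denominator halfTangle := rfl
    have hh : HasKernel halfTangle _ := (hasKernel_crossing true).comp (hasKernel_crossing true)
    rw [h, hh.denominator]
    rfl
  | figureEight => omega
  | @connectedSum L₁ L₂ L a b f a' b' f' _ _ h ih ih' =>
    obtain ⟨S, T, h1, h2, h3⟩ := h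
    obtain ⟨c, hc⟩ := spinModel_strand S
    obtain ⟨c', hc'⟩ := spinModel_strand T
    have hcc : (spinModel.eval (S.comp T).word).1 0 = (c * c') • 1 := by
      rw [Tower.eval_comp, Prod.fst_mul, Pi.mul_apply, hc, hc', smul_mul_smul_comm, mul_one]
    have e1 := ih (by omega)
    have e2 := ih' (by omega)
    rw [spinModel_equiv (isotopic_iff.1 h1), spinModel_closure hc] at e1
    rw [spinModel_equiv (isotopic_iff.1 h2), spinModel_closure hc'] at e2
    rw [spinModel_equiv (isotopic_iff.1 h3), spinModel_closure hcc]
    congr 1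
    have k1 : 4 * c = 4 ^ (a + 1) * (-1) ^ b := by
      simpa using congrFun (LinearMap.congr_fun e1 fun _ => 1) (.const 0)
    have k2 : 4 * c' = 4 ^ (a' + 1) * (-1) ^ b' := by
      simpa using congrFun (LinearMap.congr_fun e2 fun _ => 1) (.const 0)
    have h12 : (3 : ZMod 11) * 4 = 1 := rfl
    have : 4 * (c * c') = 3 * ((4 * c) * (4 * c')) := by linear_combination -4 * c * c' * h12
    rw [this, k1, k2]
    linear_combination 4 ^ (a + a' + 1) * (-1) ^ (b + b') * h12

theorem hasKernel_horizontalTwist (s : ℤ) : HasKernel (horizontalTwist s)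
    ((convolve (spinWeight (decide (0 ≤ s))))^[s.natAbs] fun u => if u = 0 then 4 else 0) := by
  rw [horizontalTwist]
  induction s.natAbs with
  | zero => exact hasKernel_zeroTangle
  | succ n ih =>
    rw [Function.iterate_succ_apply']
    exact (hasKernel_crossing _).prod ih

/-- The spin model distinguishes the links `M[1/2, 1/2, 1/2, s]` from the trivial link `T₂`. -/
theorem spinModel_halfPretzel_three {s : ℤ} (hs : -2 ≤ s) (hs' : s ≤ 2) :
    (spinModel.eval (halfPretzel 3 s).word).1 0 ≠ (5 : ZMod 11) • 1 := by
  rw [spinModel_equiv (halfPretzel_equiv (p := True) 3 s)]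
  have hh : HasKernel halfTangle _ := (hasKernel_crossing true).comp (hasKernel_crossing true)
  have ht := hasKernel_horizontalTwist s
  intro h
  have key := (hh.prod (hh.prod (hh.prod (ht.prod hasKernel_zeroTangle)))).numerator.symm.trans h
  have key := congrFun (LinearMap.congr_fun key fun _ => 1) (.const 0)
  simp only [LinearMap.smul_apply, Pi.smul_apply, smul_eq_mul, Module.End.one_apply, mul_one] at key
  revert key
  -- The five values of `4 * f 0` are computed by convolution and compared with `5 = 4 ^ 2`, the
  -- value of `T₂`.
  interval_cases s <;> decide

end FiveMove

namespace FiveMove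

/-! ## The norms of the Kauffman bracket -/

section Value

variable {K : Type*} [CommRing K]

/-- The Kauffman bracket of a link diagram, computed by the vertex model. -/
def bracketValue (A : Kˣ) (L : LinkDiagram) : K :=
  (vertexModel A).eval L.word (fun _ => 1) (.const false)

theorem bracketValue_eq {A : Kˣ} {L : LinkDiagram} {x : K}
    (h : ∃ g ∈ Subgroup.zpowers A, (vertexModel A).eval L.word = g • (x • 1)) :
    ∃ r : ℤ, bracketValue A L = ((A ^ r : Kˣ) : K) * x := by
  obtain ⟨_, ⟨r, rfl⟩, h⟩ := h
  exact ⟨r, by simp [bracketValue, h, Units.smul_def]⟩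

theorem bracketValue_equiv {A : Kˣ} (hA : IsFiveRoot A) {L L' : LinkDiagram}
    (h : FiveMoveEquiv L L') :
    ∃ r : ℤ, bracketValue A L = ((A ^ r : Kˣ) : K) * bracketValue A L' := by
  obtain ⟨_, ⟨r, rfl⟩, h⟩ :=
    ((vertexModel_isBracket A).isInvariant hA).eval_equiv (fiveMoveEquiv_iff.1 h)
  exact ⟨r, by simp [bracketValue, h, Units.smul_def]⟩

end Value

open Real Complex

/-- Both roots of the equation lie in `[-2, 2]`, so `c = 2 cos θ` and `A = exp (iθ/4)`. Since `A`
has modulus one, the norm of the bracket is insensitive to powers of `A`. -/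
theorem exists_variable {c : ℝ} (hc : c ^ 2 = c + 1) :
    ∃ A : ℂˣ, ‖(A : ℂ)‖ = 1 ∧ golden A = c := by
  have h1 : -1 ≤ c / 2 := by nlinarith
  have h2 : c / 2 ≤ 1 := by nlinarith
  refine ⟨Units.mk0 (exp ((arccos (c / 2) / 4 : ℝ) * I)) (exp_ne_zero _), ?_, ?_⟩
  · simp only [Units.val_mk0, norm_exp_ofReal_mul_I]
  · have h := Complex.two_cos (arccos (c / 2) : ℂ)
    rw [← ofReal_cos, cos_arccos h1 h2] at h
    simp only [golden, Units.val_mk0, Units.val_inv_eq_inv_val, ← Complex.exp_neg,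
      ← Complex.exp_nat_mul]
    rw [show ((c : ℝ) : ℂ) = 2 * ((c / 2 : ℝ) : ℂ) by push_cast; ring, h]
    congr 2 <;> (push_cast; ring)

theorem norm_one_sub_sq {z : ℂ} (hz : ‖z‖ = 1) {c : ℝ} (h : z + z⁻¹ = c) :
    ‖1 - z‖ ^ 2 = 2 - c := by
  rw [Complex.inv_eq_conj hz, Complex.add_conj] at h
  have h' : 2 * z.re = c := by exact_mod_cast h
  rw [← h', Complex.sq_norm, Complex.normSq_sub]
  rw [← Complex.sq_norm, ← Complex.sq_norm, hz]
  simp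
  ring

section Norms

variable {A : ℂˣ} {c : ℝ}

theorem isFiveRoot_of_golden (hc : golden A = (c : ℂ)) (hcc : c ^ 2 = c + 1) : IsFiveRoot A := by
  apply IsFiveRoot.of_golden
  rw [hc]
  exact_mod_cast hcc

theorem norm_one_sub_inv_pow_four (hA : ‖(A : ℂ)‖ = 1) (hc : golden A = (c : ℂ)) :
    ‖1 - ((A⁻¹ : ℂˣ) : ℂ) ^ 4‖ ^ 2 = 2 - c := by
  apply norm_one_sub_sq (by simp [hA])
  rw [← hc, golden]
  simp [add_comm]

theorem norm_one_sub_pow_eight (hA : ‖(A : ℂ)‖ = 1) (hc : golden A = (c : ℂ))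
    (hcc : c ^ 2 = c + 1) : ‖1 - (A : ℂ) ^ 8‖ ^ 2 = 3 - c := by
  rw [norm_one_sub_sq (c := c - 1) (by simp [hA])]
  · ring
  · have h1 : golden A ^ 2 = c + 1 := by rw [hc]; exact_mod_cast hcc
    have h2 := A.ne_zero
    rw [golden] at h1
    rw [Units.val_inv_eq_inv_val] at h1
    have h3 : (A : ℂ) ^ 4 * ((A : ℂ)⁻¹) ^ 4 = 1 := by rw [← mul_pow, mul_inv_cancel₀ h2, one_pow]
    rw [← inv_pow]
    push_cast
    linear_combination h1 - 2 * h3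

theorem norm_loopValue (hc : golden A = (c : ℂ)) (hcc : c ^ 2 = c + 1) :
    ‖loopValue A‖ ^ 2 = 2 + c := by
  rw [← norm_pow, loopValue_sq, hc]
  have : 0 ≤ c + 2 := by nlinarith
  rw [show (c : ℂ) + 2 = ((c + 2 : ℝ) : ℂ) by push_cast; ring, Complex.norm_real,
    Real.norm_of_nonneg this, add_comm]

theorem norm_bracketValue_equiv (hA : ‖(A : ℂ)‖ = 1) (hc : golden A = (c : ℂ))
    (hcc : c ^ 2 = c + 1) {L L' : LinkDiagram} (h : FiveMoveEquiv L L') :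
    ‖bracketValue A L‖ = ‖bracketValue A L'‖ := by
  obtain ⟨r, h⟩ := bracketValue_equiv (isFiveRoot_of_golden hc hcc) h
  rw [h, norm_mul, Units.val_zpow_eq_zpow_val, norm_zpow, hA, one_zpow, one_mul]

theorem norm_bracketValue_halfPretzel (hA : ‖(A : ℂ)‖ = 1) (hc : golden A = (c : ℂ))
    (hcc : c ^ 2 = c + 1) (m : ℕ) (s : ℤ) : ∃ x y : ℂ,
    ‖bracketValue A (halfPretzel m s)‖ = ‖x + y‖ ∧
      ‖x‖ = c ^ 2 * ‖1 - ((A⁻¹ : ℂˣ) : ℂ) ^ 4‖ ^ m ∧ ‖y‖ = |c| ^ m := by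
  obtain ⟨r, h⟩ := bracketValue_eq
    ((vertexModel_isBracket A).eval_halfPretzel (isFiveRoot_of_golden hc hcc) m s)
  refine ⟨_, _, by rw [h, norm_mul, Units.val_zpow_eq_zpow_val, norm_zpow, hA, one_zpow,
    one_mul], ?_, ?_⟩
  · rw [hc, norm_mul, norm_mul, Units.val_zpow_eq_zpow_val, norm_zpow, hA, one_zpow, norm_pow,
      norm_pow, Complex.norm_real, Real.norm_eq_abs, sq_abs, mul_one]
  · rw [hc, norm_mul, Units.val_zpow_eq_zpow_val, norm_zpow, Units.val_neg, norm_neg,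
      Units.val_pow_eq_pow_val, norm_pow, norm_pow, hA, one_pow, one_zpow, norm_neg,
      Complex.norm_real, Real.norm_eq_abs, mul_one]

theorem norm_bracketValue_columnList (hA : ‖(A : ℂ)‖ = 1) (hc : golden A = (c : ℂ))
    (hcc : c ^ 2 = c + 1) {k m : ℕ} (hk : 1 ≤ k) {y : List (OnePoint ℚ)}
    (hy : IsColumnList k m y) : ‖bracketValue A (montesinos y)‖ =
      c ^ 2 * ‖1 - (A : ℂ) ^ 8‖ ^ k * ‖1 - ((A⁻¹ : ℂˣ) : ℂ) ^ 4‖ ^ m := by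
  obtain ⟨r, h⟩ := bracketValue_eq
    ((vertexModel_isBracket A).eval_columnList (isFiveRoot_of_golden hc hcc) hk hy)
  rw [h, norm_mul, Units.val_zpow_eq_zpow_val, norm_zpow, hA, one_zpow, one_mul, hc, norm_mul,
    norm_mul, norm_pow, norm_pow, norm_pow, Complex.norm_real, Real.norm_eq_abs, sq_abs]

theorem norm_bracketValue_basicCount (hA : ‖(A : ℂ)‖ = 1) (hc : golden A = (c : ℂ))
    (hcc : c ^ 2 = c + 1) {L : LinkDiagram} {a b f : ℕ} (h : BasicCount L a b f) :
    ‖bracketValue A L‖ = ‖loopValue A‖ ^ (a + 1) * |c| ^ b * 0 ^ f := by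
  have hd : loopValue A ≠ 0 := by
    intro h0
    have := norm_loopValue hc hcc
    rw [h0] at this
    simp at this
    nlinarith
  obtain ⟨r, h⟩ := bracketValue_eq
    ((vertexModel_isBracket A).eval_basicCount (isFiveRoot_of_golden hc hcc) hd h)
  rw [h, norm_mul, Units.val_zpow_eq_zpow_val, norm_zpow, hA, one_zpow, one_mul, hc, norm_mul,
    norm_mul, norm_pow, norm_pow, norm_pow, norm_neg, Complex.norm_real, Real.norm_eq_abs,
    norm_zero]

end Norms

end FiveMove

namespace FiveMove

/-! ## The two families and the connected sums are inequivalent -/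

open Real

theorem exists_golden_variable : ∃ A : ℂˣ, ‖(A : ℂ)‖ = 1 ∧ golden A = ((goldenRatio : ℝ) : ℂ) :=
  exists_variable goldenRatio_sq

theorem exists_conj_variable : ∃ A : ℂˣ, ‖(A : ℂ)‖ = 1 ∧ golden A = ((goldenConj : ℝ) : ℂ) :=
  exists_variable goldenConj_sq

/-- The norm of the bracket for a variable `A` with `A ^ 4 + A ^ (-4) = φ`. -/
noncomputable def goldenNorm (L : LinkDiagram) : ℝ :=
  ‖bracketValue exists_golden_variable.choose L‖

/-- The norm of the bracket for a variable `A` with `A ^ 4 + A ^ (-4) = ψ`, times `φ ^ 2`. -/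
noncomputable def conjNorm (L : LinkDiagram) : ℝ :=
  goldenRatio ^ 2 * ‖bracketValue exists_conj_variable.choose L‖

theorem goldenNorm_equiv {L L' : LinkDiagram} (h : FiveMoveEquiv L L') :
    goldenNorm L = goldenNorm L' :=
  norm_bracketValue_equiv exists_golden_variable.choose_spec.1 exists_golden_variable.choose_spec.2
    goldenRatio_sq h

theorem conjNorm_equiv {L L' : LinkDiagram} (h : FiveMoveEquiv L L') :
    conjNorm L = conjNorm L' := by
  rw [conjNorm, conjNorm, norm_bracketValue_equiv exists_conj_variable.choose_spec.1
    exists_conj_variable.choose_spec.2 goldenConj_sq h]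

theorem abs_goldenConj : |goldenConj| = goldenRatio⁻¹ := by
  rw [abs_of_neg goldenConj_neg, inv_goldenRatio]

/-- The square root of `3 - φ`. -/
noncomputable def goldenRoot : ℝ := √(3 - goldenRatio)

theorem goldenRoot_sq : goldenRoot ^ 2 = 3 - goldenRatio :=
  Real.sq_sqrt (by linarith [goldenRatio_lt_two])

theorem goldenRoot_pos : 0 < goldenRoot := Real.sqrt_pos.2 (by linarith [goldenRatio_lt_two])

theorem goldenRoot_sq_mul : goldenRoot ^ 2 * goldenRatio = 2 * goldenRatio - 1 := by
  rw [goldenRoot_sq]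
  linear_combination -goldenRatio_sq

theorem goldenConj_eq : goldenConj = 1 - goldenRatio := by
  linarith [goldenRatio_add_goldenConj]

theorem norm_eq_of_sq {x y : ℝ} (hx : 0 ≤ x) (hy : 0 ≤ y) (h : x ^ 2 = y ^ 2) : x = y :=
  (sq_eq_sq₀ hx hy).1 h

theorem golden_one_sub_inv {A : ℂˣ} (hA : ‖(A : ℂ)‖ = 1)
    (hc : golden A = ((goldenRatio : ℝ) : ℂ)) : ‖1 - ((A⁻¹ : ℂˣ) : ℂ) ^ 4‖ = goldenRatio⁻¹ := by
  apply norm_eq_of_sq (norm_nonneg _) (inv_nonneg.2 goldenRatio_pos.le)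
  rw [norm_one_sub_inv_pow_four hA hc, inv_goldenRatio, neg_sq, goldenConj_sq, goldenConj_eq]
  ring

theorem conj_one_sub_inv {A : ℂˣ} (hA : ‖(A : ℂ)‖ = 1)
    (hc : golden A = ((goldenConj : ℝ) : ℂ)) : ‖1 - ((A⁻¹ : ℂˣ) : ℂ) ^ 4‖ = goldenRatio := by
  apply norm_eq_of_sq (norm_nonneg _) goldenRatio_pos.le
  rw [norm_one_sub_inv_pow_four hA hc, goldenRatio_sq, goldenConj_eq]
  ring

/-- For `γ = φ` the second term of the bracket has modulus `φ ^ m` and dominates; the first is the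
error. -/
theorem goldenNorm_halfPretzel (m : ℕ) (s : ℤ) :
    |goldenNorm (halfPretzel m s) - goldenRatio ^ m| ≤ goldenRatio ^ 2 / goldenRatio ^ m := by
  obtain ⟨hA, hc⟩ := exists_golden_variable.choose_spec
  obtain ⟨x, y, h, hx, hy⟩ := norm_bracketValue_halfPretzel hA hc goldenRatio_sq m s
  rw [golden_one_sub_inv hA hc, inv_pow, ← div_eq_mul_inv] at hx
  rw [abs_of_pos goldenRatio_pos] at hy
  rw [goldenNorm, h, ← hx, ← hy]
  have := abs_norm_sub_norm_le (x + y) y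
  rwa [add_sub_cancel_right] at this

/-- For `γ = ψ` the first term dominates instead, and the normalisation by `φ ^ 2` compensates its
factor `ψ ^ 2`. -/
theorem conjNorm_halfPretzel (m : ℕ) (s : ℤ) :
    |conjNorm (halfPretzel m s) - goldenRatio ^ m| ≤ goldenRatio ^ 2 / goldenRatio ^ m := by
  obtain ⟨hA, hc⟩ := exists_conj_variable.choose_spec
  obtain ⟨x, y, h, hx, hy⟩ := norm_bracketValue_halfPretzel hA hc goldenConj_sq m s
  have h1 : goldenRatio ^ 2 * goldenConj ^ 2 = 1 := by
    rw [← mul_pow, goldenRatio_mul_goldenConj]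
    norm_num
  rw [conj_one_sub_inv hA hc] at hx
  rw [abs_goldenConj, inv_pow] at hy
  have hx' : goldenRatio ^ m = goldenRatio ^ 2 * ‖x‖ := by rw [hx, ← mul_assoc, h1, one_mul]
  rw [conjNorm, h, div_eq_mul_inv, ← hy, hx', ← mul_sub, abs_mul,
    abs_of_pos (by positivity : 0 < goldenRatio ^ 2)]
  have := abs_norm_sub_norm_le (x + y) x
  rw [add_sub_cancel_left] at this
  gcongr

theorem goldenNorm_columnList {k m : ℕ} (hk : 1 ≤ k) {y : List (OnePoint ℚ)}
    (hy : IsColumnList k m y) : goldenNorm (montesinos y) * goldenRatio ^ m =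
      goldenRatio ^ 2 * goldenRoot ^ k := by
  obtain ⟨hA, hc⟩ := exists_golden_variable.choose_spec
  have h : ‖1 - ((exists_golden_variable.choose : ℂˣ) : ℂ) ^ 8‖ = goldenRoot := by
    apply norm_eq_of_sq (norm_nonneg _) goldenRoot_pos.le
    rw [norm_one_sub_pow_eight hA hc goldenRatio_sq, goldenRoot_sq]
  rw [goldenNorm, norm_bracketValue_columnList hA hc goldenRatio_sq hk hy,
    golden_one_sub_inv hA hc, h, mul_assoc, ← mul_pow, inv_mul_cancel₀ goldenRatio_ne_zero,
    one_pow, mul_one]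

theorem conjNorm_columnList {k m : ℕ} (hk : 1 ≤ k) {y : List (OnePoint ℚ)}
    (hy : IsColumnList k m y) : conjNorm (montesinos y) =
      goldenRoot ^ k * goldenRatio ^ (k + m) := by
  obtain ⟨hA, hc⟩ := exists_conj_variable.choose_spec
  have h : ‖1 - ((exists_conj_variable.choose : ℂˣ) : ℂ) ^ 8‖ = goldenRoot * goldenRatio := by
    apply norm_eq_of_sq (norm_nonneg _) (mul_pos goldenRoot_pos goldenRatio_pos).le
    rw [norm_one_sub_pow_eight hA hc goldenConj_sq, mul_pow, goldenRoot_sq, goldenConj_eq]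
    linear_combination (goldenRatio - 2) * goldenRatio_sq
  have h1 : goldenRatio ^ 2 * goldenConj ^ 2 = 1 := by
    rw [← mul_pow, goldenRatio_mul_goldenConj]
    norm_num
  rw [conjNorm, norm_bracketValue_columnList hA hc goldenConj_sq hk hy,
    conj_one_sub_inv hA hc, h, mul_pow, pow_add]
  linear_combination goldenRoot ^ k * goldenRatio ^ k * goldenRatio ^ m * h1

theorem goldenNorm_basicCount {L : LinkDiagram} {a b f : ℕ} (h : BasicCount L a b f) :
    goldenNorm L = (goldenRoot * goldenRatio) ^ (a + 1) * goldenRatio ^ b * 0 ^ f := by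
  obtain ⟨hA, hc⟩ := exists_golden_variable.choose_spec
  have hd : ‖loopValue exists_golden_variable.choose‖ = goldenRoot * goldenRatio := by
    apply norm_eq_of_sq (norm_nonneg _) (mul_pos goldenRoot_pos goldenRatio_pos).le
    rw [norm_loopValue hc goldenRatio_sq, mul_pow, goldenRoot_sq]
    linear_combination (goldenRatio - 2) * goldenRatio_sq
  rw [goldenNorm, norm_bracketValue_basicCount hA hc goldenRatio_sq h, hd,
    abs_of_pos goldenRatio_pos]

theorem conjNorm_basicCount {L : LinkDiagram} {a b f : ℕ} (h : BasicCount L a b f) :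
    conjNorm L * goldenRatio ^ b = goldenRatio ^ 2 * goldenRoot ^ (a + 1) * 0 ^ f := by
  obtain ⟨hA, hc⟩ := exists_conj_variable.choose_spec
  have hd : ‖loopValue exists_conj_variable.choose‖ = goldenRoot := by
    apply norm_eq_of_sq (norm_nonneg _) goldenRoot_pos.le
    rw [norm_loopValue hc goldenConj_sq, goldenRoot_sq, goldenConj_eq]
    ring
  have h1 : goldenRatio⁻¹ ^ b * goldenRatio ^ b = 1 := by
    rw [← mul_pow, inv_mul_cancel₀ goldenRatio_ne_zero, one_pow]
  rw [conjNorm, norm_bracketValue_basicCount hA hc goldenConj_sq h, hd, abs_goldenConj]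
  linear_combination goldenRatio ^ 2 * goldenRoot ^ (a + 1) * 0 ^ f * h1

/-! ### Estimates -/

theorem goldenRatio_pow_three : goldenRatio ^ 3 = 2 * goldenRatio + 1 := by
  linear_combination (goldenRatio + 1) * goldenRatio_sq

theorem goldenRatio_pow_four : goldenRatio ^ 4 = 3 * goldenRatio + 2 := by
  linear_combination (goldenRatio ^ 2 + goldenRatio + 2) * goldenRatio_sq

theorem goldenRatio_gt : 1.6 < goldenRatio := by
  nlinarith [goldenRatio_sq, one_lt_goldenRatio]

theorem goldenRatio_pow_le_pow {m n : ℕ} (h : m ≤ n) : goldenRatio ^ m ≤ goldenRatio ^ n :=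
  pow_le_pow_right₀ one_lt_goldenRatio.le h

theorem div_golden_pow_le {m : ℕ} (hm : 3 ≤ m) :
    2 * goldenRatio + 1 ≤ goldenRatio ^ m ∧ goldenRatio ^ 2 / goldenRatio ^ m ≤ goldenRatio - 1 := by
  have h3 := goldenRatio_pow_le_pow hm
  rw [goldenRatio_pow_three] at h3
  have hφ := goldenRatio_gt
  refine ⟨h3, ?_⟩
  rw [div_le_iff₀ (by positivity)]
  nlinarith [goldenRatio_sq]

theorem goldenNorm_halfPretzel_lt {m m' : ℕ} (hm : 3 ≤ m) (h : m < m') (s s' : ℤ) :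
    goldenNorm (halfPretzel m s) < goldenNorm (halfPretzel m' s') := by
  have h1 := (abs_le.1 (goldenNorm_halfPretzel m s)).2
  have h2 := (abs_le.1 (goldenNorm_halfPretzel m' s')).1
  obtain ⟨h3, h5⟩ := div_golden_pow_le hm
  obtain ⟨-, h6⟩ := div_golden_pow_le (hm.trans h.le)
  have h4 := goldenRatio_pow_le_pow (Nat.succ_le_of_lt h)
  rw [pow_succ] at h4
  nlinarith [goldenRatio_gt, goldenRatio_sq]

/-- The norms of the bracket of `M[m[1/2], [s]]` are close to each other. -/
theorem norms_halfPretzel {m : ℕ} (hm : 3 ≤ m) (s : ℤ) :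
    0 < goldenNorm (halfPretzel m s) ∧
    goldenNorm (halfPretzel m s) < goldenRatio * conjNorm (halfPretzel m s) ∧
      conjNorm (halfPretzel m s) < goldenRatio * goldenNorm (halfPretzel m s) := by
  have h1 := abs_le.1 (goldenNorm_halfPretzel m s)
  have h2 := abs_le.1 (conjNorm_halfPretzel m s)
  obtain ⟨h3, h5⟩ := div_golden_pow_le hm
  have hφ := goldenRatio_gt
  have hφ' := goldenRatio_sq
  refine ⟨by linarith, ?_, ?_⟩ <;> nlinarith

/-- The powers of `φ` depending on `m` cancel in the product of the two norms. As `2 * φ - 1 = √5`,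
the product determines `k`. -/
theorem norms_columnList {k m : ℕ} (hk : 1 ≤ k) {y : List (OnePoint ℚ)}
    (hy : IsColumnList k m y) : goldenNorm (montesinos y) * conjNorm (montesinos y) =
      goldenRatio ^ 2 * (2 * goldenRatio - 1) ^ k := by
  have hm : goldenRatio ^ m ≠ 0 := pow_ne_zero _ goldenRatio_ne_zero
  apply mul_left_cancel₀ hm
  have h := goldenNorm_columnList hk hy
  rw [conjNorm_columnList hk hy, ← goldenRoot_sq_mul, mul_pow, ← pow_mul, mul_comm 2 k, pow_mul,
    pow_add]
  linear_combination goldenRoot ^ k * (goldenRatio ^ k * goldenRatio ^ m) * h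

theorem norms_basicCount {L : LinkDiagram} {a b : ℕ} (h : BasicCount L a b 0) :
    goldenNorm L * conjNorm L = goldenRatio ^ 2 * (2 * goldenRatio - 1) ^ (a + 1) := by
  have hb : goldenRatio ^ b ≠ 0 := pow_ne_zero _ goldenRatio_ne_zero
  apply mul_left_cancel₀ hb
  have h' := conjNorm_basicCount h
  rw [goldenNorm_basicCount h, ← goldenRoot_sq_mul, mul_pow, mul_pow, ← pow_mul,
    mul_comm 2 (a + 1), pow_mul]
  rw [pow_zero, mul_one] at *
  linear_combination goldenRoot ^ (a + 1) * goldenRatio ^ (a + 1) * goldenRatio ^ b * h'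

theorem golden_pow_injective {k k' : ℕ}
    (h : goldenRatio ^ 2 * (2 * goldenRatio - 1) ^ k =
      goldenRatio ^ 2 * (2 * goldenRatio - 1) ^ k') : k = k' := by
  have h' := mul_left_cancel₀ (pow_ne_zero 2 goldenRatio_ne_zero) h
  have hφ := goldenRatio_gt
  exact pow_right_injective₀ (by linarith) (by linarith) h'

/-! ### Separation of the families by the two norms. -/

theorem columnList_injective {k m k' m' : ℕ} (hk : 1 ≤ k) (hk' : 1 ≤ k')
    {y y' : List (OnePoint ℚ)} (hy : IsColumnList k m y) (hy' : IsColumnList k' m' y')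
    (h : FiveMoveEquiv (montesinos y) (montesinos y')) : k = k' ∧ m = m' := by
  have h1 := norms_columnList hk hy
  rw [goldenNorm_equiv h, conjNorm_equiv h, norms_columnList hk' hy'] at h1
  obtain rfl := golden_pow_injective h1
  have h2 := conjNorm_columnList hk hy
  rw [conjNorm_equiv h, conjNorm_columnList hk' hy'] at h2
  have h3 := mul_left_cancel₀ (pow_ne_zero _ goldenRoot_pos.ne') h2
  have h4 := pow_right_injective₀ goldenRatio_pos one_lt_goldenRatio.ne' h3
  exact ⟨rfl, by omega⟩

/-- The norms of a pretzel link have ratio less than `φ`. For a column list this would give `k + 2 *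
n < 3`. -/
theorem halfPretzel_not_equiv_columnList {m : ℕ} (hm : 3 ≤ m) (s : ℤ) {k n : ℕ} (hk : 1 ≤ k)
    (hkn : 3 ≤ k + n) {y : List (OnePoint ℚ)} (hy : IsColumnList k n y) :
    ¬ FiveMoveEquiv (halfPretzel m s) (montesinos y) := by
  intro h
  obtain ⟨-, -, h0⟩ := norms_halfPretzel hm s
  rw [goldenNorm_equiv h, conjNorm_equiv h] at h0
  have h1 := goldenNorm_columnList hk hy
  rw [conjNorm_columnList hk hy] at h0
  have hn : 0 < goldenRatio ^ n := pow_pos goldenRatio_pos n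
  have hr : 0 < goldenRoot ^ k := pow_pos goldenRoot_pos k
  have h3 := goldenRatio_pow_le_pow (show 3 ≤ k + n + n by omega)
  have h4 := mul_lt_mul_of_pos_right h0 hn
  rw [mul_assoc _ (goldenNorm _), h1, mul_assoc, ← pow_add] at h4
  have h5 : goldenRoot ^ k * goldenRatio ^ (k + n + n) < goldenRoot ^ k * goldenRatio ^ 3 := by
    linarith
  exact absurd (lt_of_mul_lt_mul_left h5 hr.le) h3.not_gt

/-- The product of the norms gives `k = a + 1`, and the norm at `φ` then gives `a + 1 + b + m = 2`,
against `k + m ≥ 3`. A copy of `4₁` is impossible because the norm of a column list is positive. -/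
theorem columnList_not_equiv_basicSum {k m : ℕ} (hk : 1 ≤ k) (hkm : 3 ≤ k + m)
    {y : List (OnePoint ℚ)} (hy : IsColumnList k m y) {L : LinkDiagram} (hL : IsBasicSum L) :
    ¬ FiveMoveEquiv (montesinos y) L := by
  intro h
  obtain ⟨a, b, f, hL⟩ := hL.exists_count
  have h1 := goldenNorm_columnList hk hy
  rw [goldenNorm_equiv h, goldenNorm_basicCount hL] at h1
  have hr : 0 < goldenRoot ^ k := pow_pos goldenRoot_pos k
  obtain rfl | hf := eq_or_ne f 0
  · have h2 := norms_columnList hk hy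
    rw [goldenNorm_equiv h, conjNorm_equiv h, norms_basicCount hL] at h2
    obtain rfl := golden_pow_injective h2
    have h5 : goldenRatio ^ (a + 1 + b + m) = goldenRatio ^ 2 := by
      apply mul_left_cancel₀ hr.ne'
      rw [pow_zero, mul_pow] at h1
      rw [pow_add, pow_add]
      linear_combination h1
    have := pow_right_injective₀ goldenRatio_pos one_lt_goldenRatio.ne' h5
    omega
  · rw [zero_pow hf, mul_zero, zero_mul] at h1
    have : 0 < goldenRatio ^ 2 * goldenRoot ^ k := mul_pos (pow_pos goldenRatio_pos 2) hr
    linarith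

theorem golden_pow_lt {m n : ℕ} {r : ℝ} (hr : 0 < r)
    (h : r * goldenRatio ^ m < r * goldenRatio ^ n) : m < n :=
  (pow_lt_pow_iff_right₀ one_lt_goldenRatio).1 (lt_of_mul_lt_mul_left h hr.le)

theorem halfPretzel_not_equiv_basicSum {m : ℕ} (hm : 3 ≤ m) {s : ℤ} (hs : -2 ≤ s) (hs' : s ≤ 2)
    {L : LinkDiagram} (hL : IsBasicSum L) : ¬ FiveMoveEquiv (halfPretzel m s) L := by
  intro h
  obtain ⟨a, b, f, hL⟩ := hL.exists_count
  have h1 := goldenNorm_basicCount hL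
  have h2 := conjNorm_basicCount hL
  obtain ⟨k1, k3, k4⟩ := norms_halfPretzel hm s
  have h3 := abs_le.1 (goldenNorm_halfPretzel m s)
  rw [goldenNorm_equiv h] at k1 k3 k4 h3
  rw [conjNorm_equiv h] at k3 k4
  obtain rfl | hf := eq_or_ne f 0
  · rw [pow_zero, mul_one] at h1 h2
    have hb : 0 < goldenRatio ^ b := pow_pos goldenRatio_pos b
    have hr : 0 < goldenRoot ^ (a + 1) := pow_pos goldenRoot_pos _
    have l1 := mul_lt_mul_of_pos_right k3 hb
    have l2 := mul_lt_mul_of_pos_right k4 hb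
    rw [mul_assoc goldenRatio, h2, h1, mul_pow] at l1
    rw [mul_assoc goldenRatio, h2, h1, mul_pow] at l2
    have l1' : a + 1 + b + b < 3 := by
      exact golden_pow_lt hr (lt_of_eq_of_lt (by ring) (l1.trans_eq (by ring)))
    have l2' : 2 < a + 2 + b + b := by
      exact golden_pow_lt hr (lt_of_eq_of_lt (by ring) (l2.trans_eq (by ring)))
    -- The comparison of the norms leaves `0 < a + 2 * b < 2`, so the only candidate is `T₂`.
    obtain rfl : a = 1 := by omega
    obtain rfl : b = 0 := by omega
    -- The norm of `T₂` at `φ` is `φ + 2`, too small for `m ≥ 4`. For `m = 3` it equals the lower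
    -- bound `φ³ - φ⁻¹`, so the estimate decides nothing and the spin model is used.
    obtain rfl | hm' := hm.eq_or_lt
    · apply spinModel_halfPretzel_three hs hs'
      rw [spinModel_equiv (fiveMoveEquiv_iff.1 h), spinModel_basicCount hL rfl]
      rfl
    · have h4 := goldenRatio_pow_le_pow hm'
      rw [Nat.succ_eq_add_one, goldenRatio_pow_four] at h4
      obtain ⟨-, h5⟩ := div_golden_pow_le hm
      have h6 : goldenNorm L = goldenRatio + 2 := by
        rw [h1, mul_pow, goldenRoot_sq]
        linear_combination (2 - goldenRatio) * goldenRatio_sq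
      linarith [goldenRatio_gt]
  · rw [zero_pow hf, mul_zero] at h1
    linarith

end FiveMove

namespace FiveMove

/-! ## The parameter of the pretzel links -/

open Real

/-- A tenth root of unity other than `1` is far from `1`. -/
theorem lt_norm_one_sub {w : ℂ} (h : w ^ 10 = 1) (h1 : w ≠ 1) : 0.3 < ‖1 - w‖ ^ 2 := by
  have hw : ‖w‖ = 1 := Complex.norm_eq_one_of_pow_eq_one h (by norm_num)
  have hw0 : w ≠ 0 := by
    rintro rfl
    simp at hw
  have hre : w + w⁻¹ = ((2 * w.re : ℝ) : ℂ) := by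
    rw [Complex.inv_eq_conj hw, Complex.add_conj]
  rw [norm_one_sub_sq hw hre]
  have hinv : w * w⁻¹ = 1 := mul_inv_cancel₀ hw0
  have key : (w - 1) * ((w + 1) * ((w ^ 4 + w ^ 3 + w ^ 2 + w + 1) *
      (w ^ 4 - w ^ 3 + w ^ 2 - w + 1))) = 0 := by linear_combination h
  rcases mul_eq_zero.1 key with h2 | key
  · exact absurd (sub_eq_zero.1 h2) h1
  rcases mul_eq_zero.1 key with h2 | key
  · have : w = -1 := eq_neg_of_add_eq_zero_left h2
    rw [this]
    norm_num
  set t : ℝ := 2 * w.re with ht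
  -- For the roots of the fifth and tenth cyclotomic polynomials, `t = w + w⁻¹` satisfies `t² ± t -
  -- 1 = 0`. This keeps `2 - t` above `0.3`.
  rcases mul_eq_zero.1 key with h2 | h2
  · have h3 : ((t : ℝ) : ℂ) ^ 2 + t - 1 = 0 := by
      rw [← hre]
      generalize w⁻¹ = v at hinv
      clear hre ht
      grind
    have h4 : t ^ 2 + t - 1 = 0 := by exact_mod_cast h3
    nlinarith
  · have h3 : ((t : ℝ) : ℂ) ^ 2 - t - 1 = 0 := by
      rw [← hre]
      generalize w⁻¹ = v at hinv
      clear hre ht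
      grind
    have h4 : t ^ 2 - t - 1 = 0 := by exact_mod_cast h3
    nlinarith

/-! ### The exponent of the variable and the substitution of `iA` for `A`. -/

section

variable {K K' : Type*} [CommRing K] [CommRing K']

/-- The bracket of the link `M[m[1/2], [s]]`, up to a power of the variable. -/
def pretzelValue (A : Kˣ) (m : ℕ) (s : ℤ) : K :=
  golden A ^ 2 * (1 - ((A⁻¹ : Kˣ) : K) ^ 4) ^ m * ((A ^ (-s) : Kˣ) : K) +
    (-golden A) ^ m * (((-A ^ 3) ^ s : Kˣ) : K)

theorem map_pretzelValue (f : K →+* K') (A : Kˣ) (m : ℕ) (s : ℤ) :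
    f (pretzelValue A m s) = pretzelValue (Units.map f A) m s := by
  have h : ∀ u : Kˣ, f u = (Units.map (f : K →* K') u : K'ˣ) := fun _ => rfl
  have hneg : Units.map (f : K →* K') (-A ^ 3) = -(Units.map (f : K →* K') A) ^ 3 := by
    ext
    simp
  simp only [pretzelValue, golden, map_add, map_mul, map_pow, map_sub, map_neg, map_one, h,
    map_zpow, map_inv, hneg]

theorem pretzelValue_equiv {A : Kˣ} (hA : IsFiveRoot A) {m m' : ℕ} {s s' : ℤ}
    (h : FiveMoveEquiv (halfPretzel m s) (halfPretzel m' s')) :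
    ∃ n : ℤ, pretzelValue A m s = ((A ^ n : Kˣ) : K) * pretzelValue A m' s' := by
  obtain ⟨r, h⟩ := bracketValue_equiv hA h
  obtain ⟨r1, h1⟩ := bracketValue_eq ((vertexModel_isBracket A).eval_halfPretzel hA m s)
  obtain ⟨r2, h2⟩ := bracketValue_eq ((vertexModel_isBracket A).eval_halfPretzel hA m' s')
  rw [← pretzelValue] at h1 h2
  rw [h1, h2] at h
  refine ⟨-r1 + (r + r2), ?_⟩
  rw [zpow_add, zpow_add, Units.val_mul, Units.val_mul, mul_assoc, mul_assoc, ← h, ← mul_assoc,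
    ← Units.val_mul, zpow_neg, inv_mul_cancel, Units.val_one, one_mul]

end

/-- The complex number `i` as a unit. -/
noncomputable def unitI : ℂˣ := Units.mk0 Complex.I Complex.I_ne_zero

theorem golden_unitI_mul (A : ℂˣ) : golden (unitI * A) = golden A := by
  have h : ∀ z : ℂ, (Complex.I * z) ^ 4 = z ^ 4 := fun z => by
    rw [mul_pow, Complex.I_pow_four, one_mul]
  simp only [golden, Units.val_inv_eq_inv_val, Units.val_mul, unitI, Units.val_mk0, inv_pow, h]

/-- Fourth powers of the variable do not change, and `A ^ (-s)` and `(-A ^ 3) ^ s` acquire the same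
factor because `i³ = i⁻¹`. This factor shows `s` modulo 4. -/
theorem pretzelValue_unitI_mul (A : ℂˣ) (m : ℕ) (s : ℤ) :
    pretzelValue (unitI * A) m s = ((unitI ^ (-s) : ℂˣ) : ℂ) * pretzelValue A m s := by
  have h4 : (((unitI * A)⁻¹ : ℂˣ) : ℂ) ^ 4 = ((A⁻¹ : ℂˣ) : ℂ) ^ 4 := by
    rw [mul_inv, Units.val_mul, mul_pow]
    simp [unitI, Even.neg_pow (show Even 4 by decide)]
  have h3 : -(unitI * A) ^ 3 = unitI⁻¹ * (-A ^ 3) := by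
    ext
    simp [unitI, mul_pow, Complex.I_pow_three]
  rw [pretzelValue, pretzelValue, golden_unitI_mul, h4, h3, mul_zpow, mul_zpow, inv_zpow, zpow_neg,
    Units.val_mul, Units.val_mul]
  ring

theorem pretzelValue_eq (A : ℂˣ) (m : ℕ) (s : ℤ) :
    pretzelValue A m s = ((A ^ (-s) : ℂˣ) : ℂ) * (golden A ^ 2 * (1 - ((A⁻¹ : ℂˣ) : ℂ) ^ 4) ^ m +
      (-golden A) ^ m * (((-A ^ 4) ^ s : ℂˣ) : ℂ)) := by
  have h : -A ^ 4 = A * (-A ^ 3) := by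
    ext
    simp
    ring
  have h' : A ^ (-s) * A ^ s = 1 := by simp
  have h' : ((A ^ (-s) : ℂˣ) : ℂ) * ((A ^ s : ℂˣ) : ℂ) = 1 := by
    rw [← Units.val_mul, h', Units.val_one]
  rw [pretzelValue, h, mul_zpow, Units.val_mul]
  linear_combination -(-golden A) ^ m * (((-A ^ 3) ^ s : ℂˣ) : ℂ) * h'

theorem zpow_unitI {n : ℤ} (h : unitI ^ n = 1) : 4 ∣ n := by
  have h' : Complex.I ^ n = 1 := by
    have := congrArg Units.val h
    rwa [Units.val_zpow_eq_zpow_val] at this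
  exact_mod_cast (Complex.isPrimitiveRoot_I.zpow_eq_one_iff_dvd n).1 h'

theorem halfPretzel_injective {m : ℕ} (hm : 3 ≤ m) {s s' : ℤ} (hs : -2 ≤ s) (hs' : s ≤ 2)
    (ht : -2 ≤ s') (ht' : s' ≤ 2) (h : FiveMoveEquiv (halfPretzel m s) (halfPretzel m s')) :
    s = s' := by
  obtain ⟨A, hA, hc⟩ := exists_conj_variable
  have hfive := isFiveRoot_of_golden hc goldenConj_sq
  have hfive' : IsFiveRoot (unitI * A) := by
    apply isFiveRoot_of_golden _ goldenConj_sq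
    rw [golden_unitI_mul, hc]
  -- The bracket is taken over `ℂ × ℂ`, so that one exponent `n` serves for both `A` and `iA`.
  -- Separate evaluations would give two unrelated exponents.
  let B : (ℂ × ℂ)ˣ := MulEquiv.prodUnits.symm (A, unitI * A)
  have hB : IsFiveRoot B := Prod.ext hfive hfive'
  obtain ⟨n, hn⟩ := pretzelValue_equiv hB h
  have h1 := congrArg (RingHom.fst ℂ ℂ) hn
  have h2 := congrArg (RingHom.snd ℂ ℂ) hn
  rw [map_mul, map_pretzelValue, map_pretzelValue] at h1 h2
  have e1 : Units.map (RingHom.fst ℂ ℂ : ℂ × ℂ →* ℂ) B = A := rfl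
  have e2 : Units.map (RingHom.snd ℂ ℂ : ℂ × ℂ →* ℂ) B = unitI * A := rfl
  have f1 : RingHom.fst ℂ ℂ (B ^ n : (ℂ × ℂ)ˣ) = (A ^ n : ℂˣ) := by
    rw [← e1, ← map_zpow]
    rfl
  have f2 : RingHom.snd ℂ ℂ (B ^ n : (ℂ × ℂ)ˣ) = ((unitI * A) ^ n : ℂˣ) := by
    rw [← e2, ← map_zpow]
    rfl
  rw [e1, f1] at h1
  rw [e2, f2, pretzelValue_unitI_mul, pretzelValue_unitI_mul, h1, mul_zpow] at h2
  have e := pretzelValue_eq A m s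
  have e' := pretzelValue_eq A m s'
  set p : ℂ := golden A ^ 2 * (1 - ((A⁻¹ : ℂˣ) : ℂ) ^ 4) ^ m with hp
  set q : ℂ := (-golden A) ^ m with hq
  have hφ := goldenRatio_gt
  have hψ : goldenRatio ^ 2 * goldenConj ^ 2 = 1 := by
    rw [← mul_pow, goldenRatio_mul_goldenConj]
    norm_num
  have hp' : goldenRatio ^ 2 * ‖p‖ = goldenRatio ^ m := by
    rw [hp, hc, norm_mul, norm_pow, norm_pow, conj_one_sub_inv hA hc, Complex.norm_real,
      Real.norm_eq_abs, sq_abs, ← mul_assoc, hψ, one_mul]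
  have hq' : goldenRatio ^ m * ‖q‖ = 1 := by
    rw [hq, hc, norm_pow, norm_neg, Complex.norm_real, Real.norm_eq_abs, abs_goldenConj, ← mul_pow,
      mul_inv_cancel₀ goldenRatio_ne_zero, one_pow]
  obtain ⟨g1, g2⟩ := div_golden_pow_le hm
  have hqle : goldenRatio ^ 2 * ‖q‖ ≤ goldenRatio - 1 := by
    rwa [eq_one_div_of_mul_eq_one_right hq', mul_one_div]
  have hζ : ∀ j : ℤ, ‖(((-A ^ 4) ^ j : ℂˣ) : ℂ)‖ = 1 := fun j => by
    rw [Units.val_zpow_eq_zpow_val, norm_zpow, Units.val_neg, norm_neg, Units.val_pow_eq_pow_val,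
      norm_pow, hA, one_pow, one_zpow]
  have hA0 : ∀ j : ℤ, ((A ^ j : ℂˣ) : ℂ) ≠ 0 := fun j => Units.ne_zero _
  have hV : pretzelValue A m s' ≠ 0 := by
    rw [e']
    refine mul_ne_zero (hA0 _) fun h0 => ?_
    have h5 := congrArg norm (eq_neg_of_add_eq_zero_left h0)
    rw [norm_neg, norm_mul q, hζ, mul_one] at h5
    rw [h5] at hp'
    linarith
  -- The quotient of the two coordinates is an equation between powers of `i`, since the common
  -- value is nonzero.
  have h4 : 4 ∣ n + s - s' := by
    apply zpow_unitI
    have h5 : unitI ^ (-s) = unitI ^ n * unitI ^ (-s') := by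
      ext
      apply mul_right_cancel₀ (mul_ne_zero (hA0 n) hV)
      rw [h2]
      push_cast
      ring
    rw [add_sub_assoc, sub_eq_add_neg, zpow_add, zpow_add, mul_comm (unitI ^ s), ← mul_assoc, ← h5,
      ← zpow_add, neg_add_cancel, zpow_zero]
  obtain ⟨j, hj⟩ := h4
  set w : ℂˣ := (A ^ 4) ^ j with hw
  have hn' : n = -s + s' + 4 * j := by omega
  -- After division by `A ^ (-s)` the unknown factor is a power of `A ^ 4`, and by `A ^ 20 = -1`
  -- this is a tenth root of unity.
  have key : p + q * (((-A ^ 4) ^ s : ℂˣ) : ℂ) = w * (p + q * (((-A ^ 4) ^ s' : ℂˣ) : ℂ)) := by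
    apply mul_left_cancel₀ (hA0 (-s))
    rw [← e, h1, e', ← mul_assoc, ← mul_assoc, ← Units.val_mul, ← Units.val_mul, hn', hw,
      show (A ^ 4) ^ j = A ^ (4 * j) by rw [zpow_mul]; rfl, ← zpow_add, ← zpow_add]
    congr 3
    ring
  have hw10 : (w : ℂ) ^ 10 = 1 := by
    have h20 := hfive.pow_twenty
    have : w ^ 10 = 1 := by
      rw [hw, ← zpow_natCast, zpow_comm, zpow_natCast, ← pow_mul,
        show 4 * 10 = 20 * 2 from rfl, pow_mul, h20]
      simp
    rw [← Units.val_pow_eq_pow_val, this, Units.val_one]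
  have hw1 : (w : ℂ) = 1 := by
    -- Here `|p| = φ^(m-2)` far exceeds `|q| = φ^(-m)`. The equation `p (1 - w) = q (…)` puts `w`
    -- within `0.5` of `1`, nearer than any other tenth root of unity.
    by_contra hne
    have h6 := lt_norm_one_sub hw10 hne
    have hwn : ‖(w : ℂ)‖ = 1 := Complex.norm_eq_one_of_pow_eq_one hw10 (by norm_num)
    have h7 : p * (1 - w) = q * (w * (((-A ^ 4) ^ s' : ℂˣ) : ℂ) - (((-A ^ 4) ^ s : ℂˣ) : ℂ)) := by
      linear_combination key
    have h8 : ‖(w : ℂ) * (((-A ^ 4) ^ s' : ℂˣ) : ℂ) - (((-A ^ 4) ^ s : ℂˣ) : ℂ)‖ ≤ 2 := by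
      refine (norm_sub_le _ _).trans_eq ?_
      rw [norm_mul, hζ, hζ, hwn]
      norm_num
    have h9 : ‖p‖ * ‖1 - (w : ℂ)‖ ≤ ‖q‖ * 2 := by
      rw [← norm_mul, h7, norm_mul]
      gcongr
    have h10 : goldenRatio ^ m * ‖1 - (w : ℂ)‖ ≤ (goldenRatio - 1) * 2 := by
      rw [← hp']
      nlinarith
    have h11 : ‖1 - (w : ℂ)‖ ≤ 0.5 := by
      have := norm_nonneg (1 - (w : ℂ))
      nlinarith [goldenRatio_lt_two]
    have h12 := norm_nonneg (1 - (w : ℂ))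
    nlinarith
  rw [hw1, one_mul, add_right_inj] at key
  have hq0 : q ≠ 0 := by
    rintro h0
    rw [h0, norm_zero, mul_zero] at hq'
    exact zero_ne_one hq'
  have key' : (-A ^ 4) ^ s = (-A ^ 4) ^ s' := Units.ext (mul_left_cancel₀ hq0 key)
  have hζ5 : (-A ^ 4) ^ 5 = 1 := by
    rw [Odd.neg_pow (by decide), ← pow_mul, show 4 * 5 = 20 from rfl, hfive.pow_twenty, neg_neg]
  have hζ1 : -A ^ 4 ≠ 1 := by
    intro h0
    have h5 : A ^ 4 = -1 := by rw [← neg_eq_iff_eq_neg, h0]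
    have h6 : golden A = -2 := by
      rw [golden, ← Units.val_pow_eq_pow_val, ← Units.val_pow_eq_pow_val, inv_pow, h5]
      norm_num
    rw [hc] at h6
    have h7 : goldenConj = -2 := by exact_mod_cast h6
    linarith [neg_one_lt_goldenConj]
  have : orderOf (-A ^ 4) = 5 := by
    have : Fact (Nat.Prime 5) := ⟨by norm_num⟩
    exact orderOf_eq_prime hζ5 hζ1
  -- With `w = 1` only powers of `-A⁴`, of order five, are compared; since `|s - s'| ≤ 4`,
  -- divisibility by five gives equality.
  have h5 : ((5 : ℕ) : ℤ) ∣ s - s' := by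
    rw [← this, orderOf_dvd_iff_zpow_eq_one, zpow_sub, key', mul_inv_cancel]
  omega

end FiveMove

theorem theorem5p1 :
    -- (1) every Montesinos link is 5-move equivalent to a link of one of the three families
    (∀ x : List (OnePoint ℚ),
      (∃ (m : ℕ) (s : ℤ), 3 ≤ m ∧ -2 ≤ s ∧ s ≤ 2 ∧
        FiveMoveEquiv (montesinos x) (halfPretzel m s)) ∨
      (∃ (k m : ℕ) (y : List (OnePoint ℚ)), 1 ≤ k ∧ 3 ≤ k + m ∧ IsColumnList k m y ∧
        FiveMoveEquiv (montesinos x) (montesinos y)) ∨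
      (∃ L : LinkDiagram, IsBasicSum L ∧ FiveMoveEquiv (montesinos x) L)) ∧
    -- (2) the links of the first two families are pairwise inequivalent
    (∀ (m m' : ℕ) (s s' : ℤ), 3 ≤ m → 3 ≤ m' → -2 ≤ s → s ≤ 2 → -2 ≤ s' → s' ≤ 2 →
      FiveMoveEquiv (halfPretzel m s) (halfPretzel m' s') → m = m' ∧ s = s') ∧
    (∀ (k m k' m' : ℕ) (y y' : List (OnePoint ℚ)), 1 ≤ k → 3 ≤ k + m → 1 ≤ k' → 3 ≤ k' + m' →
      IsColumnList k m y → IsColumnList k' m' y' →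
      FiveMoveEquiv (montesinos y) (montesinos y') → k = k' ∧ m = m') ∧
    (∀ (m : ℕ) (s : ℤ) (k n : ℕ) (y : List (OnePoint ℚ)), 3 ≤ m → -2 ≤ s → s ≤ 2 →
      1 ≤ k → 3 ≤ k + n → IsColumnList k n y →
      ¬ FiveMoveEquiv (halfPretzel m s) (montesinos y)) ∧
    -- and they are not equivalent to any link of the third family
    (∀ (m : ℕ) (s : ℤ) (L : LinkDiagram), 3 ≤ m → -2 ≤ s → s ≤ 2 → IsBasicSum L →
      ¬ FiveMoveEquiv (halfPretzel m s) L) ∧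
    (∀ (k m : ℕ) (y : List (OnePoint ℚ)) (L : LinkDiagram), 1 ≤ k → 3 ≤ k + m →
      IsColumnList k m y → IsBasicSum L → ¬ FiveMoveEquiv (montesinos y) L) := by
  refine ⟨montesinos_cases, ?_, ?_, ?_, ?_, ?_⟩
  · intro m m' s s' hm hm' hs hs' ht ht' h
    have h1 := goldenNorm_equiv h
    rcases lt_trichotomy m m' with hlt | rfl | hlt
    · exact absurd h1 (goldenNorm_halfPretzel_lt hm hlt s s').ne
    · exact ⟨rfl, halfPretzel_injective hm hs hs' ht ht' h⟩
    · exact absurd h1 (goldenNorm_halfPretzel_lt hm' hlt s' s).ne'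
  · intro k m k' m' y y' hk _ hk' _ hy hy' h
    exact columnList_injective hk hk' hy hy' h
  · intro m s k n y hm _ _ hk hkn hy
    exact halfPretzel_not_equiv_columnList hm s hk hkn hy
  · intro m s L hm hs hs' hL
    exact halfPretzel_not_equiv_basicSum hm hs hs' hL
  · intro k m y L hk hkm hy hL
    exact columnList_not_equiv_basicSum hk hkm hy hL
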